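/- Let $d\ge 1$, $s,\gamma\in\mathbb R$, $0<q\le\infty$, $\langle x\rangle=(1+|x|^2)^{1/2}$, $T_xg(y)=g(y-x)$, $M_\xi g(y)=e^{2\pi i\xi\cdot y}g(y)$, $\hat f(\xi)=\int_{\mathbb R^d} e^{-2\pi i x\cdot\xi}f(x)\,dx$, and $V_gf(x,\xi)=\langle f,M_\xi T_xg\rangle$ (conjugate linear in the second entry) for $f\in\mathcal S'(\mathbb R^d)$, $g\in\mathcal S(\mathbb R^d)$. For $0<p\le\infty$ the modulation space $\mathcal M^{p,q}_s$ is the closure of $\mathcal S(\mathbb R^d)$ in $\mathcal S'(\mathbb R^d)$ with respect to $$\|f\|_{\mathcal M^{p,q}_s}=\Big(\int\Big(\int|V_gf(x,\xi)|^p\,dx\Big)^{q/p}\langle\xi\rangle^{sq}\,d\xi\Big)^{1/q}$$ (obvious modifications if $p=\infty$ or $q=\infty$). The window $g$ is any nonzero Schwartz function if $p,q\ge1$; if $p<1$ or $q<1$ it is any Schwartz function with $\operatorname{supp}\hat g\subset\{|\xi|\le1\}$ and $\sum_{k\in\mathbb Z^d}\hat g(\xi-\alpha k)=1$ for all $\xi$,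 for some $\alpha>0$. For $0<r\le1$, $W(\mathcal FL^r,L^\infty_\gamma)$ is the space of measurable functions $\sigma$ on $\mathbb R^d$, integrable against some power $(1+|\xi|)^{-N}$, with $$\|\sigma\|_{W(\mathcal FL^r,L^\infty_\gamma)}=\operatorname*{ess\,sup}_{x\in\mathbb R^d}\ \langle x\rangle^\gamma\,\|\mathcal F(\sigma\,T_xw)\|_{L^r}<\infty .$$ The window $w$ is any nonzero Schwartz function if $r=1$; if $r<1$ it is any nonzero Schwartz function that has compact support or satisfies $\operatorname{supp}\hat w\subset\{|\xi|\le1\}$. For such a $\sigma$ let $H_\sigma f(x)=\int_{\mathbb R^d}e^{2\pi i x\cdot\xi}\sigma(\xi)\hat f(\xi)\,d\xi$, $f\in\mathcal S(\mathbb R^d)$. For all admissible windows $g$, $w$: (i) If $1\le p\le\infty$, there is a constant $C$, depending only on $d,p,q,s,\gamma$ and the windows, such that for every $\sigma\in W(\mathcal FL^1,L^\infty_\gamma)$ the operator $H_\sigma$ extends to a bounded linear operator from $\mathcal M^{p,q}_s$ into $\mathcal M^{p,q}_{s+\gamma}$ with $$\|H_\sigma f\|_{\mathcal M^{p,q}_{s+\gamma}}\le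 C\,\|\sigma\|_{W(\mathcal FL^1,L^\infty_\gamma)}\,\|f\|_{\mathcal M^{p,q}_s}.$$ (ii) If $0<p<1$, there is a constant $C$, depending only on $d,p,q,s,\gamma$ and the windows, such that for every $\sigma\in W(\mathcal FL^p,L^\infty_\gamma)$ the operator $H_\sigma$ extends to a bounded linear operator from $\mathcal M^{p,q}_s$ into $\mathcal M^{p,q}_{s+\gamma}$ with $$\|H_\sigma f\|_{\mathcal M^{p,q}_{s+\gamma}}\le C\,\|\sigma\|_{W(\mathcal FL^p,L^\infty_\gamma)}\,\|f\|_{\mathcal M^{p,q}_s}.$$ Moreover, for every $f\in\mathcal M^{p,q}_s$, the distributions $\hat f$ and $\widehat{H_\sigma f}$ are functions, each integrable against some power $(1+|\xi|)^{-N}$, and $\widehat{H_\sigma f}=\sigma\hat f$. -/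

import Mathlib

open MeasureTheory Real FourierTransform SchwartzMap
open scoped ENNReal NNReal

noncomputable section

namespace ModulationMultiplier

/-- The Euclidean space `ℝᵈ`. -/
abbrev Rd (d : ℕ) := EuclideanSpace ℝ (Fin d)

variable {d : ℕ}

/-! ### Time-frequency shifts of Schwartz functions -/

/-- The character `y ↦ e^{2π i ξ·y}`. -/
def character (ξ : Rd d) (y : Rd d) : ℂ :=
  Complex.exp (((2 * π * inner ℝ ξ y : ℝ) : ℂ) * Complex.I)

theorem hasTemperateGrowth_exp_I :
    Function.HasTemperateGrowth (fun t : ℝ => Complex.exp ((t : ℂ) * Complex.I)) := by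
  have hsm : ContDiff ℝ (⊤ : ℕ∞) (fun t : ℝ => Complex.exp ((t : ℂ) * Complex.I)) := by
    have : ContDiff ℝ (⊤ : ℕ∞) (fun t : ℝ => (t : ℂ)) := Complex.ofRealCLM.contDiff
    fun_prop
  refine ⟨hsm, fun n => ⟨0, 1, fun t => ?_⟩⟩
  have key : ∀ n : ℕ, iteratedDeriv n (fun t : ℝ => Complex.exp ((t : ℂ) * Complex.I))
      = fun t : ℝ => Complex.I ^ n * Complex.exp ((t : ℂ) * Complex.I) := by
    intro n
    induction n with
    | zero => simp
    | succ n ih =>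
      rw [iteratedDeriv_succ, ih]
      funext t
      have h1 : HasDerivAt (fun t : ℝ => (t : ℂ) * Complex.I) (1 * Complex.I) t :=
        (Complex.ofRealCLM.hasDerivAt (x := t)).mul_const Complex.I
      have h2 := (h1.cexp).const_mul (Complex.I ^ n)
      rw [h2.deriv]
      ring
  rw [norm_iteratedFDeriv_eq_norm_iteratedDeriv, key]
  simp [Complex.norm_exp_ofReal_mul_I]

theorem hasTemperateGrowth_character (ξ : Rd d) :
    Function.HasTemperateGrowth (character ξ) := by
  have h : Function.HasTemperateGrowth (fun y : Rd d => 2 * π * inner ℝ ξ y) := by fun_prop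
  exact hasTemperateGrowth_exp_I.comp h

/-- The complex conjugate of the time-frequency shift `M_ξ T_x g`, where
`T_x g (y) = g (y - x)` and `M_ξ h (y) = e^{2π i ξ·y} h (y)`. -/
def conjShift (g : 𝓢(Rd d, ℂ)) (x ξ : Rd d) : 𝓢(Rd d, ℂ) :=
  SchwartzMap.smulLeftCLM ℂ (character (-ξ))
    (((g.compSubConstCLM ℝ x).postcompCLM Complex.conjCLE.toContinuousLinearMap))

theorem conjShift_apply (g : 𝓢(Rd d, ℂ)) (x ξ y : Rd d) :
    conjShift g x ξ y = (starRingEnd ℂ) (character ξ y * g (y - x)) := by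
  have hc : character (-ξ) y = (starRingEnd ℂ) (character ξ y) := by
    rw [character, character, ← Complex.exp_conj, map_mul, Complex.conj_ofReal, Complex.conj_I,
      inner_neg_left]
    push_cast
    ring_nf
  simp [conjShift, SchwartzMap.smulLeftCLM_apply_apply (hasTemperateGrowth_character (-ξ)), hc]

/-- The short-time Fourier transform `V_g f (x, ξ) = ⟨f, M_ξ T_x g⟩` of a tempered
distribution (the bracket being conjugate linear in the second entry). -/
def stft (g : 𝓢(Rd d, ℂ)) (f : 𝓢'(Rd d, ℂ)) (x ξ : Rd d) : ℂ :=
  f (conjShift g x ξ)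

/-! ### Modulation spaces -/

/-- The weight `⟨x⟩ˢ = (1 + |x|²)^{s/2}`. -/
def weight (s : ℝ) (x : Rd d) : ℝ≥0∞ :=
  ENNReal.ofReal ((1 + ‖x‖ ^ 2) ^ (s / 2))

/-- The (quasi-)norm of `M^{p,q}_s`: the `L^q` norm in `ξ`, with weight `⟨ξ⟩ˢ`, of the
`L^p` norm in `x` of the short-time Fourier transform; `∞` is an allowed value. -/
def modulationNorm (g : 𝓢(Rd d, ℂ)) (p q : ℝ≥0∞) (s : ℝ) (f : 𝓢'(Rd d, ℂ)) : ℝ≥0∞ :=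
  eLpNorm (fun ξ : Rd d => weight s ξ * eLpNorm (fun x : Rd d => stft g f x ξ) p volume)
    q volume

/-- The modulation space `M^{p,q}_s`: the closure of the Schwartz class, among the tempered
distributions, with respect to the modulation (quasi-)norm. -/
def modulationSpace (g : 𝓢(Rd d, ℂ)) (p q : ℝ≥0∞) (s : ℝ) : Set 𝓢'(Rd d, ℂ) :=
  {f | ∀ ε : ℝ≥0∞, 0 < ε → ∃ φ : 𝓢(Rd d, ℂ),
    modulationNorm g p q s (f - (φ : 𝓢'(Rd d, ℂ))) < ε}

/-- The windows used in the quasi-Banach range: `ĝ` is supported in the closed unit ball and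
`∑_{k ∈ ℤᵈ} ĝ (ξ - α k) = 1` for all `ξ`, for some `α > 0`. -/
def IsPartitionWindow (g : 𝓢(Rd d, ℂ)) : Prop :=
  tsupport (𝓕 g : 𝓢(Rd d, ℂ)) ⊆ Metric.closedBall 0 1 ∧
    ∃ α : ℝ, 0 < α ∧ ∀ ξ : Rd d,
      HasSum (fun k : Fin d → ℤ =>
        (𝓕 g : 𝓢(Rd d, ℂ)) (ξ - α • WithLp.toLp 2 (fun i => (k i : ℝ)))) 1

/-- Admissible windows for `M^{p,q}_s`: all nonzero Schwartz functions in the Banach range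
`p, q ≥ 1`, and the restricted class of windows otherwise. -/
def IsModulationWindow (p q : ℝ≥0∞) (g : 𝓢(Rd d, ℂ)) : Prop :=
  g ≠ 0 ∧ (p < 1 ∨ q < 1 → IsPartitionWindow g)

/-! ### Functions as tempered distributions, and Wiener amalgam spaces -/

/-- A (measurable) function on `ℝᵈ` that defines a tempered distribution by integration, in
that it is integrable against some negative power of `1 + |x|`. -/
def IsTemperedFunction (u : Rd d → ℂ) : Prop :=
  ∃ N : ℕ, Integrable (fun x : Rd d => (((1 + ‖x‖) ^ N)⁻¹ : ℝ) • u x) volume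

/-- The tempered distribution `T` is (given by integration against) the function `u`. -/
def Represents (T : 𝓢'(Rd d, ℂ)) (u : Rd d → ℂ) : Prop :=
  IsTemperedFunction u ∧ ∀ φ : 𝓢(Rd d, ℂ), T φ = ∫ x : Rd d, φ x * u x

/-- The (quasi-)norm of `W(𝓕 L^q_s, L^p_γ)`, with window `g`, of a tempered function `σ`:
the `L^p` norm in `x`, with weight `⟨x⟩^γ`, of the `L^q` norm in `y`, with weight `⟨y⟩ˢ`, of
the Fourier transform of `σ · T_x g`; `∞` is an allowed value. -/
def amalgamNorm (g : 𝓢(Rd d, ℂ)) (q : ℝ≥0∞) (s : ℝ) (p : ℝ≥0∞) (γ : ℝ) (σ : Rd d → ℂ) :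
    ℝ≥0∞ :=
  eLpNorm (fun x : Rd d => weight γ x *
    eLpNorm (fun y : Rd d => weight s y * ‖𝓕 (fun t : Rd d => σ t * g (t - x)) y‖ₑ) q volume)
    p volume

/-- Membership of a function in `W(𝓕 L^q_s, L^p_γ)`. -/
def MemAmalgam (g : 𝓢(Rd d, ℂ)) (q : ℝ≥0∞) (s : ℝ) (p : ℝ≥0∞) (γ : ℝ) (σ : Rd d → ℂ) :
    Prop :=
  IsTemperedFunction σ ∧ amalgamNorm g q s p γ σ < ∞

/-- Admissible windows for `W(𝓕 L^q_s, L^p_γ)` with `p ≥ 1`: all nonzero Schwartz functions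
if `q ≥ 1`; if `q < 1`, those that have compact support or whose Fourier transform is
supported in the closed unit ball. -/
def IsAmalgamWindow (q : ℝ≥0∞) (g : 𝓢(Rd d, ℂ)) : Prop :=
  g ≠ 0 ∧ (q < 1 → HasCompactSupport g ∨
    tsupport (𝓕 g : 𝓢(Rd d, ℂ)) ⊆ Metric.closedBall 0 1)

/-! ### Fourier multipliers -/

/-- `H_σ f (x) = ∫ e^{2π i x·ξ} σ(ξ) f̂(ξ) dξ` for a Schwartz function `f`. -/
def fourierMultiplier (σ : Rd d → ℂ) (f : 𝓢(Rd d, ℂ)) (x : Rd d) : ℂ :=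
  ∫ ξ : Rd d, character x ξ * (σ ξ * (𝓕 f : 𝓢(Rd d, ℂ)) ξ)

/-- `h = H_σ f` for tempered distributions: `f̂` is a function, and `ĥ` is the function
obtained as the product of `σ` and `f̂`. -/
def IsMultiplierImage (σ : Rd d → ℂ) (f h : 𝓢'(Rd d, ℂ)) : Prop :=
  ∃ F : Rd d → ℂ, Represents (𝓕 f) F ∧ Represents (𝓕 h) (fun ξ => σ ξ * F ξ)

/-- `H`, restricted to `M^{p,q}_s`, is a bounded linear operator from `M^{p,q}_s` into
`M^{p,q}_t` of (quasi-)norm at most `B`, and it extends `H_σ`. -/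
structure IsBoundedExtension (g : 𝓢(Rd d, ℂ)) (p q : ℝ≥0∞) (s t : ℝ) (σ : Rd d → ℂ)
    (B : ℝ≥0∞) (H : 𝓢'(Rd d, ℂ) → 𝓢'(Rd d, ℂ)) : Prop where
  /-- On Schwartz functions, `H` is the Fourier multiplier operator with symbol `σ`. -/
  extends_schwartz : ∀ f : 𝓢(Rd d, ℂ),
    Represents (H (f : 𝓢'(Rd d, ℂ))) (fourierMultiplier σ f)
  map_mem : ∀ f ∈ modulationSpace g p q s, H f ∈ modulationSpace g p q t
  linear : ∀ f₁ ∈ modulationSpace g p q s, ∀ f₂ ∈ modulationSpace g p q s, ∀ a b : ℂ,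
    a • f₁ + b • f₂ ∈ modulationSpace g p q s ∧ H (a • f₁ + b • f₂) = a • H f₁ + b • H f₂
  bound : ∀ f ∈ modulationSpace g p q s,
    modulationNorm g p q t (H f) ≤ B * modulationNorm g p q s f

end ModulationMultiplier

end

open ModulationMultiplier

noncomputable section

namespace ModulationMultiplier

open Filter Topology

variable {d : ℕ}

/-! ### Lebesgue quasi-norms of `ℝ≥0∞`-valued functions -/

section Lebesgue

variable {α β : Type*} [MeasurableSpace α] [MeasurableSpace β] {μ : Measure α} {ν : Measure β}

/-! On the Fourier side a multiplier is a multiplication. With `G` the conjugate of `ĝ`, the modulus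
of `V_g f (x, ξ)` is that of the Fourier transform of `f̂ · T_ξ G` at `-x`. So the modulation
quasi-norm of `f` is the mixed quasi-norm of `tf G f̂` (`modulationNorm_eq_mixN_tf`), and the
amalgam quasi-norm of `σ` is that of `tf w σ` with outer exponent `∞`. The transform of a product is
a convolution, so `tf G (σ Φ) (·, ξ)` should be dominated by `tf G Φ (·, ξ) * tf w σ (·, ξ)`;
Young's inequality in `x`, for each fixed `ξ`, would finish, the weights `⟨ξ⟩ˢ` and `⟨ξ⟩^γ`
multiplying.

There are two obstacles: changing windows smears the position `ξ`, and Young's inequality `L^p * L^p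
⊂ L^p` is false for general functions when `p < 1`. Both disappear when `tf` is replaced by its
Peetre maximal function `pmax m`, which changes by at most a polynomial factor under shifts. The
replacement is harmless: `tf` satisfies a reproducing inequality of every order
(`exists_tf_le_lintegral`), hence Peetre's maximal inequality with exponent `r = min (1, p, q)`
(`pmax_rpow_le`), and Minkowski's inequality in `L^(p/r)` and `L^(q/r)` makes the two mixed
quasi-norms equivalent (`exists_mixN_pmax_tf_le`). For slowly varying functions `L^p` embeds in
`L^1` when `p < 1`, which gives Young's inequality for all `p` (`exists_eLpNorm_conv_le`). With the
pointwise estimate `exists_tf_mul_le` this yields the bound `exists_mixN_tf_mul_le` for Schwartz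
functions.

The rest passes to closures. The quasi-norm controls the pairing with Schwartz functions
(`exists_enorm_integral_mul_le`), so the operator extends by continuity with values in tempered
distributions (`exists_extension`); injectivity of the short-time Fourier transform shows that
approximating Schwartz functions converge to the right distribution (`exists_enorm_sub_apply_le`).
The images lie in the closure of the Schwartz class, even for infinite exponents, because `σ φ̂` can
be mollified: dominated convergence holds for the finite exponents `min 1 p`, `min 1 q`, and slow
variation transfers it to `p`, `q` (`exists_schwartz_mixN_sub_lt`). For `p ≤ 1` the quasi-norm
bounds `⟨ξ⟩ˢ |f̂ (ξ)|` pointwise (`exists_weight_mul_enorm_le`), so transforms of approximants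
converge pointwise and dominated convergence gives the product formula. -/

theorem eLpNorm_mono_ennreal {f g : α → ℝ≥0∞} {p : ℝ≥0∞} (h : ∀ x, f x ≤ g x) :
    eLpNorm f p μ ≤ eLpNorm g p μ :=
  eLpNorm_mono_enorm fun x => by simpa using h x

theorem eLpNorm_ennreal_rpow (f : α → ℝ≥0∞) {p : ℝ≥0∞} {r : ℝ} (hr : 0 < r) :
    eLpNorm (fun x => f x ^ r) p μ = eLpNorm f (p * ENNReal.ofReal r) μ ^ r := by
  simpa using eLpNorm_enorm_rpow (p := p) (μ := μ) f hr

theorem eLpNorm_ennreal_eq_lintegral {p : ℝ≥0∞} (h0 : p ≠ 0) (htop : p ≠ ∞) (f : α → ℝ≥0∞) :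
    eLpNorm f p μ = (∫⁻ x, f x ^ p.toReal ∂μ) ^ (1 / p.toReal) := by
  simpa using eLpNorm_eq_lintegral_rpow_enorm_toReal (μ := μ) h0 htop (f := f)

theorem eLpNorm_ennreal_one (f : α → ℝ≥0∞) : eLpNorm f 1 μ = ∫⁻ x, f x ∂μ := by
  simp [eLpNorm_ennreal_eq_lintegral]

theorem eLpNorm_ennreal_top (f : α → ℝ≥0∞) : eLpNorm f ∞ μ = essSup f μ := by
  simp [eLpNorm_exponent_top, eLpNormEssSup]

/-- A finite constant can be pulled out with no measurability of `f`;
`eLpNorm_ennreal_const_mul_of_measurable` makes the opposite trade. -/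
theorem eLpNorm_ennreal_const_mul {c : ℝ≥0∞} (hc : c ≠ ∞) (f : α → ℝ≥0∞) (p : ℝ≥0∞) :
    eLpNorm (fun x => c * f x) p μ = c * eLpNorm f p μ := by
  rcases eq_or_ne p 0 with rfl | h0
  · simp
  rcases eq_or_ne p ∞ with rfl | htop
  · simp only [eLpNorm_ennreal_top]
    exact ENNReal.essSup_const_mul
  · have hp := ENNReal.toReal_pos h0 htop
    rw [eLpNorm_ennreal_eq_lintegral h0 htop, eLpNorm_ennreal_eq_lintegral h0 htop]
    simp_rw [ENNReal.mul_rpow_of_nonneg _ _ hp.le]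
    rw [lintegral_const_mul' _ _ (ENNReal.rpow_ne_top_of_nonneg hp.le hc),
      ENNReal.mul_rpow_of_nonneg _ _ (by positivity), ← ENNReal.rpow_mul,
      mul_one_div_cancel hp.ne', ENNReal.rpow_one]

theorem eLpNorm_ennreal_add_le {f g : α → ℝ≥0∞} (hf : Measurable f) (hg : Measurable g)
    (p : ℝ≥0∞) :
    eLpNorm (fun x => f x + g x) p μ ≤ p.LpAddConst * (eLpNorm f p μ + eLpNorm g p μ) :=
  eLpNorm_add_le' hf.aestronglyMeasurable hg.aestronglyMeasurable p

/-- Fatou's lemma for Lebesgue quasi-norms. -/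
theorem eLpNorm_liminf_le {f : ℕ → α → ℝ≥0∞} (hf : ∀ n, Measurable (f n)) (p : ℝ≥0∞) :
    eLpNorm (fun x => liminf (fun n => f n x) atTop) p μ
      ≤ liminf (fun n => eLpNorm (f n) p μ) atTop := by
  rcases eq_or_ne p 0 with rfl | h0
  · simp
  rcases eq_or_ne p ∞ with rfl | htop
  · simp only [eLpNorm_ennreal_top]
    refine essSup_le_of_ae_le _ ?_
    have h : ∀ᵐ x ∂μ, ∀ n, f n x ≤ essSup (f n) μ :=
      ae_all_iff.2 fun n => ENNReal.ae_le_essSup (f n)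
    filter_upwards [h] with x hx
    exact liminf_le_liminf (Eventually.of_forall hx)
  · have hp := ENNReal.toReal_pos h0 htop
    have hc : ∀ {t : ℝ}, 0 < t → ∀ u : ℕ → ℝ≥0∞,
        (liminf u atTop) ^ t = liminf (fun n => u n ^ t) atTop := fun {t} ht u =>
      Monotone.map_liminf_of_continuousAt (F := atTop) (f := fun y : ℝ≥0∞ => y ^ t)
        (ENNReal.monotone_rpow_of_nonneg ht.le) u
        ENNReal.continuous_rpow_const.continuousAt
    simp_rw [eLpNorm_ennreal_eq_lintegral h0 htop, hc hp]
    rw [← hc (by positivity)]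
    refine ENNReal.rpow_le_rpow ?_ (by positivity)
    exact lintegral_liminf_le fun n => (hf n).pow_const _

/-- **Minkowski's integral inequality**. -/
theorem eLpNorm_lintegral_le [SigmaFinite μ] [SFinite ν] {H : α → β → ℝ≥0∞}
    (hH : Measurable (Function.uncurry H)) {a : ℝ≥0∞} (ha : 1 ≤ a)
    (hN : Measurable fun y => eLpNorm (fun x => H x y) a μ) :
    eLpNorm (fun x => ∫⁻ y, H x y ∂ν) a μ ≤ ∫⁻ y, eLpNorm (fun x => H x y) a μ ∂ν := by
  have hF : Measurable fun x => ∫⁻ y, H x y ∂ν := hH.lintegral_prod_right'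
  have hHs : ∀ y, Measurable fun x => H x y := fun y => hH.comp measurable_prodMk_right
  rcases eq_or_ne a ∞ with rfl | htop
  · simp only [eLpNorm_ennreal_top] at hN ⊢
    refine essSup_le_of_ae_le _ ?_
    -- For `a = ∞` the point is to exchange the two almost-everywhere quantifiers, which needs the
    -- exceptional set to be measurable in the product.
    have h1 : ∀ᵐ y ∂ν, ∀ᵐ x ∂μ, H x y ≤ essSup (fun x => H x y) μ :=
      Eventually.of_forall fun y => ENNReal.ae_le_essSup _
    have h2 := (Measure.ae_ae_comm (μ := ν) (ν := μ)
      (p := fun y x => H x y ≤ essSup (fun x => H x y) μ)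
      (measurableSet_le (hH.comp measurable_swap) (hN.comp measurable_fst))).1 h1
    filter_upwards [h2] with x hx
    exact lintegral_mono_ae hx
  have h0 : a ≠ 0 := (zero_lt_one.trans_le ha).ne'
  rcases eq_or_lt_of_le ha with rfl | h1a
  · simp only [eLpNorm_ennreal_one]
    exact (lintegral_lintegral_swap hH.aemeasurable).le
  set F : α → ℝ≥0∞ := fun x => ∫⁻ y, H x y ∂ν with hFdef
  set M := ∫⁻ y, eLpNorm (fun x => H x y) a μ ∂ν with hM
  set t := a.toReal with ht
  have ht1 : 1 < t := by
    rw [ht, ← ENNReal.toReal_one]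
    exact (ENNReal.toReal_lt_toReal ENNReal.one_ne_top htop).2 h1a
  have ht0 : 0 < t := by linarith
  have hconj : t.HolderConjugate (t / (t - 1)) := Real.HolderConjugate.conjExponent ht1
  -- Truncation in height and to sets of finite measure makes `J` below finite, so that a power of
  -- it can be cancelled.
  let Fn : ℕ → α → ℝ≥0∞ := fun n => (spanningSets μ n).indicator fun x => min (F x) n
  have hFn : ∀ n, Measurable (Fn n) := fun n =>
    (hF.min measurable_const).indicator (measurableSet_spanningSets μ n)
  have hFnF : ∀ n x, Fn n x ≤ F x := fun n x =>
    (Set.indicator_le_self' (fun _ _ => zero_le) x).trans (min_le_left _ _)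
  have hmono : Monotone Fn := by
    intro n m hnm x
    refine Set.indicator_le_indicator_of_subset (monotone_spanningSets μ hnm)
      (fun _ => zero_le) x |>.trans ?_
    refine Set.indicator_le_indicator (min_le_min_left _ (by exact_mod_cast hnm))
  have hsup : ∀ x, ⨆ n, Fn n x = F x := by
    intro x
    refine le_antisymm (iSup_le fun n => hFnF n x) ?_
    have hx : ∃ k, x ∈ spanningSets μ k := by
      have : x ∈ ⋃ i, spanningSets μ i := iUnion_spanningSets μ ▸ Set.mem_univ x
      exact Set.mem_iUnion.1 this
    obtain ⟨k, hk⟩ := hx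
    refine le_of_forall_lt fun c hc => ?_
    obtain ⟨j, hj⟩ := ENNReal.exists_nat_gt (hc.ne_top)
    refine lt_of_lt_of_le ?_ (le_iSup _ (max j k))
    have hmem : x ∈ spanningSets μ (max j k) := monotone_spanningSets μ (le_max_right _ _) hk
    simp only [Fn, Set.indicator_of_mem hmem]
    refine lt_min hc (hj.trans_le ?_)
    exact_mod_cast le_max_left j k
  have hJ : ∀ n, (∫⁻ x, Fn n x ^ t ∂μ) ^ (1 / t) ≤ M := by
    intro n
    set J := ∫⁻ x, Fn n x ^ t ∂μ with hJdef
    have hJtop : J ≠ ∞ := by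
      have : J ≤ ∫⁻ x, (spanningSets μ n).indicator (fun _ => (n : ℝ≥0∞) ^ t) x ∂μ := by
        refine lintegral_mono fun x => ?_
        by_cases hx : x ∈ spanningSets μ n
        · simp only [Fn, Set.indicator_of_mem hx]
          exact ENNReal.rpow_le_rpow (min_le_right _ _) ht0.le
        · simp [Fn, Set.indicator_of_notMem hx, ht0]
      refine ne_top_of_le_ne_top ?_ this
      rw [lintegral_indicator_const (measurableSet_spanningSets μ n)]
      exact ENNReal.mul_ne_top (ENNReal.rpow_ne_top_of_nonneg ht0.le (by simp))
        (measure_spanningSets_lt_top μ n).ne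
    -- Duality argument: bound one factor of `Fn ^ t` by `F`, exchange the integrals, and apply
    -- Hölder in `x` to `H` and `Fn ^ (t - 1)`.
    have hstep : J ≤ M * J ^ (1 / (t / (t - 1))) := by
      calc J ≤ ∫⁻ x, ∫⁻ y, Fn n x ^ (t - 1) * H x y ∂ν ∂μ := by
            refine lintegral_mono fun x => ?_
            rw [lintegral_const_mul (Fn n x ^ (t - 1))
              (show Measurable fun y => H x y from hH.comp measurable_prodMk_left)]
            calc Fn n x ^ t = Fn n x ^ (t - 1) * Fn n x := by
                  have := ENNReal.rpow_add_of_nonneg (x := Fn n x) (t - 1) 1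
                    (by linarith) zero_le_one
                  rw [ENNReal.rpow_one] at this
                  rw [← this]; congr 1; ring
              _ ≤ _ := mul_le_mul' le_rfl (hFnF n x)
        _ = ∫⁻ y, ∫⁻ x, Fn n x ^ (t - 1) * H x y ∂μ ∂ν := by
            refine lintegral_lintegral_swap ?_
            exact ((((hFn n).comp measurable_fst).pow_const _).mul hH).aemeasurable
        _ ≤ ∫⁻ y, eLpNorm (fun x => H x y) a μ * J ^ (1 / (t / (t - 1))) ∂ν := by
            refine lintegral_mono fun y => ?_
            have := ENNReal.lintegral_mul_le_Lp_mul_Lq μ hconj (hHs y).aemeasurable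
              ((hFn n).pow_const (t - 1)).aemeasurable
            rw [eLpNorm_ennreal_eq_lintegral h0 htop]
            refine le_trans (le_of_eq ?_) (this.trans (le_of_eq ?_))
            · exact lintegral_congr fun x => by simp [mul_comm]
            · simp_rw [← ENNReal.rpow_mul]
              rw [mul_div_cancel₀ t (by linarith : t - 1 ≠ 0)]
        _ = M * J ^ (1 / (t / (t - 1))) := by
            rw [lintegral_mul_const _ hN]
    rcases eq_or_ne J 0 with h | h
    · simp [h, ht0]
    have hsplit : J = J ^ (1 / t) * J ^ (1 / (t / (t - 1))) := by
      rw [← ENNReal.rpow_add _ _ h hJtop]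
      have : 1 / t + 1 / (t / (t - 1)) = 1 := by field_simp; ring
      rw [this, ENNReal.rpow_one]
    have hne : J ^ (1 / (t / (t - 1))) ≠ 0 := by
      simp [ENNReal.rpow_eq_zero_iff, h, hJtop]
    have hne' : J ^ (1 / (t / (t - 1))) ≠ ∞ :=
      ENNReal.rpow_ne_top_of_nonneg (by have : 0 < t - 1 := by linarith
                                        positivity) hJtop
    exact (ENNReal.mul_le_mul_iff_left hne hne').1 (hsplit ▸ hstep)
  rw [eLpNorm_ennreal_eq_lintegral h0 htop]
  have hlim : ∫⁻ x, F x ^ t ∂μ = ⨆ n, ∫⁻ x, Fn n x ^ t ∂μ := by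
    rw [← lintegral_iSup (fun n => (hFn n).pow_const t)
      (fun n m h x => ENNReal.rpow_le_rpow (hmono h x) ht0.le)]
    refine lintegral_congr fun x => ?_
    rw [← hsup x]
    exact (ENNReal.orderIsoRpow t ht0).map_iSup _
  rw [hlim]
  have : (⨆ n, ∫⁻ x, Fn n x ^ t ∂μ) ≤ M ^ t := by
    refine iSup_le fun n => ?_
    have := ENNReal.rpow_le_rpow (hJ n) ht0.le
    rwa [← ENNReal.rpow_mul, one_div_mul_cancel ht0.ne', ENNReal.rpow_one] at this
  have := ENNReal.rpow_le_rpow this (by positivity : 0 ≤ 1 / t)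
  rwa [← ENNReal.rpow_mul, mul_one_div_cancel ht0.ne', ENNReal.rpow_one] at this

end Lebesgue

/-! ### Polynomial weights -/

section Weights

variable {E : Type*} [NormedAddCommGroup E]

/-- The weight `1 + ‖x‖`. -/
def bw (x : E) : ℝ≥0∞ := 1 + ‖x‖ₑ

theorem one_le_bw (x : E) : 1 ≤ bw x := le_self_add

theorem bw_ne_zero (x : E) : bw x ≠ 0 := (zero_lt_one.trans_le (one_le_bw x)).ne'

theorem bw_ne_top (x : E) : bw x ≠ ∞ := by simp [bw]

theorem bw_rpow_ne_zero (x : E) (m : ℝ) : bw x ^ m ≠ 0 := by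
  simp [ENNReal.rpow_eq_zero_iff, bw_ne_zero, bw_ne_top]

theorem bw_rpow_ne_top (x : E) (m : ℝ) : bw x ^ m ≠ ∞ := by
  simp [ENNReal.rpow_eq_top_iff, bw_ne_zero, bw_ne_top]

theorem bw_rpow_add (x : E) (a b : ℝ) : bw x ^ (a + b) = bw x ^ a * bw x ^ b :=
  ENNReal.rpow_add _ _ (bw_ne_zero x) (bw_ne_top x)

theorem bw_rpow_neg_mul (x : E) (m : ℝ) : bw x ^ (-m) * bw x ^ m = 1 := by
  rw [← bw_rpow_add]; simp

theorem bw_rpow_mono (x : E) {a b : ℝ} (h : a ≤ b) : bw x ^ a ≤ bw x ^ b :=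
  ENNReal.rpow_le_rpow_of_exponent_le (one_le_bw x) h

theorem bw_zero : bw (0 : E) = 1 := by simp [bw]

theorem bw_neg (x : E) : bw (-x) = bw x := by simp [bw]

theorem bw_sub_comm (x y : E) : bw (x - y) = bw (y - x) := by rw [← bw_neg, neg_sub]

/-- This submultiplicativity makes all weights moderate: a shift costs a power of `bw` of the shift,
whatever the sign of the exponent of the weight. -/
theorem bw_add_le (x y : E) : bw (x + y) ≤ bw x * bw y := by
  unfold bw
  calc 1 + ‖x + y‖ₑ ≤ 1 + (‖x‖ₑ + ‖y‖ₑ) := by gcongr; exact enorm_add_le x y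
    _ ≤ 1 + (‖x‖ₑ + ‖y‖ₑ) + ‖x‖ₑ * ‖y‖ₑ := le_self_add
    _ = (1 + ‖x‖ₑ) * (1 + ‖y‖ₑ) := by ring

theorem bw_rpow_le_mul (x y : E) {m : ℝ} (hm : 0 ≤ m) :
    bw x ^ m ≤ bw y ^ m * bw (x - y) ^ m := by
  rw [← ENNReal.mul_rpow_of_nonneg _ _ hm]
  refine ENNReal.rpow_le_rpow ?_ hm
  simpa using bw_add_le y (x - y)

theorem bw_rpow_neg_le_mul (x y : E) {m : ℝ} (hm : 0 ≤ m) :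
    bw x ^ (-m) ≤ bw y ^ (-m) * bw (x - y) ^ m := by
  have h := bw_rpow_le_mul y x hm
  rw [bw_sub_comm] at h
  calc bw x ^ (-m) = bw x ^ (-m) * (bw y ^ (-m) * bw y ^ m) := by
        rw [bw_rpow_neg_mul, mul_one]
    _ ≤ bw x ^ (-m) * (bw y ^ (-m) * (bw x ^ m * bw (x - y) ^ m)) := by gcongr
    _ = (bw x ^ (-m) * bw x ^ m) * (bw y ^ (-m) * bw (x - y) ^ m) := by ring
    _ = _ := by rw [bw_rpow_neg_mul, one_mul]

theorem continuous_bw : Continuous (bw : E → ℝ≥0∞) := by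
  unfold bw; fun_prop

@[fun_prop]
theorem measurable_bw [MeasurableSpace E] [BorelSpace E] : Measurable (bw : E → ℝ≥0∞) :=
  continuous_bw.measurable

theorem continuous_bw_rpow (m : ℝ) : Continuous fun x : E => bw x ^ m :=
  ENNReal.continuous_rpow_const.comp continuous_bw

theorem bw_eq_ofReal (x : E) : bw x = ENNReal.ofReal (1 + ‖x‖) := by
  rw [bw, ENNReal.ofReal_add zero_le_one (norm_nonneg x), ENNReal.ofReal_one, ofReal_norm]

theorem bw_rpow_eq_ofReal (x : E) (m : ℝ) : bw x ^ m = ENNReal.ofReal ((1 + ‖x‖) ^ m) := by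
  rw [bw_eq_ofReal, ENNReal.ofReal_rpow_of_pos (by positivity)]

theorem lintegral_bw_rpow_neg_lt_top [NormedSpace ℝ E] [FiniteDimensional ℝ E]
    [MeasurableSpace E] [BorelSpace E] (μ : Measure E) [μ.IsAddHaarMeasure] {m : ℝ}
    (hm : (Module.finrank ℝ E : ℝ) < m) : ∫⁻ x, bw x ^ (-m) ∂μ < ∞ := by
  simpa only [bw_rpow_eq_ofReal] using finite_integral_one_add_norm (μ := μ) hm

theorem bw_prod_le {F : Type*} [NormedAddCommGroup F] (x : E) (y : F) :
    bw (x, y) ≤ bw x * bw y := by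
  simp only [bw_eq_ofReal, Prod.norm_def]
  rw [← ENNReal.ofReal_mul (by positivity)]
  refine ENNReal.ofReal_le_ofReal ?_
  have h1 := norm_nonneg x
  have h2 := norm_nonneg y
  rcases max_cases ‖x‖ ‖y‖ with ⟨h, -⟩ | ⟨h, -⟩ <;> rw [h] <;> nlinarith

theorem bw_fst_le {F : Type*} [NormedAddCommGroup F] (x : E) (y : F) : bw x ≤ bw (x, y) := by
  simp only [bw_eq_ofReal, Prod.norm_def]
  gcongr
  exact le_max_left _ _

theorem bw_snd_le {F : Type*} [NormedAddCommGroup F] (x : E) (y : F) : bw y ≤ bw (x, y) := by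
  simp only [bw_eq_ofReal, Prod.norm_def]
  gcongr
  exact le_max_right _ _

theorem bw_prod_rpow_le {F : Type*} [NormedAddCommGroup F] (x : E) (y : F) {m : ℝ} (hm : 0 ≤ m) :
    bw (x, y) ^ m ≤ bw x ^ m * bw y ^ m := by
  rw [← ENNReal.mul_rpow_of_nonneg _ _ hm]
  exact ENNReal.rpow_le_rpow (bw_prod_le x y) hm

theorem mul_bw_rpow_neg_le_prod {F : Type*} [NormedAddCommGroup F] (x : E) (y : F) {m : ℝ}
    (hm : 0 ≤ m) : bw x ^ (-m) * bw y ^ (-m) ≤ bw (x, y) ^ (-m) := by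
  simp only [ENNReal.rpow_neg]
  rw [← ENNReal.mul_inv (Or.inl (bw_rpow_ne_zero _ _)) (Or.inl (bw_rpow_ne_top _ _))]
  exact ENNReal.inv_le_inv.2 (bw_prod_rpow_le x y hm)

/-- `bw (x, y)` dominates both `bw x` and `bw y`, so half of the decay is spent on each component.
-/
theorem bw_prod_rpow_neg_le {F : Type*} [NormedAddCommGroup F] (x : E) (y : F) {m : ℝ}
    (hm : 0 ≤ m) : bw (x, y) ^ (-(2 * m)) ≤ bw x ^ (-m) * bw y ^ (-m) := by
  rw [show -(2 * m) = -m + -m by ring, bw_rpow_add]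
  simp only [ENNReal.rpow_neg]
  gcongr
  · exact bw_fst_le x y
  · exact bw_snd_le x y

theorem weight_ne_top {d : ℕ} (s : ℝ) (x : Rd d) : weight s x ≠ ∞ := ENNReal.ofReal_ne_top

theorem weight_ne_zero {d : ℕ} (s : ℝ) (x : Rd d) : weight s x ≠ 0 := by
  simp only [weight, ne_eq, ENNReal.ofReal_eq_zero, not_le]; positivity

theorem continuous_weight {d : ℕ} (s : ℝ) : Continuous (weight s : Rd d → ℝ≥0∞) := by
  refine ENNReal.continuous_ofReal.comp ?_
  refine Continuous.rpow_const (by fun_prop) fun x => Or.inl (by positivity)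

theorem weight_add {d : ℕ} (s t : ℝ) (x : Rd d) : weight (s + t) x = weight s x * weight t x := by
  rw [weight, weight, weight, ← ENNReal.ofReal_mul (by positivity),
    ← Real.rpow_add (by positivity), add_div]

theorem weight_zero {d : ℕ} (x : Rd d) : weight 0 x = 1 := by simp [weight]

theorem weight_le_mul {d : ℕ} (s : ℝ) (x y : Rd d) :
    weight s x ≤ weight s y * bw (x - y) ^ |s| := by
  have key : ∀ x y : Rd d, 1 + ‖x‖ ^ 2 ≤ (1 + ‖y‖ ^ 2) * (1 + ‖x - y‖) ^ 2 := by
    intro x y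
    have h1 : ‖x‖ ≤ ‖y‖ + ‖x - y‖ := by simpa using norm_add_le y (x - y)
    have h2 : ‖x‖ ^ 2 ≤ (‖y‖ + ‖x - y‖) ^ 2 := by gcongr
    have h3 := norm_nonneg y
    have h4 := norm_nonneg (x - y)
    -- After `h2`, the two sides of the claim differ exactly by `2 ‖x - y‖ (1 + ‖y‖² - ‖y‖) + ‖y‖²
    -- ‖x - y‖²`.
    have h5 : 0 ≤ ‖x - y‖ * (1 + ‖y‖ ^ 2 - ‖y‖) :=
      mul_nonneg h4 (by nlinarith [sq_nonneg (‖y‖ - 1)])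
    have h6 : 0 ≤ ‖y‖ ^ 2 * ‖x - y‖ ^ 2 := by positivity
    nlinarith
  have hpow : ∀ t : ℝ, ((1 + ‖x - y‖) ^ 2) ^ (t / 2) = (1 + ‖x - y‖) ^ t := by
    intro t
    rw [← Real.rpow_natCast, ← Real.rpow_mul (by positivity)]
    congr 1; push_cast; ring
  rw [weight, weight, bw_rpow_eq_ofReal, ← ENNReal.ofReal_mul (by positivity)]
  refine ENNReal.ofReal_le_ofReal ?_
  rcases le_total 0 s with hs | hs
  · rw [abs_of_nonneg hs, ← hpow, ← Real.mul_rpow (by positivity) (by positivity)]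
    exact Real.rpow_le_rpow (by positivity) (key x y) (by positivity)
  -- For negative `s`, exchange `x` and `y` and invert.
  · rw [abs_of_nonpos hs, ← hpow]
    have h := key y x
    rw [norm_sub_rev] at h
    have h2 := Real.rpow_le_rpow (by positivity) h (by linarith : 0 ≤ -s / 2)
    rw [Real.mul_rpow (by positivity) (by positivity)] at h2
    have e1 : ∀ z : ℝ, 0 < z → z ^ (s / 2) = (z ^ (-s / 2))⁻¹ := by
      intro z hz; rw [← Real.rpow_neg hz.le]; congr 1; ring
    rw [e1 _ (by positivity : 0 < 1 + ‖x‖ ^ 2), e1 _ (by positivity : 0 < 1 + ‖y‖ ^ 2)]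
    have p1 : 0 < (1 + ‖x‖ ^ 2) ^ (-s / 2) := by positivity
    have p2 : 0 < (1 + ‖y‖ ^ 2) ^ (-s / 2) := by positivity
    rw [inv_mul_eq_div, le_div_iff₀ p2, inv_mul_le_iff₀ p1]
    exact h2

end Weights

/-! ### Slowly varying functions -/

section SlowVariation

variable {E : Type*} [NormedAddCommGroup E]

/-- `h` varies by at most the factor `(1 + ‖x - y‖) ^ m` between `x` and `y`. -/
def SlowlyVarying (m : ℝ) (h : E → ℝ≥0∞) : Prop :=
  ∀ x y, h x ≤ h y * bw (x - y) ^ m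

theorem SlowlyVarying.mul {m n : ℝ} {f g : E → ℝ≥0∞} (hf : SlowlyVarying m f)
    (hg : SlowlyVarying n g) : SlowlyVarying (m + n) fun x => f x * g x := fun x y => by
  rw [bw_rpow_add]
  calc f x * g x ≤ (f y * bw (x - y) ^ m) * (g y * bw (x - y) ^ n) := mul_le_mul' (hf x y) (hg x y)
    _ = _ := by ring

theorem slowlyVarying_weight {d : ℕ} (s : ℝ) : SlowlyVarying |s| (weight s : Rd d → ℝ≥0∞) :=
  weight_le_mul s

theorem SlowlyVarying.sub_left {m : ℝ} {f : E → ℝ≥0∞} (hf : SlowlyVarying m f) (x : E) :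
    SlowlyVarying m fun y => f (x - y) := fun y z => by
  have := hf (x - y) (x - z)
  rwa [sub_sub_sub_cancel_left, bw_sub_comm] at this

variable [NormedSpace ℝ E] [FiniteDimensional ℝ E] [MeasurableSpace E] [BorelSpace E]
  (μ : Measure E) [μ.IsAddHaarMeasure]

/-- A slowly varying function is bounded by its Lebesgue quasi-norms. -/
theorem exists_slowlyVarying_le_eLpNorm {m : ℝ} (hm : 0 ≤ m) {p : ℝ≥0∞} (hp : p ≠ 0) :
    ∃ C : ℝ≥0, ∀ h : E → ℝ≥0∞, SlowlyVarying m h → ∀ x, h x ≤ C * eLpNorm h p μ := by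
  -- For `p = ∞` the exponent is `1 / 0 = 0`, so `v = 1`, as the essential supremum requires.
  set v := μ (Metric.ball (0 : E) 1) ^ (1 / p.toReal) with hv
  have hvol : ∀ x : E, μ (Metric.ball x 1) = μ (Metric.ball (0 : E) 1) := fun x =>
    Measure.addHaar_ball_center μ x 1
  have hpos : μ (Metric.ball (0 : E) 1) ≠ 0 := (Metric.measure_ball_pos μ 0 one_pos).ne'
  have hfin : μ (Metric.ball (0 : E) 1) ≠ ∞ := measure_ball_lt_top.ne
  have hv0 : v ≠ 0 := by simp [hv, ENNReal.rpow_eq_zero_iff, hpos, hfin]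
  have hvt : v ≠ ∞ := ENNReal.rpow_ne_top_of_nonneg (by positivity) hfin
  have h2 : ((2 : ℝ≥0∞) ^ m) ≠ ∞ := ENNReal.rpow_ne_top_of_nonneg hm (by simp)
  refine ⟨((2 : ℝ≥0∞) ^ m * v⁻¹).toNNReal, fun h hh x => ?_⟩
  rw [ENNReal.coe_toNNReal (ENNReal.mul_ne_top h2 (ENNReal.inv_ne_top.2 hv0))]
  -- On the unit ball about `x` the function is at least `2 ^ (-m) * h x`; integrate this over the
  -- ball.
  have key : eLpNorm ((Metric.ball x 1).indicator fun _ => h x) p μ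
      ≤ (2 : ℝ≥0∞) ^ m * eLpNorm h p μ := by
    rw [← eLpNorm_ennreal_const_mul h2]
    refine eLpNorm_mono_ennreal fun y => ?_
    by_cases hy : y ∈ Metric.ball x 1
    · rw [Set.indicator_of_mem hy]
      refine (hh x y).trans ?_
      rw [mul_comm]
      gcongr
      rw [bw_eq_ofReal, ← ENNReal.ofReal_ofNat]
      refine ENNReal.ofReal_le_ofReal ?_
      rw [Metric.mem_ball, dist_eq_norm, norm_sub_rev] at hy
      linarith
    · simp [Set.indicator_of_notMem hy]
  rw [eLpNorm_indicator_const' measurableSet_ball (by rw [hvol]; exact hpos) hp, hvol,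
    enorm_eq_self] at key
  calc h x = h x * v * v⁻¹ := by rw [mul_assoc, ENNReal.mul_inv_cancel hv0 hvt, mul_one]
    _ ≤ (2 : ℝ≥0∞) ^ m * eLpNorm h p μ * v⁻¹ := by gcongr
    _ = _ := by ring

/-- For slowly varying functions, Lebesgue quasi-norms decrease with the exponent. -/
theorem exists_slowlyVarying_eLpNorm_le {m : ℝ} (hm : 0 ≤ m) {r p : ℝ≥0∞} (hr : r ≠ 0)
    (hrp : r ≤ p) :
    ∃ C : ℝ≥0, ∀ h : E → ℝ≥0∞, SlowlyVarying m h → eLpNorm h p μ ≤ C * eLpNorm h r μ := by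
  obtain ⟨C, hC⟩ := exists_slowlyVarying_le_eLpNorm μ hm hr
  have hp : p ≠ 0 := (pos_iff_ne_zero.2 hr |>.trans_le hrp).ne'
  rcases eq_or_ne p ∞ with rfl | hptop
  · refine ⟨C, fun h hh => ?_⟩
    rw [eLpNorm_ennreal_top]
    exact essSup_le_of_ae_le _ (Eventually.of_forall (hC h hh))
  have hrtop : r ≠ ∞ := ne_top_of_le_ne_top hptop hrp
  have hr0 := ENNReal.toReal_pos hr hrtop
  have hp0 := ENNReal.toReal_pos hp hptop
  have hle : r.toReal ≤ p.toReal := (ENNReal.toReal_le_toReal hrtop hptop).2 hrp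
  refine ⟨C ^ ((p.toReal - r.toReal) / p.toReal), fun h hh => ?_⟩
  set N := eLpNorm h r μ with hN
  have hNr : ∫⁻ x, h x ^ r.toReal ∂μ = N ^ r.toReal := by
    rw [hN, eLpNorm_ennreal_eq_lintegral hr hrtop, ← ENNReal.rpow_mul,
      one_div_mul_cancel hr0.ne', ENNReal.rpow_one]
  -- An infinite right side is harmless unless the constant vanishes, and then the pointwise bound
  -- forces `h = 0`.
  rcases eq_or_ne N ∞ with hNt | hNt
  · rw [hNt]
    rcases eq_or_ne ((C : ℝ≥0∞) ^ ((p.toReal - r.toReal) / p.toReal)) 0 with h0 | h0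
    · rw [ENNReal.rpow_eq_zero_iff_of_pos] at h0
      · have hz : ∀ x, h x = 0 := fun x => by simpa [h0] using hC h hh x
        simp [funext hz] at hN ⊢
      · by_contra hcon
        have : (p.toReal - r.toReal) / p.toReal = 0 := le_antisymm (not_lt.1 hcon) (by
          apply div_nonneg <;> linarith)
        simp [this] at h0
    · have h0' : ((C ^ ((p.toReal - r.toReal) / p.toReal) : ℝ≥0) : ℝ≥0∞) ≠ 0 := by
        rwa [ENNReal.coe_rpow_of_nonneg _ (by apply div_nonneg <;> linarith)]
      rw [ENNReal.mul_top h0']; exact le_top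
  rw [eLpNorm_ennreal_eq_lintegral hp hptop]
  -- Of the `p` powers of `h`, all but `r` are estimated by the pointwise bound `C * N`.
  have h1 : ∫⁻ x, h x ^ p.toReal ∂μ ≤ (C * N) ^ (p.toReal - r.toReal) * N ^ r.toReal := by
    rw [← hNr, ← lintegral_const_mul' _ _
      (ENNReal.rpow_ne_top_of_nonneg (by linarith) (ENNReal.mul_ne_top (by simp) hNt))]
    refine lintegral_mono fun x => ?_
    calc h x ^ p.toReal = h x ^ (p.toReal - r.toReal) * h x ^ r.toReal := by
          rw [← ENNReal.rpow_add_of_nonneg _ _ (by linarith) hr0.le]; congr 1; ring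
      _ ≤ _ := by
          exact mul_le_mul' (ENNReal.rpow_le_rpow (hC h hh x) (by linarith)) le_rfl
  calc _ ≤ ((C * N) ^ (p.toReal - r.toReal) * N ^ r.toReal) ^ (1 / p.toReal) :=
        ENNReal.rpow_le_rpow h1 (by positivity)
    _ = (C ^ (p.toReal - r.toReal) * N ^ p.toReal) ^ (1 / p.toReal) := by
        rw [ENNReal.mul_rpow_of_nonneg _ N (by linarith : 0 ≤ p.toReal - r.toReal), mul_assoc,
          ← ENNReal.rpow_add_of_nonneg _ _ (by linarith) hr0.le]
        congr 3; ring
    _ = _ := by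
        rw [ENNReal.mul_rpow_of_nonneg _ _ (by positivity), ← ENNReal.rpow_mul,
          ← ENNReal.rpow_mul, mul_one_div_cancel hp0.ne', ENNReal.rpow_one,
          ENNReal.coe_rpow_of_nonneg _ (by apply div_nonneg <;> linarith), mul_one_div]

end SlowVariation

/-! ### Measurability of the norms of slices. -/

theorem eLpNorm_ennreal_const_mul_of_measurable {α : Type*} [MeasurableSpace α] {μ : Measure α}
    (c : ℝ≥0∞) {f : α → ℝ≥0∞} (hf : Measurable f) (p : ℝ≥0∞) :
    eLpNorm (fun x => c * f x) p μ = c * eLpNorm f p μ := by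
  rcases eq_or_ne p 0 with rfl | h0
  · simp
  rcases eq_or_ne p ∞ with rfl | htop
  · simp only [eLpNorm_ennreal_top]
    exact ENNReal.essSup_const_mul
  · have hp := ENNReal.toReal_pos h0 htop
    rw [eLpNorm_ennreal_eq_lintegral h0 htop, eLpNorm_ennreal_eq_lintegral h0 htop]
    simp_rw [ENNReal.mul_rpow_of_nonneg _ _ hp.le]
    rw [lintegral_const_mul _ (hf.pow_const _),
      ENNReal.mul_rpow_of_nonneg _ _ (by positivity), ← ENNReal.rpow_mul,
      mul_one_div_cancel hp.ne', ENNReal.rpow_one]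

/-- Strict superlevel sets are open, hence not null as soon as they are nonempty. -/
theorem LowerSemicontinuous.essSup_eq_iSup {E : Type*} [TopologicalSpace E] [MeasurableSpace E]
    [OpensMeasurableSpace E] {μ : Measure E} [μ.IsOpenPosMeasure] {h : E → ℝ≥0∞}
    (hh : LowerSemicontinuous h) : essSup h μ = ⨆ x, h x := by
  refine le_antisymm (essSup_le_of_ae_le _ (Eventually.of_forall fun x => le_iSup h x)) ?_
  refine iSup_le fun x => le_of_forall_lt fun c hc => ?_
  by_contra hcon
  have hae : ∀ᵐ y ∂μ, h y ≤ c := by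
    filter_upwards [ENNReal.ae_le_essSup h (μ := μ)] with y hy using hy.trans (not_lt.1 hcon)
  have hopen : IsOpen {y | c < h y} := hh.isOpen_preimage c
  have h0 : μ {y | c < h y} = 0 := by
    have := ae_iff.1 hae
    simpa only [not_le] using this
  exact (hopen.measure_ne_zero μ ⟨x, hc⟩) h0

/-- The delicate exponent is `∞`: the essential supremum is a true supremum, and a supremum of lower
semicontinuous functions of `y` is measurable. Peetre maximal functions are suprema of continuous
functions, so this hypothesis suits them. -/
theorem LowerSemicontinuous.measurable_eLpNorm_slice {E F : Type*} [TopologicalSpace E]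
    [MeasurableSpace E] [BorelSpace E] [SecondCountableTopology E] [TopologicalSpace F]
    [MeasurableSpace F] [BorelSpace F] [SecondCountableTopology F] {μ : Measure E}
    [μ.IsOpenPosMeasure] [SFinite μ] {V : E × F → ℝ≥0∞} (hV : LowerSemicontinuous V)
    (p : ℝ≥0∞) : Measurable fun y => eLpNorm (fun x => V (x, y)) p μ := by
  have hcomp : ∀ x, LowerSemicontinuous fun y => V (x, y) := fun x =>
    hV.comp (by fun_prop)
  rcases eq_or_ne p 0 with rfl | h0
  · simp
  rcases eq_or_ne p ∞ with rfl | htop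
  · have : ∀ y, LowerSemicontinuous fun x => V (x, y) := fun y =>
      hV.comp (by fun_prop)
    simp_rw [eLpNorm_ennreal_top, (this _).essSup_eq_iSup]
    exact (lowerSemicontinuous_iSup hcomp).measurable
  · simp_rw [eLpNorm_ennreal_eq_lintegral h0 htop]
    exact ((hV.measurable.pow_const _).lintegral_prod_left').pow_const _

/-! ### The Peetre maximal function -/

section Peetre

variable {E : Type*} [NormedAddCommGroup E]

/-- The Peetre maximal function of order `m`. -/
def pmax (m : ℝ) (V : E → ℝ≥0∞) (z : E) : ℝ≥0∞ := ⨆ w, V w * bw (z - w) ^ (-m)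

theorem le_pmax (m : ℝ) (V : E → ℝ≥0∞) (z : E) : V z ≤ pmax m V z := by
  refine le_trans ?_ (le_iSup _ z)
  simp [bw_zero]

theorem slowlyVarying_pmax {m : ℝ} (hm : 0 ≤ m) (V : E → ℝ≥0∞) : SlowlyVarying m (pmax m V) := by
  intro x y
  refine iSup_le fun w => ?_
  calc V w * bw (x - w) ^ (-m) ≤ V w * (bw (y - w) ^ (-m) * bw (x - w - (y - w)) ^ m) := by
        gcongr; exact bw_rpow_neg_le_mul _ _ hm
    _ = V w * bw (y - w) ^ (-m) * bw (x - y) ^ m := by rw [sub_sub_sub_cancel_right, mul_assoc]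
    _ ≤ _ := by gcongr; exact le_iSup (fun w => V w * bw (y - w) ^ (-m)) w

theorem le_pmax_mul {m : ℝ} (hm : 0 ≤ m) (V : E → ℝ≥0∞) (w z : E) :
    V w ≤ pmax m V z * bw (w - z) ^ m :=
  (le_pmax m V w).trans (slowlyVarying_pmax hm V w z)

theorem lowerSemicontinuous_pmax (m : ℝ) {V : E → ℝ≥0∞} (hV : ∀ z, V z ≠ ∞) :
    LowerSemicontinuous (pmax m V) :=
  lowerSemicontinuous_iSup fun w =>
    ((ENNReal.continuous_const_mul (hV w)).comp
      ((continuous_bw_rpow (-m)).comp (continuous_id.sub continuous_const))).lowerSemicontinuous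

theorem bw_rpow_neg_mul_le {m : ℝ} (hm : 0 ≤ m) (x y : E) :
    bw x ^ (-m) * bw y ^ (-m) ≤ bw (x + y) ^ (-m) := by
  simp only [ENNReal.rpow_neg]
  rw [← ENNReal.mul_inv (Or.inl (bw_rpow_ne_zero _ _)) (Or.inl (bw_rpow_ne_top _ _)),
    ← ENNReal.mul_rpow_of_nonneg _ _ hm]
  exact ENNReal.inv_le_inv.2 (ENNReal.rpow_le_rpow (bw_add_le x y) hm)

variable [MeasurableSpace E] {μ : Measure E}

/-- The Strömberg–Torchinsky argument. Split `V * bw ^ (-m)` into its powers `r` and `1 - r` and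
bound the second by `P ^ (1 - r)`. The reproducing inequality then gives `P ≤ K * I * P ^ (1 - r)`,
and finiteness of `P` permits the division. -/
theorem pmax_rpow_le_of_ne_top {V : E → ℝ≥0∞} {r m : ℝ} (hr : 0 < r) (hr1 : r ≤ 1) (hm : 0 ≤ m)
    {K : ℝ≥0} (hrep : ∀ z, V z ≤ K * ∫⁻ w, V w * bw (z - w) ^ (-m) ∂μ) {z : E}
    (hz : pmax m V z ≠ ∞) :
    pmax m V z ^ r ≤ K * ∫⁻ w, V w ^ r * bw (z - w) ^ (-(m * r)) ∂μ := by
  set P := pmax m V z with hP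
  set I := ∫⁻ w, V w ^ r * bw (z - w) ^ (-(m * r)) ∂μ with hI
  rcases eq_or_ne P 0 with h0 | h0
  · simp [h0, hr]
  have hPt : P ^ (1 - r) ≠ ∞ := ENNReal.rpow_ne_top_of_nonneg (by linarith) hz
  have hP0 : P ^ (1 - r) ≠ 0 := by simp [ENNReal.rpow_eq_zero_iff, h0, hz]
  have h1 : ∫⁻ v, V v * bw (z - v) ^ (-m) ∂μ ≤ I * P ^ (1 - r) := by
    rw [hI, ← lintegral_mul_const' _ _ hPt]
    refine lintegral_mono fun v => ?_
    have hv : V v * bw (z - v) ^ (-m) ≤ P := le_iSup (fun w => V w * bw (z - w) ^ (-m)) v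
    calc V v * bw (z - v) ^ (-m)
        = (V v * bw (z - v) ^ (-m)) ^ r * (V v * bw (z - v) ^ (-m)) ^ (1 - r) := by
          rw [← ENNReal.rpow_add_of_nonneg _ _ hr.le (by linarith)]; simp
      _ ≤ (V v * bw (z - v) ^ (-m)) ^ r * P ^ (1 - r) := by
          gcongr
      _ = _ := by
          rw [ENNReal.mul_rpow_of_nonneg _ _ hr.le, ← ENNReal.rpow_mul, neg_mul]
  -- The kernel of the reproducing inequality and that of the maximal function combine into a single
  -- kernel centred at `z`, by submultiplicativity of `bw`.
  have h2 : P ≤ K * I * P ^ (1 - r) := by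
    refine iSup_le fun w => ?_
    calc V w * bw (z - w) ^ (-m)
        ≤ K * (∫⁻ v, V v * bw (w - v) ^ (-m) ∂μ) * bw (z - w) ^ (-m) := by
          gcongr; exact hrep w
      _ = K * ∫⁻ v, V v * bw (w - v) ^ (-m) * bw (z - w) ^ (-m) ∂μ := by
          rw [mul_assoc, lintegral_mul_const' _ _ (bw_rpow_ne_top _ _)]
      _ ≤ K * ∫⁻ v, V v * bw (z - v) ^ (-m) ∂μ := by
          refine mul_le_mul' le_rfl (lintegral_mono fun v => ?_)
          rw [mul_assoc]
          have := bw_rpow_neg_mul_le hm (w - v) (z - w)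
          rw [show w - v + (z - w) = z - v by abel] at this
          exact mul_le_mul' le_rfl this
      _ ≤ K * (I * P ^ (1 - r)) := by gcongr
      _ = _ := by ring
  refine (ENNReal.mul_le_mul_iff_left hP0 hPt).1 ?_
  rwa [← ENNReal.rpow_add_of_nonneg _ _ hr.le (by linarith), add_sub_cancel, ENNReal.rpow_one]

/-- A function of polynomial growth that satisfies reproducing inequalities of all orders
satisfies Peetre's maximal inequality, with constants that do not depend on its growth. -/
theorem pmax_rpow_le {V : E → ℝ≥0∞} {r m : ℝ} (hr : 0 < r) (hr1 : r ≤ 1) (hm : 0 ≤ m)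
    {K : ℝ → ℝ≥0} (hrep : ∀ m, 0 ≤ m → ∀ z, V z ≤ K m * ∫⁻ w, V w * bw (z - w) ^ (-m) ∂μ)
    {N : ℝ} {D : ℝ≥0∞} (hD : D ≠ ∞) (hgrow : ∀ z, V z ≤ D * bw z ^ N) (z : E) :
    pmax m V z ^ r ≤ K m * ∫⁻ w, V w ^ r * bw (z - w) ^ (-(m * r)) ∂μ := by
  have hI : ∀ z, ∫⁻ w, V w ^ r * bw (z - w) ^ (-(max N m * r)) ∂μ
      ≤ ∫⁻ w, V w ^ r * bw (z - w) ^ (-(m * r)) ∂μ := fun z => by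
    refine lintegral_mono fun w => mul_le_mul' le_rfl ?_
    exact bw_rpow_mono _ (neg_le_neg (mul_le_mul_of_nonneg_right (le_max_right _ _) hr.le))
  have hmax : 0 ≤ max N m := hm.trans (le_max_right _ _)
  -- At an order at least the growth exponent `N`, the maximal function is finite.
  have hlarge : ∀ z, pmax (max N m) V z ≠ ∞ := fun z => by
    refine ne_top_of_le_ne_top (ENNReal.mul_ne_top hD (bw_rpow_ne_top z (max N m)))
      (iSup_le fun w => ?_)
    calc V w * bw (z - w) ^ (-max N m)
        ≤ D * bw w ^ max N m * bw (z - w) ^ (-max N m) := by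
          gcongr
          exact (hgrow w).trans (mul_le_mul' le_rfl (bw_rpow_mono _ (le_max_left _ _)))
      _ ≤ D * (bw z ^ max N m * bw (w - z) ^ max N m) * bw (z - w) ^ (-max N m) := by
          gcongr; exact bw_rpow_le_mul _ _ hmax
      _ = D * bw z ^ max N m * (bw (z - w) ^ (-max N m) * bw (z - w) ^ max N m) := by
          rw [bw_sub_comm w z]; ring
      _ = _ := by rw [bw_rpow_neg_mul, mul_one]
  -- The inequality of the larger order, weakened to the kernel of order `m`, bounds `V` itself. Its
  -- constant depends on `N`, but it only serves to show that `pmax m V z` is finite; the final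
  -- constant comes from a second application, at order `m`.
  have hV : ∀ w, V w ^ r ≤ K (max N m) * ∫⁻ v, V v ^ r * bw (w - v) ^ (-(m * r)) ∂μ := fun w =>
    (ENNReal.rpow_le_rpow (le_pmax (max N m) V w) hr.le).trans
      ((pmax_rpow_le_of_ne_top hr hr1 hmax (hrep _ hmax) (hlarge w)).trans (mul_le_mul' le_rfl (hI w)))
  -- Set apart because `0 * ∞ = 0` would spoil the case of an infinite integral.
  rcases eq_or_ne (K m) 0 with hK | hK
  · have hV0 : ∀ w, V w = 0 := fun w => by simpa [hK] using hrep m hm w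
    simp [pmax, hV0, hr]
  set I := ∫⁻ w, V w ^ r * bw (z - w) ^ (-(m * r)) ∂μ with hIdef
  rcases eq_or_ne I ∞ with hIt | hIt
  · rw [hIt, ENNReal.mul_top (by exact_mod_cast hK)]; exact le_top
  refine pmax_rpow_le_of_ne_top hr hr1 hm (hrep m hm) ?_
  have hb : (K (max N m) * I) ^ (1 / r) ≠ ∞ :=
    ENNReal.rpow_ne_top_of_nonneg (by positivity) (ENNReal.mul_ne_top (by simp) hIt)
  refine ne_top_of_le_ne_top hb (iSup_le fun w => ?_)
  rw [one_div, ENNReal.le_rpow_inv_iff hr, ENNReal.mul_rpow_of_nonneg _ _ hr.le, ← ENNReal.rpow_mul,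
    neg_mul]
  calc V w ^ r * bw (z - w) ^ (-(m * r))
      ≤ K (max N m) * (∫⁻ v, V v ^ r * bw (w - v) ^ (-(m * r)) ∂μ) * bw (z - w) ^ (-(m * r)) := by
        gcongr; exact hV w
    _ = K (max N m) * ∫⁻ v, V v ^ r * bw (w - v) ^ (-(m * r)) * bw (z - w) ^ (-(m * r)) ∂μ := by
        rw [mul_assoc, lintegral_mul_const' _ _ (bw_rpow_ne_top _ _)]
    _ ≤ K (max N m) * I := by
        rw [hIdef]
        refine mul_le_mul' le_rfl (lintegral_mono fun v => ?_)
        rw [mul_assoc]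
        have := bw_rpow_neg_mul_le (mul_nonneg hm hr.le) (w - v) (z - w)
        rw [show w - v + (z - w) = z - v by abel] at this
        exact mul_le_mul' le_rfl this

end Peetre

/-! ### Mixed norms -/

section Mixed


/-- The weighted mixed (quasi-)norm: `L^p` in the first variable, then `L^q` with weight `⟨ξ⟩ˢ`
in the second one. -/
def mixN (p q : ℝ≥0∞) (s : ℝ) (V : Rd d × Rd d → ℝ≥0∞) : ℝ≥0∞ :=
  eLpNorm (fun ξ : Rd d => weight s ξ * eLpNorm (fun x : Rd d => V (x, ξ)) p volume) q volume

theorem mixN_mono {p q : ℝ≥0∞} {s : ℝ} {V W : Rd d × Rd d → ℝ≥0∞} (h : ∀ z, V z ≤ W z) :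
    mixN p q s V ≤ mixN p q s W :=
  eLpNorm_mono_ennreal fun _ => by
    gcongr
    exact eLpNorm_mono_ennreal fun _ => h _

theorem mixN_const_mul {p q : ℝ≥0∞} {s : ℝ} {c : ℝ≥0∞} (hc : c ≠ ∞) (V : Rd d × Rd d → ℝ≥0∞) :
    mixN p q s (fun z => c * V z) = c * mixN p q s V := by
  unfold mixN
  simp_rw [eLpNorm_ennreal_const_mul hc, mul_left_comm _ c]
  rw [eLpNorm_ennreal_const_mul hc]

theorem measurable_mixN_integrand {V : Rd d × Rd d → ℝ≥0∞} (hV : LowerSemicontinuous V)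
    (p : ℝ≥0∞) (s : ℝ) :
    Measurable fun ξ : Rd d => weight s ξ * eLpNorm (fun x : Rd d => V (x, ξ)) p volume :=
  (continuous_weight s).measurable.mul (hV.measurable_eLpNorm_slice p)

theorem exists_mixN_add_le (p q : ℝ≥0∞) (s : ℝ) :
    ∃ C : ℝ≥0, ∀ V W : Rd d × Rd d → ℝ≥0∞, LowerSemicontinuous V → LowerSemicontinuous W →
      mixN p q s (fun z => V z + W z) ≤ C * (mixN p q s V + mixN p q s W) := by
  have hp := (ENNReal.LpAddConst_lt_top p).ne
  have hq := (ENNReal.LpAddConst_lt_top q).ne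
  refine ⟨(p.LpAddConst * q.LpAddConst).toNNReal, fun V W hV hW => ?_⟩
  rw [ENNReal.coe_toNNReal (ENNReal.mul_ne_top hp hq)]
  calc mixN p q s (fun z => V z + W z)
      ≤ eLpNorm (fun ξ : Rd d => p.LpAddConst *
          (weight s ξ * eLpNorm (fun x : Rd d => V (x, ξ)) p volume
          + weight s ξ * eLpNorm (fun x : Rd d => W (x, ξ)) p volume)) q volume := by
        refine eLpNorm_mono_ennreal fun ξ => ?_
        rw [← mul_add, mul_left_comm]
        gcongr
        exact eLpNorm_ennreal_add_le (hV.measurable.comp measurable_prodMk_right)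
          (hW.measurable.comp measurable_prodMk_right) p
    _ ≤ p.LpAddConst * (q.LpAddConst * (mixN p q s V + mixN p q s W)) := by
        rw [eLpNorm_ennreal_const_mul hp]
        gcongr
        exact eLpNorm_ennreal_add_le (measurable_mixN_integrand hV p s)
          (measurable_mixN_integrand hW p s) q
    _ = _ := by ring

/-- Fatou's lemma for mixed norms. -/
theorem mixN_liminf_le {p q : ℝ≥0∞} {s : ℝ} {V : ℕ → Rd d × Rd d → ℝ≥0∞}
    (hV : ∀ n, LowerSemicontinuous (V n)) :
    mixN p q s (fun z => liminf (fun n => V n z) atTop)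
      ≤ liminf (fun n => mixN p q s (V n)) atTop := by
  refine le_trans (eLpNorm_mono_ennreal fun ξ => ?_)
    (eLpNorm_liminf_le (fun n => measurable_mixN_integrand (hV n) p s) q)
  calc weight s ξ * eLpNorm (fun x : Rd d => liminf (fun n => V n (x, ξ)) atTop) p volume
      ≤ weight s ξ * liminf (fun n => eLpNorm (fun x : Rd d => V n (x, ξ)) p volume) atTop := by
        gcongr
        exact eLpNorm_liminf_le (fun n => (hV n).measurable.comp measurable_prodMk_right) p
    _ = _ := by
        exact Monotone.map_liminf_of_continuousAt (F := atTop) (f := fun y => weight s ξ * y)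
          (fun a b h => by dsimp only; gcongr) _
          (ENNReal.continuous_const_mul (weight_ne_top s ξ)).continuousAt

theorem lintegral_phase_sub_left (f : Rd d × Rd d → ℝ≥0∞) (z : Rd d × Rd d) :
    ∫⁻ w, f (z - w) = ∫⁻ w, f w := by
  have h := (Measure.measurePreserving_sub_left (volume : Measure (Rd d)) z.1).prod
    (Measure.measurePreserving_sub_left (volume : Measure (Rd d)) z.2)
  exact h.lintegral_comp_emb
    ((MeasurableEquiv.subLeft z.1).prodCongr (MeasurableEquiv.subLeft z.2)).measurableEmbedding f

theorem lintegral_bw_rpow_neg_prod_ne_top {a b : ℝ} (ha : (d : ℝ) < a) (hb : (d : ℝ) < b) :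
    ∫⁻ w : Rd d × Rd d, bw w.1 ^ (-a) * bw w.2 ^ (-b) ≠ ∞ := by
  rw [Measure.volume_eq_prod, lintegral_prod_mul
    (continuous_bw_rpow _).measurable.aemeasurable (continuous_bw_rpow _).measurable.aemeasurable]
  exact ENNReal.mul_ne_top (lintegral_bw_rpow_neg_lt_top volume (by simpa using ha)).ne
    (lintegral_bw_rpow_neg_lt_top volume (by simpa using hb)).ne

/-- The exponent used in Peetre's maximal inequality. -/
def minExp (p q : ℝ≥0∞) : ℝ := (min 1 (min p q)).toReal

theorem minExp_pos {p q : ℝ≥0∞} (hp : p ≠ 0) (hq : q ≠ 0) : 0 < minExp p q :=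
  ENNReal.toReal_pos (by simp [hp, hq]) (ne_top_of_le_ne_top ENNReal.one_ne_top (min_le_left _ _))

theorem minExp_le_one (p q : ℝ≥0∞) : minExp p q ≤ 1 := by
  rw [minExp, ← ENNReal.toReal_one]
  exact ENNReal.toReal_mono ENNReal.one_ne_top (min_le_left _ _)

theorem ofReal_minExp (p q : ℝ≥0∞) : ENNReal.ofReal (minExp p q) = min 1 (min p q) :=
  ENNReal.ofReal_toReal (ne_top_of_le_ne_top ENNReal.one_ne_top (min_le_left _ _))

/-- Boundedness of the Peetre maximal function on mixed norm spaces. -/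
theorem exists_mixN_pmax_le {p q : ℝ≥0∞} (hp : p ≠ 0) (hq : q ≠ 0) (s : ℝ) :
    ∃ m₀ : ℝ, 0 ≤ m₀ ∧ ∀ m, m₀ ≤ m → ∀ K : ℝ≥0, ∃ C : ℝ≥0, ∀ V : Rd d × Rd d → ℝ≥0∞,
      LowerSemicontinuous V →
      (∀ z, pmax m V z ^ minExp p q
        ≤ K * ∫⁻ w, V w ^ minExp p q * bw (z - w) ^ (-(m * minExp p q))) →
      mixN p q s (pmax m V) ≤ C * mixN p q s V := by
  set r := minExp p q with hrdef
  have hr : 0 < r := minExp_pos hp hq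
  have hrofp : ENNReal.ofReal r ≤ p := by
    rw [hrdef, ofReal_minExp]; exact (min_le_right _ _).trans (min_le_left _ _)
  have hrofq : ENNReal.ofReal r ≤ q := by
    rw [hrdef, ofReal_minExp]; exact (min_le_right _ _).trans (min_le_right _ _)
  have hrof0 : ENNReal.ofReal r ≠ 0 := by simpa using hr
  have hdivp : p / ENNReal.ofReal r * ENNReal.ofReal r = p :=
    ENNReal.div_mul_cancel hrof0 ENNReal.ofReal_ne_top
  have hdivq : q / ENNReal.ofReal r * ENNReal.ofReal r = q :=
    ENNReal.div_mul_cancel hrof0 ENNReal.ofReal_ne_top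
  have h1p : 1 ≤ p / ENNReal.ofReal r := by
    rwa [ENNReal.le_div_iff_mul_le (Or.inl hrof0) (Or.inl ENNReal.ofReal_ne_top), one_mul]
  have h1q : 1 ≤ q / ENNReal.ofReal r := by
    rwa [ENNReal.le_div_iff_mul_le (Or.inl hrof0) (Or.inl ENNReal.ofReal_ne_top), one_mul]
  -- The threshold ensures `ν = m r / 2 > d + |s| r`. The factor `2` pays for splitting the decay
  -- between the two components of phase space, and `|s| r` for moving the weight from `ξ` to `ξ -
  -- w.2`; the kernel that remains is integrable.
  refine ⟨2 / r * (d + |s| * r + 1), by positivity, fun m hm K => ?_⟩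
  have hm0 : 0 ≤ m := le_trans (by positivity) hm
  set ν := m * r / 2 with hν
  have hν0 : 0 ≤ ν := by positivity
  have hνd : (d : ℝ) + |s| * r < ν := by
    have : 2 / r * (d + |s| * r + 1) * r ≤ m * r := by gcongr
    have e : 2 / r * (d + |s| * r + 1) * r = 2 * (d + |s| * r + 1) := by field_simp
    rw [hν]; linarith
  have hsr : 0 ≤ |s| * r := by positivity
  set I := ∫⁻ w : Rd d × Rd d, bw w.1 ^ (-ν) * bw w.2 ^ (-(ν - |s| * r)) with hI
  have hIt : I ≠ ∞ := lintegral_bw_rpow_neg_prod_ne_top (by linarith) (by linarith)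
  have hKI : (K * I) ^ (1 / r) ≠ ∞ :=
    ENNReal.rpow_ne_top_of_nonneg (by positivity) (ENNReal.mul_ne_top (by simp) hIt)
  refine ⟨((K * I) ^ (1 / r)).toNNReal, fun V hV hmain => ?_⟩
  rw [ENNReal.coe_toNNReal hKI]
  set N : Rd d → ℝ≥0∞ := fun ξ => eLpNorm (fun x : Rd d => V (x, ξ)) p volume with hNdef
  have hNm : Measurable N := hV.measurable_eLpNorm_slice p
  -- Since `r ≤ p`, Minkowski's inequality applies in `L^(p/r)` to the `r`-th powers; translation in
  -- `x` leaves the slice norms unchanged.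
  have hinner : ∀ ξ, eLpNorm (fun x : Rd d => pmax m V (x, ξ)) p volume ^ r
      ≤ K * ∫⁻ w : Rd d × Rd d, bw w.1 ^ (-ν) * bw w.2 ^ (-ν) * N (ξ - w.2) ^ r := by
    intro ξ
    have hpt : ∀ x, pmax m V (x, ξ) ^ r
        ≤ K * ∫⁻ w : Rd d × Rd d, bw w.1 ^ (-ν) * bw w.2 ^ (-ν) * V (x - w.1, ξ - w.2) ^ r := by
      intro x
      refine (hmain (x, ξ)).trans (mul_le_mul' le_rfl ?_)
      rw [← lintegral_phase_sub_left _ (x, ξ)]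
      refine lintegral_mono fun w => ?_
      dsimp only
      rw [sub_sub_cancel, mul_comm]
      have : bw w ^ (-(m * r)) ≤ bw w.1 ^ (-ν) * bw w.2 ^ (-ν) := by
        rw [show m * r = 2 * ν by rw [hν]; ring]
        exact bw_prod_rpow_neg_le w.1 w.2 hν0
      exact mul_le_mul' this le_rfl
    have hconst : ∀ w : Rd d × Rd d,
        eLpNorm (fun x : Rd d => bw w.1 ^ (-ν) * bw w.2 ^ (-ν) * V (x - w.1, ξ - w.2) ^ r)
          (p / ENNReal.ofReal r) volume
        = bw w.1 ^ (-ν) * bw w.2 ^ (-ν) * N (ξ - w.2) ^ r := by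
      intro w
      rw [eLpNorm_ennreal_const_mul (ENNReal.mul_ne_top (bw_rpow_ne_top _ _) (bw_rpow_ne_top _ _)),
        eLpNorm_ennreal_rpow _ hr, hdivp]
      congr 2
      exact eLpNorm_comp_measurePreserving (g := fun x : Rd d => V (x, ξ - w.2))
        (hV.measurable.comp measurable_prodMk_right).aestronglyMeasurable
        (measurePreserving_sub_right volume w.1)
    have hVm := hV.measurable
    calc eLpNorm (fun x : Rd d => pmax m V (x, ξ)) p volume ^ r
        = eLpNorm (fun x : Rd d => pmax m V (x, ξ) ^ r) (p / ENNReal.ofReal r) volume := by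
          rw [eLpNorm_ennreal_rpow _ hr, hdivp]
      _ ≤ eLpNorm (fun x : Rd d => K * ∫⁻ w : Rd d × Rd d,
            bw w.1 ^ (-ν) * bw w.2 ^ (-ν) * V (x - w.1, ξ - w.2) ^ r)
            (p / ENNReal.ofReal r) volume := eLpNorm_mono_ennreal hpt
      _ ≤ _ := by
          rw [eLpNorm_ennreal_const_mul (by simp)]
          gcongr
          refine (eLpNorm_lintegral_le ?_ h1p ?_).trans (lintegral_mono fun w => (hconst w).le)
          · unfold Function.uncurry
            fun_prop
          · simp_rw [hconst]
            fun_prop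
  set W : Rd d → ℝ≥0∞ := fun ξ => weight s ξ * N ξ with hW
  have hWm : Measurable W := (continuous_weight s).measurable.mul hNm
  -- The weight is carried to the translated point, at the cost of `bw w.2 ^ (|s| * r)`, so that
  -- Minkowski can be repeated in `L^(q/r)`.
  have houter : ∀ ξ, (weight s ξ * eLpNorm (fun x : Rd d => pmax m V (x, ξ)) p volume) ^ r
      ≤ K * ∫⁻ w : Rd d × Rd d, bw w.1 ^ (-ν) * bw w.2 ^ (-(ν - |s| * r)) * W (ξ - w.2) ^ r := by
    intro ξ
    have hwt : weight s ξ ^ r ≠ ∞ := ENNReal.rpow_ne_top_of_nonneg hr.le (weight_ne_top _ _)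
    calc _ = weight s ξ ^ r * eLpNorm (fun x : Rd d => pmax m V (x, ξ)) p volume ^ r :=
          ENNReal.mul_rpow_of_nonneg _ _ hr.le
      _ ≤ weight s ξ ^ r * (K * ∫⁻ w : Rd d × Rd d,
            bw w.1 ^ (-ν) * bw w.2 ^ (-ν) * N (ξ - w.2) ^ r) := by gcongr; exact hinner ξ
      _ = K * ∫⁻ w : Rd d × Rd d,
            weight s ξ ^ r * (bw w.1 ^ (-ν) * bw w.2 ^ (-ν) * N (ξ - w.2) ^ r) := by
          rw [lintegral_const_mul' _ _ hwt]; ring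
      _ ≤ _ := by
          refine mul_le_mul' le_rfl (lintegral_mono fun w => ?_)
          have h1 := ENNReal.rpow_le_rpow (weight_le_mul s ξ (ξ - w.2)) hr.le
          rw [sub_sub_cancel, ENNReal.mul_rpow_of_nonneg _ _ hr.le, ← ENNReal.rpow_mul] at h1
          calc _ ≤ (weight s (ξ - w.2) ^ r * bw w.2 ^ (|s| * r)) *
                (bw w.1 ^ (-ν) * bw w.2 ^ (-ν) * N (ξ - w.2) ^ r) :=
              mul_le_mul' h1 le_rfl
            _ = bw w.1 ^ (-ν) * (bw w.2 ^ (-ν) * bw w.2 ^ (|s| * r)) *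
                (weight s (ξ - w.2) ^ r * N (ξ - w.2) ^ r) := by ring
            _ = _ := by
                rw [← bw_rpow_add, ← ENNReal.mul_rpow_of_nonneg _ _ hr.le,
                  show -ν + |s| * r = -(ν - |s| * r) by ring]
  have hconst : ∀ w : Rd d × Rd d,
      eLpNorm (fun ξ : Rd d => bw w.1 ^ (-ν) * bw w.2 ^ (-(ν - |s| * r)) * W (ξ - w.2) ^ r)
        (q / ENNReal.ofReal r) volume
      = bw w.1 ^ (-ν) * bw w.2 ^ (-(ν - |s| * r)) * mixN p q s V ^ r := by
    intro w
    rw [eLpNorm_ennreal_const_mul (ENNReal.mul_ne_top (bw_rpow_ne_top _ _) (bw_rpow_ne_top _ _)),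
      eLpNorm_ennreal_rpow _ hr, hdivq]
    congr 2
    exact eLpNorm_comp_measurePreserving (g := W) hWm.aestronglyMeasurable
      (measurePreserving_sub_right volume w.2)
  have hfinal : mixN p q s (pmax m V) ^ r ≤ K * I * mixN p q s V ^ r := by
    calc mixN p q s (pmax m V) ^ r
        = eLpNorm (fun ξ : Rd d =>
            (weight s ξ * eLpNorm (fun x : Rd d => pmax m V (x, ξ)) p volume) ^ r)
            (q / ENNReal.ofReal r) volume := by
          rw [eLpNorm_ennreal_rpow _ hr, hdivq]; rfl
      _ ≤ eLpNorm (fun ξ : Rd d => K * ∫⁻ w : Rd d × Rd d,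
            bw w.1 ^ (-ν) * bw w.2 ^ (-(ν - |s| * r)) * W (ξ - w.2) ^ r)
            (q / ENNReal.ofReal r) volume := eLpNorm_mono_ennreal houter
      _ ≤ K * ∫⁻ w : Rd d × Rd d, bw w.1 ^ (-ν) * bw w.2 ^ (-(ν - |s| * r)) *
            mixN p q s V ^ r := by
          rw [eLpNorm_ennreal_const_mul (by simp)]
          gcongr
          refine (eLpNorm_lintegral_le ?_ h1q ?_).trans (lintegral_mono fun w => (hconst w).le)
          · unfold Function.uncurry
            fun_prop
          · simp_rw [hconst]
            fun_prop
      _ = K * I * mixN p q s V ^ r := by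
          rw [lintegral_mul_const _ (by fun_prop), mul_assoc]
  have := ENNReal.rpow_le_rpow hfinal (by positivity : 0 ≤ 1 / r)
  rwa [ENNReal.mul_rpow_of_nonneg _ _ (by positivity), ← ENNReal.rpow_mul, ← ENNReal.rpow_mul,
    mul_one_div_cancel hr.ne', ENNReal.rpow_one, ENNReal.rpow_one] at this

theorem SlowlyVarying.slice_fst {m : ℝ} {h : Rd d × Rd d → ℝ≥0∞} (hh : SlowlyVarying m h)
    (ξ : Rd d) : SlowlyVarying m fun x => h (x, ξ) := fun x y => by
  have := hh (x, ξ) (y, ξ)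
  have e : bw ((x, ξ) - (y, ξ)) = bw (x - y) := by
    simp [bw_eq_ofReal, Prod.norm_def]
  rwa [e] at this

theorem SlowlyVarying.slice_snd {m : ℝ} {h : Rd d × Rd d → ℝ≥0∞} (hh : SlowlyVarying m h)
    (x : Rd d) : SlowlyVarying m fun ξ => h (x, ξ) := fun ξ η => by
  have := hh (x, ξ) (x, η)
  have e : bw ((x, ξ) - (x, η)) = bw (ξ - η) := by
    simp [bw_eq_ofReal, Prod.norm_def]
  rwa [e] at this

/-- Lets the one-variable estimates for slowly varying functions be used a second time, in the outer
variable. -/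
theorem SlowlyVarying.mixN_integrand {m : ℝ} {h : Rd d × Rd d → ℝ≥0∞} (hh : SlowlyVarying m h)
    (p : ℝ≥0∞) (s : ℝ) :
    SlowlyVarying (|s| + m)
      fun ξ : Rd d => weight s ξ * eLpNorm (fun x : Rd d => h (x, ξ)) p volume := by
  refine (slowlyVarying_weight s).mul fun ξ η => ?_
  rw [mul_comm, ← eLpNorm_ennreal_const_mul (bw_rpow_ne_top _ _)]
  refine eLpNorm_mono_ennreal fun x => ?_
  rw [mul_comm]
  exact hh.slice_snd x ξ η

theorem exists_weight_mul_eLpNorm_le_mixN {m : ℝ} (hm : 0 ≤ m) (p : ℝ≥0∞) {q : ℝ≥0∞} (hq : q ≠ 0)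
    (s : ℝ) :
    ∃ C : ℝ≥0, ∀ h : Rd d × Rd d → ℝ≥0∞, SlowlyVarying m h → ∀ ξ,
      weight s ξ * eLpNorm (fun x : Rd d => h (x, ξ)) p volume ≤ C * mixN p q s h := by
  obtain ⟨C, hC⟩ := exists_slowlyVarying_le_eLpNorm (E := Rd d) volume
    (by positivity : 0 ≤ |s| + m) hq
  exact ⟨C, fun h hh ξ => hC _ (hh.mixN_integrand p s) ξ⟩

theorem exists_weight_mul_le_mixN {m : ℝ} (hm : 0 ≤ m) {p q : ℝ≥0∞} (hp : p ≠ 0) (hq : q ≠ 0)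
    (s : ℝ) :
    ∃ C : ℝ≥0, ∀ h : Rd d × Rd d → ℝ≥0∞, SlowlyVarying m h → ∀ z : Rd d × Rd d,
      weight s z.2 * h z ≤ C * mixN p q s h := by
  obtain ⟨C, hC⟩ := exists_weight_mul_eLpNorm_le_mixN (d := d) hm p hq s
  obtain ⟨C', hC'⟩ := exists_slowlyVarying_le_eLpNorm (E := Rd d) volume hm hp
  refine ⟨C' * C, fun h hh z => ?_⟩
  calc weight s z.2 * h z
      ≤ weight s z.2 * (C' * eLpNorm (fun x : Rd d => h (x, z.2)) p volume) := by
        gcongr; exact hC' _ (hh.slice_fst z.2) z.1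
    _ = C' * (weight s z.2 * eLpNorm (fun x : Rd d => h (x, z.2)) p volume) := by ring
    _ ≤ C' * (C * mixN p q s h) := mul_le_mul' le_rfl (hC h hh z.2)
    _ = _ := by push_cast; ring

/-- Serves to pass from the finite exponents `min 1 p`, `min 1 q`, where dominated convergence is
available, to `p`, `q`. -/
theorem exists_slowlyVarying_mixN_le {m : ℝ} (hm : 0 ≤ m) {p q r t : ℝ≥0∞} (hr : r ≠ 0)
    (ht : t ≠ 0) (hrp : r ≤ p) (htq : t ≤ q) (s : ℝ) :
    ∃ C : ℝ≥0, ∀ h : Rd d × Rd d → ℝ≥0∞, SlowlyVarying m h →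
      mixN p q s h ≤ C * mixN r t s h := by
  obtain ⟨C, hC⟩ := exists_slowlyVarying_eLpNorm_le (E := Rd d) volume hm hr hrp
  obtain ⟨C', hC'⟩ := exists_slowlyVarying_eLpNorm_le (E := Rd d) volume
    (by positivity : 0 ≤ |s| + m) ht htq
  refine ⟨C * C', fun h hh => ?_⟩
  calc mixN p q s h
      ≤ eLpNorm (fun ξ : Rd d => C * (weight s ξ * eLpNorm (fun x : Rd d => h (x, ξ)) r volume))
          q volume := by
        refine eLpNorm_mono_ennreal fun ξ => ?_
        rw [mul_left_comm]
        gcongr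
        exact hC _ (hh.slice_fst ξ)
    _ ≤ C * (C' * mixN r t s h) := by
        rw [eLpNorm_ennreal_const_mul (by simp)]
        gcongr
        exact hC' _ (hh.mixN_integrand r s)
    _ = _ := by push_cast; ring

/-- Young's inequality for slowly varying functions, for all exponents. -/
theorem exists_eLpNorm_conv_le {m : ℝ} (hm : 0 ≤ m) {p : ℝ≥0∞} (hp : p ≠ 0) :
    ∃ C : ℝ≥0, ∀ f g : Rd d → ℝ≥0∞, SlowlyVarying m f → SlowlyVarying m g →
      Measurable f → Measurable g →
      eLpNorm (fun x : Rd d => ∫⁻ v : Rd d, f (x - v) * g v) p volume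
        ≤ C * (eLpNorm f p volume * eLpNorm g (min 1 p) volume) := by
  rcases le_or_gt 1 p with h1 | h1
  · refine ⟨1, fun f g _ _ hf hg => ?_⟩
    have hconst : ∀ v, eLpNorm (fun x : Rd d => f (x - v) * g v) p volume
        = eLpNorm f p volume * g v := by
      intro v
      simp_rw [mul_comm _ (g v)]
      rw [eLpNorm_ennreal_const_mul_of_measurable _ (by fun_prop)]
      congr 1
      exact eLpNorm_comp_measurePreserving (g := f) hf.aestronglyMeasurable
        (measurePreserving_sub_right volume v)
    rw [min_eq_left h1, ENNReal.coe_one, one_mul, eLpNorm_ennreal_one,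
      ← lintegral_const_mul _ hg]
    refine (eLpNorm_lintegral_le ?_ h1 ?_).trans (lintegral_mono fun v => (hconst v).le)
    · unfold Function.uncurry; fun_prop
    · simp_rw [hconst]; fun_prop
  -- For `p < 1` the integrand is slowly varying in `v`, so its `L^1` norm is bounded by its `L^p`
  -- quasi-norm; Tonelli then factors the double integral of `p`-th powers.
  · have hptop : p ≠ ∞ := (h1.trans ENNReal.one_lt_top).ne
    have hp0 := ENNReal.toReal_pos hp hptop
    obtain ⟨C, hC⟩ := exists_slowlyVarying_eLpNorm_le (E := Rd d) volume
      (by positivity : 0 ≤ m + m) hp h1.le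
    refine ⟨C, fun f g hf hg hfm hgm => ?_⟩
    rw [min_eq_right h1.le]
    calc eLpNorm (fun x : Rd d => ∫⁻ v : Rd d, f (x - v) * g v) p volume
        ≤ eLpNorm (fun x : Rd d => C * (∫⁻ v : Rd d, (f (x - v) * g v) ^ p.toReal)
            ^ (1 / p.toReal)) p volume := by
          refine eLpNorm_mono_ennreal fun x => ?_
          have := hC _ ((hf.sub_left x).mul hg)
          rwa [eLpNorm_ennreal_one, eLpNorm_ennreal_eq_lintegral hp hptop] at this
      _ = C * (∫⁻ x : Rd d, ∫⁻ v : Rd d, f (x - v) ^ p.toReal * g v ^ p.toReal)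
            ^ (1 / p.toReal) := by
          rw [eLpNorm_ennreal_const_mul (by simp), eLpNorm_ennreal_eq_lintegral hp hptop]
          simp_rw [← ENNReal.rpow_mul, one_div_mul_cancel hp0.ne', ENNReal.rpow_one,
            ENNReal.mul_rpow_of_nonneg _ _ hp0.le]
      _ = C * ((∫⁻ x, f x ^ p.toReal) * ∫⁻ v, g v ^ p.toReal) ^ (1 / p.toReal) := by
          rw [lintegral_lintegral_swap (by fun_prop)]
          congr 2
          rw [← lintegral_const_mul _ (by fun_prop)]
          refine lintegral_congr fun v => ?_
          rw [lintegral_mul_const _ (by fun_prop),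
            lintegral_sub_right_eq_self (fun x => f x ^ p.toReal) v]
      _ = _ := by
          rw [ENNReal.mul_rpow_of_nonneg _ _ (by positivity),
            eLpNorm_ennreal_eq_lintegral hp hptop, eLpNorm_ennreal_eq_lintegral hp hptop]

end Mixed

/-! ### Seminorm bounds for shifted Schwartz functions -/

section Seminorms

/-- The supremum of the Schwartz seminorms with indices at most `M`. -/
def semi (M : ℕ × ℕ) : Seminorm ℂ 𝓢(Rd d, ℂ) :=
  (Finset.Iic M).sup (schwartzSeminormFamily ℂ (Rd d) ℂ)

theorem finset_sup_le_semi (s : Finset (ℕ × ℕ)) :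
    ∃ M, s.sup (schwartzSeminormFamily ℂ (Rd d) ℂ) ≤ semi M :=
  ⟨s.sup id, Finset.sup_mono fun _ hi => Finset.mem_Iic.2 (Finset.le_sup (f := id) hi)⟩

theorem seminorm_le_semi (k n : ℕ) (A : 𝓢(Rd d, ℂ)) :
    SchwartzMap.seminorm ℂ k n A ≤ semi (k, n) A :=
  Seminorm.le_finset_sup_apply (p := schwartzSeminormFamily ℂ (Rd d) ℂ)
    (Finset.mem_Iic.2 (le_refl (k, n)))

theorem one_add_pow_mul_le_semi {k n : ℕ} (A : 𝓢(Rd d, ℂ)) {i : ℕ} (hi : i ≤ n) (x : Rd d) :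
    (1 + ‖x‖) ^ k * ‖iteratedFDeriv ℝ i A x‖ ≤ 2 ^ k * semi (k, n) A :=
  SchwartzMap.one_add_le_sup_seminorm_apply (𝕜 := ℂ) (m := (k, n)) le_rfl hi A x

theorem semi_le_of_forall {M : ℕ × ℕ} {A : 𝓢(Rd d, ℂ)} {C : ℝ} (hC : 0 ≤ C)
    (h : ∀ k ≤ M.1, ∀ n ≤ M.2, ∀ x, ‖x‖ ^ k * ‖iteratedFDeriv ℝ n A x‖ ≤ C) : semi M A ≤ C := by
  refine Seminorm.finset_sup_apply_le hC fun i hi => ?_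
  have := Finset.mem_Iic.1 hi
  exact SchwartzMap.seminorm_le_bound ℂ i.1 i.2 A hC (h i.1 this.1 i.2 this.2)

/-- A continuous seminorm on the Schwartz space is bounded by one of the seminorms `semi M`. -/
theorem exists_le_semi (q : Seminorm ℂ 𝓢(Rd d, ℂ)) (hq : Continuous q) :
    ∃ (C : ℝ≥0) (M : ℕ × ℕ), ∀ A, q A ≤ C * semi M A := by
  obtain ⟨s, C, -, hC⟩ := Seminorm.bound_of_continuous (schwartz_withSeminorms ℂ (Rd d) ℂ) q hq
  obtain ⟨M, hM⟩ := finset_sup_le_semi (d := d) s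
  refine ⟨C, M, fun A => (hC A).trans ?_⟩
  simp only [smul_apply, NNReal.smul_def, smul_eq_mul]
  gcongr
  exact hM A

theorem continuous_semi (M : ℕ × ℕ) : Continuous (semi M : 𝓢(Rd d, ℂ) → ℝ) :=
  Seminorm.continuous_of_le (q := ∑ i ∈ Finset.Iic M, schwartzSeminormFamily ℂ (Rd d) ℂ i) (by
    have : ∀ i, Continuous (schwartzSeminormFamily ℂ (Rd d) ℂ i) :=
      (schwartz_withSeminorms ℂ (Rd d) ℂ).continuous_seminorm
    have h2 : ⇑(∑ i ∈ Finset.Iic M, schwartzSeminormFamily ℂ (Rd d) ℂ i)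
        = fun A => ∑ i ∈ Finset.Iic M, schwartzSeminormFamily ℂ (Rd d) ℂ i A := by
      funext A; simp
    rw [h2]
    fun_prop) (Seminorm.finset_sup_le_sum _ _)

/-- The product of `A` with the translate `B (· - a)`. -/
def shiftMul (A B : 𝓢(Rd d, ℂ)) (a : Rd d) : 𝓢(Rd d, ℂ) :=
  SchwartzMap.pairing (ContinuousLinearMap.mul ℂ ℂ) A (B.compSubConstCLM ℂ a)

@[simp]
theorem shiftMul_apply (A B : 𝓢(Rd d, ℂ)) (a t : Rd d) : shiftMul A B a t = A t * B (t - a) := by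
  simp [shiftMul]

/-- Since `1 + ‖a‖ ≤ (1 + ‖t‖) (1 + ‖t - a‖)`, decay in the shift is paid for by the decay of both
factors, derivative by derivative through the Leibniz rule. The bound is linear in `A`. -/
theorem exists_semi_shiftMul_le (M : ℕ × ℕ) (B : 𝓢(Rd d, ℂ)) (m : ℕ) :
    ∃ (C : ℝ≥0) (M' : ℕ × ℕ), ∀ (A : 𝓢(Rd d, ℂ)) (a : Rd d),
      (1 + ‖a‖) ^ m * semi M (shiftMul A B a) ≤ C * semi M' A := by
  set SB : ℝ := 2 ^ m * semi (m, M.2) B with hSB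
  have hSB0 : 0 ≤ SB := by positivity
  refine ⟨2 ^ M.2 * (2 ^ (M.1 + m)) * SB.toNNReal, (M.1 + m, M.2), fun A a => ?_⟩
  set SA : ℝ := 2 ^ (M.1 + m) * semi (M.1 + m, M.2) A with hSA
  have hSA0 : 0 ≤ SA := by positivity
  have hpos : 0 < (1 + ‖a‖) ^ m := by positivity
  rw [← le_div_iff₀' hpos]
  refine semi_le_of_forall (by positivity) fun k hk n hn t => ?_
  rw [le_div_iff₀' hpos]
  have hadd : (1 + ‖a‖) ≤ (1 + ‖t‖) * (1 + ‖t - a‖) := by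
    have h1 : ‖a‖ ≤ ‖t‖ + ‖t - a‖ := by
      have := norm_sub_le t (t - a); rwa [sub_sub_cancel] at this
    nlinarith [norm_nonneg t, norm_nonneg (t - a)]
  have hB : ∀ i, iteratedFDeriv ℝ i (fun t => B (t - a)) t = iteratedFDeriv ℝ i B (t - a) :=
    fun i => iteratedFDeriv_comp_sub i a t
  have hfun : ⇑(shiftMul A B a) = fun t => A t * B (t - a) := funext fun t => by simp
  have hBs : ContDiff ℝ n (fun t => B (t - a)) := (B.smooth n).comp (contDiff_id.sub contDiff_const)
  rw [hfun]
  calc (1 + ‖a‖) ^ m * (‖t‖ ^ k * ‖iteratedFDeriv ℝ n (fun t => A t * B (t - a)) t‖)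
      ≤ ((1 + ‖t‖) * (1 + ‖t - a‖)) ^ m * ((1 + ‖t‖) ^ M.1 *
          ∑ i ∈ Finset.range (n + 1), (n.choose i : ℝ) * ‖iteratedFDeriv ℝ i A t‖ *
            ‖iteratedFDeriv ℝ (n - i) (fun t => B (t - a)) t‖) := by
        gcongr
        · calc ‖t‖ ^ k ≤ (1 + ‖t‖) ^ k := by gcongr; linarith
            _ ≤ _ := pow_le_pow_right₀ (by linarith [norm_nonneg t]) hk
        · exact norm_iteratedFDeriv_mul_le (A.smooth n) hBs t le_rfl
    _ = ∑ i ∈ Finset.range (n + 1), (n.choose i : ℝ) *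
          (((1 + ‖t‖) ^ (M.1 + m) * ‖iteratedFDeriv ℝ i A t‖) *
            ((1 + ‖t - a‖) ^ m * ‖iteratedFDeriv ℝ (n - i) B (t - a)‖)) := by
        rw [Finset.mul_sum, Finset.mul_sum]
        refine Finset.sum_congr rfl fun i _ => ?_
        rw [hB, mul_pow, pow_add]; ring
    _ ≤ ∑ i ∈ Finset.range (n + 1), (n.choose i : ℝ) * (SA * SB) := by
        refine Finset.sum_le_sum fun i hi => ?_
        have hi' : i ≤ n := Nat.lt_succ_iff.1 (Finset.mem_range.1 hi)
        gcongr
        · exact one_add_pow_mul_le_semi A (hi'.trans hn) t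
        · exact one_add_pow_mul_le_semi B ((Nat.sub_le _ _).trans hn) (t - a)
    _ = 2 ^ n * (SA * SB) := by
        rw [← Finset.sum_mul]
        congr 1
        exact_mod_cast Nat.sum_range_choose n
    _ ≤ 2 ^ M.2 * (SA * SB) := by
        gcongr; norm_num
    _ = _ := by push_cast; rw [hSA, Real.coe_toNNReal _ hSB0]; ring

theorem exists_fourier_le_semi (m : ℕ) :
    ∃ (C : ℝ≥0) (M : ℕ × ℕ), ∀ (A : 𝓢(Rd d, ℂ)) (y : Rd d),
      (1 + ‖y‖) ^ m * ‖(𝓕 A : 𝓢(Rd d, ℂ)) y‖ ≤ C * semi M A := by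
  obtain ⟨C, M, h⟩ := exists_le_semi ((semi (m, 0)).comp
    (SchwartzMap.fourierTransformCLM ℂ (V := Rd d) (E := ℂ)).toLinearMap)
    ((continuous_semi _).comp (SchwartzMap.fourierTransformCLM ℂ).continuous)
  refine ⟨2 ^ m * C, M, fun A y => ?_⟩
  have h1 := one_add_pow_mul_le_semi (k := m) (n := 0) (𝓕 A : 𝓢(Rd d, ℂ)) le_rfl y
  rw [norm_iteratedFDeriv_zero] at h1
  have h2 : semi (m, 0) (𝓕 A : 𝓢(Rd d, ℂ)) ≤ C * semi M A := h A
  calc _ ≤ _ := h1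
    _ ≤ 2 ^ m * (C * semi M A) := by gcongr
    _ = _ := by push_cast; ring

theorem exists_semi_fourierInv_le (M : ℕ × ℕ) :
    ∃ (C : ℝ≥0) (M' : ℕ × ℕ), ∀ A : 𝓢(Rd d, ℂ), semi M (𝓕⁻ A : 𝓢(Rd d, ℂ)) ≤ C * semi M' A :=
  exists_le_semi ((semi M).comp
    (FourierTransform.fourierInvCLM ℂ 𝓢(Rd d, ℂ)).toLinearMap)
    ((continuous_semi _).comp (FourierTransform.fourierInvCLM ℂ 𝓢(Rd d, ℂ)).continuous)

theorem enorm_le_mul_bw_of_pow {E : Type*} [NormedAddCommGroup E] {y : E} {m : ℝ} {z : ℂ} {b : ℝ}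
    (h : (1 + ‖y‖) ^ ⌈m⌉₊ * ‖z‖ ≤ b) : ‖z‖ₑ ≤ ENNReal.ofReal b * bw y ^ (-m) := by
  have hb : bw y ^ m * ‖z‖ₑ ≤ ENNReal.ofReal b := by
    rw [bw_rpow_eq_ofReal, ← ofReal_norm, ← ENNReal.ofReal_mul (by positivity)]
    refine ENNReal.ofReal_le_ofReal (le_trans ?_ h)
    gcongr
    rw [← Real.rpow_natCast]
    exact Real.rpow_le_rpow_of_exponent_le (by linarith [norm_nonneg y]) (Nat.le_ceil m)
  calc ‖z‖ₑ = bw y ^ (-m) * bw y ^ m * ‖z‖ₑ := by rw [bw_rpow_neg_mul, one_mul]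
    _ = bw y ^ (-m) * (bw y ^ m * ‖z‖ₑ) := by ring
    _ ≤ bw y ^ (-m) * ENNReal.ofReal b := by gcongr
    _ = _ := mul_comm _ _

/-- Time-frequency decay of `A (t) B (t - a)`, linear in a seminorm of `A`. -/
theorem exists_fourier_shiftMul_le (B : 𝓢(Rd d, ℂ)) (m : ℝ) :
    ∃ (C : ℝ≥0) (M : ℕ × ℕ), ∀ (A : 𝓢(Rd d, ℂ)) (y a : Rd d),
      ‖(𝓕 (shiftMul A B a) : 𝓢(Rd d, ℂ)) y‖ₑ
        ≤ C * ENNReal.ofReal (semi M A) * (bw y ^ (-m) * bw a ^ (-m)) := by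
  obtain ⟨C₁, M₁, h₁⟩ := exists_fourier_le_semi (d := d) ⌈m⌉₊
  obtain ⟨C₂, M₂, h₂⟩ := exists_semi_shiftMul_le M₁ B ⌈m⌉₊
  refine ⟨C₁ * C₂, M₂, fun A y a => ?_⟩
  -- The weight in `y` is kept inside a complex number, so that `enorm_le_mul_bw_of_pow` can be
  -- applied first in `a` and then in `y`.
  have h3 : (1 + ‖a‖) ^ ⌈m⌉₊ * ‖(((1 + ‖y‖) ^ ⌈m⌉₊ : ℝ) : ℂ) *
      (𝓕 (shiftMul A B a) : 𝓢(Rd d, ℂ)) y‖ ≤ C₁ * C₂ * semi M₂ A := by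
    rw [norm_mul, Complex.norm_real, Real.norm_of_nonneg (by positivity)]
    calc _ ≤ (1 + ‖a‖) ^ ⌈m⌉₊ * (C₁ * semi M₁ (shiftMul A B a)) := by
          exact mul_le_mul_of_nonneg_left (h₁ _ y) (by positivity)
      _ = C₁ * ((1 + ‖a‖) ^ ⌈m⌉₊ * semi M₁ (shiftMul A B a)) := by ring
      _ ≤ C₁ * (C₂ * semi M₂ A) := mul_le_mul_of_nonneg_left (h₂ A a) (by positivity)
      _ = _ := by ring
  have h4 := enorm_le_mul_bw_of_pow h3
  have h5 : (1 + ‖y‖) ^ ⌈m⌉₊ * ‖(((‖(𝓕 (shiftMul A B a) : 𝓢(Rd d, ℂ)) y‖ : ℝ) : ℂ))‖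
      ≤ ‖(((1 + ‖y‖) ^ ⌈m⌉₊ : ℝ) : ℂ) * (𝓕 (shiftMul A B a) : 𝓢(Rd d, ℂ)) y‖ := by
    rw [norm_mul, Complex.norm_real, Complex.norm_real, norm_norm,
      Real.norm_of_nonneg (by positivity)]
  have h6 := enorm_le_mul_bw_of_pow h5
  rw [ofReal_norm] at h6
  have h7 : ‖(((‖(𝓕 (shiftMul A B a) : 𝓢(Rd d, ℂ)) y‖ : ℝ) : ℂ))‖ₑ
      = ‖(𝓕 (shiftMul A B a) : 𝓢(Rd d, ℂ)) y‖ₑ := by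
    rw [← ofReal_norm, ← ofReal_norm, Complex.norm_real, norm_norm]
  rw [h7] at h6
  refine h6.trans ((mul_le_mul' h4 le_rfl).trans (le_of_eq ?_))
  rw [ENNReal.ofReal_mul (by positivity), ENNReal.ofReal_mul (by positivity),
    ENNReal.ofReal_coe_nnreal, ENNReal.ofReal_coe_nnreal]
  push_cast
  ring

/-- Decay in `y` and `b` is linear in a seminorm of `shiftMul A B a`, and that seminorm itself
decays in `a`. -/
theorem exists_fourier_shiftMul_shiftMul_le (A B D : 𝓢(Rd d, ℂ)) (m : ℝ) :
    ∃ C : ℝ≥0, ∀ y a b : Rd d,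
      ‖(𝓕 (shiftMul (shiftMul A B a) D b) : 𝓢(Rd d, ℂ)) y‖ₑ
        ≤ C * (bw y ^ (-m) * bw a ^ (-m) * bw b ^ (-m)) := by
  obtain ⟨C₁, M₁, h₁⟩ := exists_fourier_shiftMul_le D m
  obtain ⟨C₂, M₂, h₂⟩ := exists_semi_shiftMul_le M₁ B ⌈m⌉₊
  refine ⟨C₁ * (C₂ * (semi M₂ A).toNNReal), fun y a b => (h₁ _ y b).trans ?_⟩
  have h3 : (1 + ‖a‖) ^ ⌈m⌉₊ * ‖((semi M₁ (shiftMul A B a) : ℝ) : ℂ)‖ ≤ C₂ * semi M₂ A := by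
    rw [Complex.norm_real, Real.norm_of_nonneg (apply_nonneg _ _)]
    exact h₂ A a
  have h4 := enorm_le_mul_bw_of_pow h3
  rw [← ofReal_norm, Complex.norm_real, Real.norm_of_nonneg (apply_nonneg _ _),
    ENNReal.ofReal_mul (by positivity), ENNReal.ofReal_coe_nnreal] at h4
  calc _ ≤ C₁ * (C₂ * ENNReal.ofReal (semi M₂ A) * bw a ^ (-m)) * (bw y ^ (-m) * bw b ^ (-m)) := by
        gcongr
    _ = _ := by
        push_cast
        rw [ENNReal.ofReal]
        ring

end Seminorms

/-! ### Continuity of translations and of time-frequency shifts -/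

section Translation

theorem semi_compSubConst_le (M : ℕ × ℕ) (A : 𝓢(Rd d, ℂ)) (a : Rd d) :
    semi M (A.compSubConstCLM ℂ a) ≤ 2 ^ M.1 * (1 + ‖a‖) ^ M.1 * semi M A := by
  refine semi_le_of_forall (by positivity) fun k hk n hn t => ?_
  have hB : iteratedFDeriv ℝ n (fun t => A (t - a)) t = iteratedFDeriv ℝ n A (t - a) :=
    iteratedFDeriv_comp_sub n a t
  have hfun : ⇑(A.compSubConstCLM ℂ a) = fun t => A (t - a) := funext fun t => by simp
  rw [hfun, hB]
  have hadd : ‖t‖ ≤ (1 + ‖a‖) * (1 + ‖t - a‖) := by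
    have h1 : ‖t‖ ≤ ‖a‖ + ‖t - a‖ := by simpa using norm_add_le a (t - a)
    nlinarith [norm_nonneg a, norm_nonneg (t - a)]
  calc _ ≤ ((1 + ‖a‖) * (1 + ‖t - a‖)) ^ k * ‖iteratedFDeriv ℝ n A (t - a)‖ := by gcongr
    _ ≤ ((1 + ‖a‖) * (1 + ‖t - a‖)) ^ M.1 * ‖iteratedFDeriv ℝ n A (t - a)‖ := by
        gcongr
        nlinarith [norm_nonneg a, norm_nonneg (t - a)]
    _ = (1 + ‖a‖) ^ M.1 * ((1 + ‖t - a‖) ^ M.1 * ‖iteratedFDeriv ℝ n A (t - a)‖) := by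
        rw [mul_pow]; ring
    _ ≤ (1 + ‖a‖) ^ M.1 * (2 ^ M.1 * semi M A) := by
        exact mul_le_mul_of_nonneg_left (one_add_pow_mul_le_semi A hn (t - a)) (by positivity)
    _ = _ := by ring

/-- Mean value inequality at fixed `t` for `u ↦ ‖t‖ ^ k • Dⁿ A u` on the ball of radius `R` about
`t`, which contains `t - a` and `t - b`; hence the one additional derivative. -/
theorem semi_compSubConst_sub_le (M : ℕ × ℕ) (A : 𝓢(Rd d, ℂ)) {a b : Rd d} {R : ℝ}
    (ha : ‖a‖ ≤ R) (hb : ‖b‖ ≤ R) :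
    semi M (A.compSubConstCLM ℂ a - A.compSubConstCLM ℂ b)
      ≤ (1 + R) ^ M.1 * (2 ^ M.1 * semi (M.1, M.2 + 1) A) * ‖a - b‖ := by
  have hR : 0 ≤ R := (norm_nonneg a).trans ha
  refine semi_le_of_forall (by positivity) fun k hk n hn t => ?_
  have hfun : ⇑(A.compSubConstCLM ℂ a - A.compSubConstCLM ℂ b)
      = (fun t => A (t - a)) - fun t => A (t - b) := funext fun t => by simp
  have hs : ∀ a, ContDiff ℝ n (fun t => A (t - a)) := fun a =>
    (A.smooth n).comp (contDiff_id.sub contDiff_const)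
  have hB : ∀ a, iteratedFDeriv ℝ n (fun t => A (t - a)) t = iteratedFDeriv ℝ n A (t - a) :=
    fun a => iteratedFDeriv_comp_sub n a t
  rw [hfun, iteratedFDeriv_sub_apply (hs a).contDiffAt (hs b).contDiffAt, hB, hB]
  have hdiff : Differentiable ℝ (iteratedFDeriv ℝ n A) :=
    (A.smooth ⊤).differentiable_iteratedFDeriv (by exact_mod_cast WithTop.coe_lt_top n)
  have key := Convex.norm_image_sub_le_of_norm_fderiv_le (𝕜 := ℝ)
    (f := fun u => (‖t‖ ^ k) • iteratedFDeriv ℝ n A u) (s := Metric.closedBall t R)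
    (x := t - b) (y := t - a) (C := (1 + R) ^ M.1 * (2 ^ M.1 * semi (M.1, M.2 + 1) A))
    (fun u _ => (hdiff u).fun_const_smul _) ?_ (convex_closedBall t R)
    (by simpa [Metric.mem_closedBall, dist_eq_norm] using hb)
    (by simpa [Metric.mem_closedBall, dist_eq_norm] using ha)
  · rw [← smul_sub, norm_smul, norm_pow, norm_norm, sub_sub_sub_cancel_left, norm_sub_rev b a] at key
    exact key
  · intro u hu
    rw [Metric.mem_closedBall, dist_eq_norm, norm_sub_rev] at hu
    rw [fderiv_fun_const_smul (hdiff u), norm_smul, norm_pow, norm_norm, norm_fderiv_iteratedFDeriv]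
    have h1 : ‖t‖ ≤ (1 + R) * (1 + ‖u‖) := by
      have : ‖t‖ ≤ ‖t - u‖ + ‖u‖ := by simpa using norm_add_le (t - u) u
      nlinarith [norm_nonneg u]
    calc _ ≤ ((1 + R) * (1 + ‖u‖)) ^ k * ‖iteratedFDeriv ℝ (n + 1) A u‖ := by gcongr
      _ ≤ ((1 + R) * (1 + ‖u‖)) ^ M.1 * ‖iteratedFDeriv ℝ (n + 1) A u‖ := by
          gcongr
          nlinarith [norm_nonneg u]
      _ = (1 + R) ^ M.1 * ((1 + ‖u‖) ^ M.1 * ‖iteratedFDeriv ℝ (n + 1) A u‖) := by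
          rw [mul_pow]; ring
      _ ≤ _ := mul_le_mul_of_nonneg_left (one_add_pow_mul_le_semi A (by omega) u) (by positivity)

/-- Translations act jointly continuously on the Schwartz space. -/
theorem continuous_compSubConst :
    Continuous fun z : Rd d × 𝓢(Rd d, ℂ) => z.2.compSubConstCLM ℂ z.1 := by
  rw [continuous_iff_continuousAt]
  rintro ⟨a, A⟩
  rw [ContinuousAt, (schwartz_withSeminorms ℂ (Rd d) ℂ).tendsto_nhds]
  rintro ⟨k, n⟩ ε hε
  have hbound : ∀ᶠ z : Rd d × 𝓢(Rd d, ℂ) in 𝓝 (a, A),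
      semi (k, n) (z.2.compSubConstCLM ℂ z.1 - A.compSubConstCLM ℂ a)
        ≤ 2 ^ k * (1 + ‖z.1‖) ^ k * semi (k, n) (z.2 - A)
          + (1 + (‖a‖ + 1)) ^ k * (2 ^ k * semi (k, n + 1) A) * ‖z.1 - a‖ := by
    have h1 : ∀ᶠ z : Rd d × 𝓢(Rd d, ℂ) in 𝓝 (a, A), ‖z.1‖ < ‖a‖ + 1 :=
      (continuous_fst.norm.tendsto (a, A)).eventually (gt_mem_nhds (by simp))
    filter_upwards [h1] with z hz
    have e : z.2.compSubConstCLM ℂ z.1 - A.compSubConstCLM ℂ a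
        = (z.2 - A).compSubConstCLM ℂ z.1
          + (A.compSubConstCLM ℂ z.1 - A.compSubConstCLM ℂ a) := by
      rw [map_sub]; abel
    rw [e]
    refine (map_add_le_add _ _ _).trans (add_le_add ?_ ?_)
    · exact semi_compSubConst_le (k, n) _ _
    · exact semi_compSubConst_sub_le (k, n) A hz.le (by linarith)
  have hlim : Tendsto (fun z : Rd d × 𝓢(Rd d, ℂ) =>
      2 ^ k * (1 + ‖z.1‖) ^ k * semi (k, n) (z.2 - A)
          + (1 + (‖a‖ + 1)) ^ k * (2 ^ k * semi (k, n + 1) A) * ‖z.1 - a‖) (𝓝 (a, A)) (𝓝 0) := by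
    have hc : Continuous fun z : Rd d × 𝓢(Rd d, ℂ) =>
      2 ^ k * (1 + ‖z.1‖) ^ k * semi (k, n) (z.2 - A)
          + (1 + (‖a‖ + 1)) ^ k * (2 ^ k * semi (k, n + 1) A) * ‖z.1 - a‖ := by
      have := (continuous_semi (d := d) (k, n)).comp
        ((continuous_snd (X := Rd d) (Y := 𝓢(Rd d, ℂ))).sub (continuous_const (y := A)))
      have h2 : Continuous fun z : Rd d × 𝓢(Rd d, ℂ) => semi (k, n) (z.2 - A) := this
      fun_prop
    simpa using hc.tendsto (a, A)
  filter_upwards [hbound, hlim.eventually (gt_mem_nhds hε)] with z h1 h2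
  exact (seminorm_le_semi k n _).trans_lt (h1.trans_lt h2)

/-- The complex conjugate of a Schwartz function. -/
def conjS (g : 𝓢(Rd d, ℂ)) : 𝓢(Rd d, ℂ) := g.postcompCLM Complex.conjCLE.toContinuousLinearMap

@[simp]
theorem conjS_apply (g : 𝓢(Rd d, ℂ)) (t : Rd d) : conjS g t = starRingEnd ℂ (g t) := by
  simp [conjS]

/-- Modulation is translation on the Fourier side, so continuity and growth of time-frequency shifts
reduce to those of translations. -/
theorem conjShift_eq (g : 𝓢(Rd d, ℂ)) (x ξ : Rd d) :
    conjShift g x ξ = 𝓕⁻ ((𝓕 ((conjS g).compSubConstCLM ℂ x) : 𝓢(Rd d, ℂ)).compSubConstCLM ℂ (-ξ)) := by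
  have h : (𝓕 (conjShift g x ξ) : 𝓢(Rd d, ℂ))
      = (𝓕 ((conjS g).compSubConstCLM ℂ x) : 𝓢(Rd d, ℂ)).compSubConstCLM ℂ (-ξ) := by
    ext y
    rw [SchwartzMap.compSubConstCLM_apply, SchwartzMap.fourier_coe, SchwartzMap.fourier_coe,
      Real.fourier_eq', Real.fourier_eq']
    refine integral_congr_ae (Eventually.of_forall fun t => ?_)
    simp only [conjShift_apply, SchwartzMap.compSubConstCLM_apply, conjS_apply, map_mul, smul_eq_mul,
      character]
    rw [← Complex.exp_conj, ← mul_assoc, ← Complex.exp_add]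
    congr 2
    simp only [map_mul, Complex.conj_ofReal, Complex.conj_I, sub_neg_eq_add, inner_add_right,
      real_inner_comm t ξ]
    push_cast
    ring
  rw [← h, FourierTransform.fourierInv_fourier_eq]

theorem continuous_conjShift (g : 𝓢(Rd d, ℂ)) :
    Continuous fun z : Rd d × Rd d => conjShift g z.1 z.2 := by
  simp_rw [conjShift_eq]
  have h1 : Continuous fun z : Rd d × Rd d => (conjS g).compSubConstCLM ℂ z.1 :=
    continuous_compSubConst.comp (continuous_fst.prodMk continuous_const)
  have h2 : Continuous fun z : Rd d × Rd d =>
      (𝓕 ((conjS g).compSubConstCLM ℂ z.1) : 𝓢(Rd d, ℂ)) :=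
    (FourierTransform.fourierCLM ℂ 𝓢(Rd d, ℂ)).continuous.comp h1
  exact (FourierTransform.fourierInvCLM ℂ 𝓢(Rd d, ℂ)).continuous.comp
    (continuous_compSubConst.comp (continuous_snd.neg.prodMk h2))

/-- Time-frequency shifts have polynomial growth in each Schwartz seminorm. -/
theorem exists_semi_conjShift_le (g : 𝓢(Rd d, ℂ)) (M : ℕ × ℕ) :
    ∃ (C : ℝ≥0) (n : ℕ), ∀ x ξ : Rd d,
      semi M (conjShift g x ξ) ≤ C * ((1 + ‖x‖) ^ n * (1 + ‖ξ‖) ^ n) := by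
  obtain ⟨C₁, M₁, h₁⟩ := exists_semi_fourierInv_le (d := d) M
  obtain ⟨C₂, M₂, h₂⟩ := exists_le_semi ((semi M₁).comp
    (SchwartzMap.fourierTransformCLM ℂ (V := Rd d) (E := ℂ)).toLinearMap)
    ((continuous_semi _).comp (SchwartzMap.fourierTransformCLM ℂ).continuous)
  have h₂' : ∀ A : 𝓢(Rd d, ℂ), semi M₁ (𝓕 A : 𝓢(Rd d, ℂ)) ≤ C₂ * semi M₂ A := h₂
  refine ⟨C₁ * 2 ^ M₁.1 * C₂ * 2 ^ M₂.1 * (semi M₂ (conjS g)).toNNReal, max M₁.1 M₂.1,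
    fun x ξ => ?_⟩
  rw [conjShift_eq]
  have hx : 1 ≤ 1 + ‖x‖ := by linarith [norm_nonneg x]
  have hξ : 1 ≤ 1 + ‖ξ‖ := by linarith [norm_nonneg ξ]
  calc _ ≤ _ := h₁ _
    _ ≤ C₁ * (2 ^ M₁.1 * (1 + ‖-ξ‖) ^ M₁.1 *
          semi M₁ (𝓕 ((conjS g).compSubConstCLM ℂ x) : 𝓢(Rd d, ℂ))) := by
        gcongr; exact semi_compSubConst_le _ _ _
    _ ≤ C₁ * (2 ^ M₁.1 * (1 + ‖-ξ‖) ^ M₁.1 *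
          (C₂ * (2 ^ M₂.1 * (1 + ‖x‖) ^ M₂.1 * semi M₂ (conjS g)))) := by
        gcongr
        exact (h₂' _).trans (by gcongr; exact semi_compSubConst_le _ _ _)
    _ ≤ C₁ * (2 ^ M₁.1 * (1 + ‖ξ‖) ^ max M₁.1 M₂.1 *
          (C₂ * (2 ^ M₂.1 * (1 + ‖x‖) ^ max M₁.1 M₂.1 * semi M₂ (conjS g)))) := by
        rw [norm_neg]
        gcongr
        · exact le_max_left _ _
        · exact le_max_right _ _
    _ = _ := by
        push_cast
        rw [Real.coe_toNNReal _ (apply_nonneg _ _)]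
        ring

end Translation

/-! ### Integrals of families of Schwartz functions -/

section SchwartzIntegral

open scoped ContDiff BoundedContinuousFunction

/-- Iterated differentiation under the integral sign. -/
theorem contDiff_integral_and_iteratedFDeriv {X : Type*} [MeasurableSpace X] {μ : Measure X}
    {E : Type} [NormedAddCommGroup E] [NormedSpace ℝ E] (n : ℕ) :
    ∀ {F : Type} [NormedAddCommGroup F] [NormedSpace ℝ F] (Φ : X → E → F),
      (∀ x, ContDiff ℝ ∞ (Φ x)) →
      (∀ k t, AEStronglyMeasurable (fun x => iteratedFDeriv ℝ k (Φ x) t) μ) →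
      (∀ k, ∃ b : X → ℝ, Integrable b μ ∧ ∀ x t, ‖iteratedFDeriv ℝ k (Φ x) t‖ ≤ b x) →
      ContDiff ℝ n (fun t => ∫ x, Φ x t ∂μ) ∧
        ∀ t, iteratedFDeriv ℝ n (fun t => ∫ x, Φ x t ∂μ) t
          = ∫ x, iteratedFDeriv ℝ n (Φ x) t ∂μ := by
  have hmeas0 : ∀ {F : Type} [NormedAddCommGroup F] [NormedSpace ℝ F] (Φ : X → E → F),
      (∀ k t, AEStronglyMeasurable (fun x => iteratedFDeriv ℝ k (Φ x) t) μ) →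
      ∀ t, AEStronglyMeasurable (fun x => Φ x t) μ := by
    intro F _ _ Φ hm t
    have := (continuousMultilinearCurryFin0 ℝ E F).continuous.comp_aestronglyMeasurable (hm 0 t)
    refine this.congr (Eventually.of_forall fun x => ?_)
    simp [iteratedFDeriv_zero_eq_comp]
  have hderiv : ∀ {F : Type} [NormedAddCommGroup F] [NormedSpace ℝ F] (Φ : X → E → F),
      (∀ x, ContDiff ℝ ∞ (Φ x)) →
      (∀ k t, AEStronglyMeasurable (fun x => iteratedFDeriv ℝ k (Φ x) t) μ) →
      (∀ k, ∃ b : X → ℝ, Integrable b μ ∧ ∀ x t, ‖iteratedFDeriv ℝ k (Φ x) t‖ ≤ b x) →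
      (∀ k t, AEStronglyMeasurable (fun x => iteratedFDeriv ℝ k (fderiv ℝ (Φ x)) t) μ) ∧
      (∀ k, ∃ b : X → ℝ, Integrable b μ ∧ ∀ x t, ‖iteratedFDeriv ℝ k (fderiv ℝ (Φ x)) t‖ ≤ b x) ∧
      (∀ t, HasFDerivAt (fun t => ∫ x, Φ x t ∂μ) (∫ x, fderiv ℝ (Φ x) t ∂μ) t) := by
    intro F _ _ Φ hs hm hb
    have h1 : ∀ k t, AEStronglyMeasurable (fun x => iteratedFDeriv ℝ k (fderiv ℝ (Φ x)) t) μ := by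
      intro k t
      have := (continuousMultilinearCurryRightEquiv' ℝ k E F).continuous.comp_aestronglyMeasurable
        (hm (k + 1) t)
      refine this.congr (Eventually.of_forall fun x => ?_)
      simp only [iteratedFDeriv_succ_eq_comp_right, Function.comp_apply,
        LinearIsometryEquiv.apply_symm_apply]
    have h2 : ∀ k, ∃ b : X → ℝ, Integrable b μ ∧
        ∀ x t, ‖iteratedFDeriv ℝ k (fderiv ℝ (Φ x)) t‖ ≤ b x := by
      intro k
      obtain ⟨b, hb1, hb2⟩ := hb (k + 1)
      refine ⟨b, hb1, fun x t => ?_⟩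
      rw [norm_iteratedFDeriv_fderiv]
      exact hb2 x t
    refine ⟨h1, h2, fun t => ?_⟩
    obtain ⟨b₀, hb₀, hb₀'⟩ := hb 0
    obtain ⟨b₁, hb₁, hb₁'⟩ := h2 0
    refine hasFDerivAt_integral_of_dominated_of_fderiv_le (s := Set.univ) (bound := b₁)
      (F' := fun t x => fderiv ℝ (Φ x) t)
      univ_mem (Eventually.of_forall (hmeas0 Φ hm)) ?_ (hmeas0 _ h1 t) ?_ hb₁ ?_
    · exact hb₀.mono' (hmeas0 Φ hm t) (Eventually.of_forall fun x => by
        simpa using hb₀' x t)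
    · exact Eventually.of_forall fun x t _ => by simpa using hb₁' x t
    · exact Eventually.of_forall fun x t _ =>
        ((hs x).differentiable (by simp) t).hasFDerivAt
  -- The target space is quantified after `n`: the inductive step applies the hypothesis to
  -- `fderiv`, whose values lie in another space.
  induction n with
  | zero =>
    intro F _ _ Φ hs hm hb
    obtain ⟨-, -, hd⟩ := hderiv Φ hs hm hb
    refine ⟨contDiff_zero.2 (continuous_iff_continuousAt.2 fun t => (hd t).continuousAt),
      fun t => ?_⟩
    simp only [iteratedFDeriv_zero_eq_comp, Function.comp_apply]
    exact ((continuousMultilinearCurryFin0 ℝ E F).symm.toContinuousLinearEquiv.integral_comp_comm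
      (μ := μ) (fun x => Φ x t)).symm
  | succ n ih =>
    intro F _ _ Φ hs hm hb
    obtain ⟨h1, h2, hd⟩ := hderiv Φ hs hm hb
    have hfd : fderiv ℝ (fun t => ∫ x, Φ x t ∂μ) = fun t => ∫ x, fderiv ℝ (Φ x) t ∂μ :=
      funext fun t => (hd t).fderiv
    obtain ⟨i1, i2⟩ := ih (fun x => fderiv ℝ (Φ x))
      (fun x => (hs x).fderiv_right (by simp)) h1 h2
    refine ⟨?_, fun t => ?_⟩
    · rw [show ((n + 1 : ℕ) : ℕ∞ω) = (n : ℕ∞ω) + 1 by push_cast; rfl,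
        contDiff_succ_iff_fderiv]
      refine ⟨fun t => (hd t).differentiableAt, by simp, ?_⟩
      rw [hfd]; exact i1
    · simp only [iteratedFDeriv_succ_eq_comp_right, Function.comp_apply]
      rw [hfd, i2 t]
      exact ((continuousMultilinearCurryRightEquiv' ℝ n E F).symm.toContinuousLinearEquiv
        |>.integral_comp_comm (μ := μ)
        (fun x => iteratedFDeriv ℝ n (fderiv ℝ (Φ x)) t)).symm

/-- Bounded continuous functions with values in the `n`-multilinear forms. -/
def DerivSpace (d n : ℕ) : Type :=
  Rd d →ᵇ ContinuousMultilinearMap ℝ (fun _ : Fin n => Rd d) ℂ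

instance (n : ℕ) : NormedAddCommGroup (DerivSpace d n) :=
  inferInstanceAs (NormedAddCommGroup (Rd d →ᵇ ContinuousMultilinearMap ℝ
    (fun _ : Fin n => Rd d) ℂ))

instance (n : ℕ) : NormedSpace ℂ (DerivSpace d n) :=
  inferInstanceAs (NormedSpace ℂ (Rd d →ᵇ ContinuousMultilinearMap ℝ
    (fun _ : Fin n => Rd d) ℂ))

instance (n : ℕ) : CompleteSpace (DerivSpace d n) :=
  inferInstanceAs (CompleteSpace (Rd d →ᵇ ContinuousMultilinearMap ℝ
    (fun _ : Fin n => Rd d) ℂ))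

/-- Evaluation at a point. -/
def DerivSpace.eval {n : ℕ} (t : Rd d) :
    DerivSpace d n →L[ℂ] ContinuousMultilinearMap ℝ (fun _ : Fin n => Rd d) ℂ :=
  BoundedContinuousFunction.evalCLM ℂ t

theorem DerivSpace.ext {n : ℕ} {f g : DerivSpace d n} (h : ∀ t, eval t f = eval t g) : f = g :=
  BoundedContinuousFunction.ext h

theorem DerivSpace.norm_eval_le {n : ℕ} (f : DerivSpace d n) (t : Rd d) : ‖eval t f‖ ≤ ‖f‖ :=
  BoundedContinuousFunction.norm_coe_le_norm (α := Rd d) f t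

/-- The bounded continuous function `t ↦ ‖t‖ᵏ Dⁿ A (t)`. -/
def weightedDerivFun (k n : ℕ) (A : 𝓢(Rd d, ℂ)) : DerivSpace d n :=
  BoundedContinuousFunction.ofNormedAddCommGroup
    (fun t => ‖t‖ ^ k • iteratedFDeriv ℝ n A t)
    (by
      have : Continuous (iteratedFDeriv ℝ n A) :=
        (A.smooth ⊤).continuous_iteratedFDeriv (by exact_mod_cast le_top)
      fun_prop)
    (SchwartzMap.seminorm ℂ k n A)
    (fun t => by
      rw [norm_smul, norm_pow, norm_norm]
      exact SchwartzMap.le_seminorm ℂ k n A t)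

theorem eval_weightedDerivFun (k n : ℕ) (A : 𝓢(Rd d, ℂ)) (t : Rd d) :
    DerivSpace.eval t (weightedDerivFun k n A) = ‖t‖ ^ k • iteratedFDeriv ℝ n A t := rfl

theorem norm_weightedDerivFun_le (k n : ℕ) (A : 𝓢(Rd d, ℂ)) :
    ‖weightedDerivFun k n A‖ ≤ SchwartzMap.seminorm ℂ k n A := by
  refine (BoundedContinuousFunction.norm_le (α := Rd d) (apply_nonneg _ _)).2 fun t => ?_
  change ‖‖t‖ ^ k • iteratedFDeriv ℝ n A t‖ ≤ _
  rw [norm_smul, norm_pow, norm_norm]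
  exact SchwartzMap.le_seminorm ℂ k n A t

/-- The map `A ↦ ‖t‖ᵏ Dⁿ A (t)` from Schwartz functions to bounded continuous functions. -/
def weightedDeriv (k n : ℕ) : 𝓢(Rd d, ℂ) →L[ℂ] DerivSpace d n :=
  SchwartzMap.mkCLMtoNormedSpace (σ := RingHom.id ℂ) (weightedDerivFun k n)
    (fun A B => DerivSpace.ext fun t => by
      rw [map_add, eval_weightedDerivFun, eval_weightedDerivFun, eval_weightedDerivFun, FunLike.coe_add,
        iteratedFDeriv_add_apply (A.smooth n).contDiffAt (B.smooth n).contDiffAt, smul_add])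
    (fun c A => DerivSpace.ext fun t => by
      rw [map_smul, eval_weightedDerivFun, eval_weightedDerivFun, FunLike.coe_smul,
        iteratedFDeriv_const_smul_apply (A.smooth n).contDiffAt, smul_comm]
      rfl)
    ⟨{(k, n)}, 1, zero_le_one, fun A => by
      rw [one_mul, Finset.sup_singleton]
      exact norm_weightedDerivFun_le k n A⟩

theorem eval_weightedDeriv (k n : ℕ) (A : 𝓢(Rd d, ℂ)) (t : Rd d) :
    DerivSpace.eval t (weightedDeriv k n A) = ‖t‖ ^ k • iteratedFDeriv ℝ n A t := rfl

theorem norm_weightedDeriv_le (k n : ℕ) (A : 𝓢(Rd d, ℂ)) :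
    ‖weightedDeriv k n A‖ ≤ SchwartzMap.seminorm ℂ k n A :=
  norm_weightedDerivFun_le k n A

theorem seminorm_le_norm_weightedDeriv (k n : ℕ) (A : 𝓢(Rd d, ℂ)) :
    SchwartzMap.seminorm ℂ k n A ≤ ‖weightedDeriv k n A‖ := by
  refine SchwartzMap.seminorm_le_bound ℂ k n A (norm_nonneg (weightedDeriv k n A)) fun t => ?_
  have := (weightedDeriv k n A).norm_eval_le t
  rwa [eval_weightedDeriv, norm_smul, norm_pow, norm_norm] at this

theorem continuous_iteratedFDeriv_eval (n : ℕ) (t : Rd d) :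
    Continuous fun A : 𝓢(Rd d, ℂ) => iteratedFDeriv ℝ n A t := by
  have h : Continuous fun A : 𝓢(Rd d, ℂ) => DerivSpace.eval t (weightedDeriv 0 n A) :=
    (DerivSpace.eval t).continuous.comp (weightedDeriv 0 n).continuous
  simpa [eval_weightedDeriv] using h

/-- A functional that is dominated by the norm of a linear map factors through that map. -/
theorem exists_factor_of_norm_le {V G : Type*} [AddCommGroup V] [Module ℂ V]
    [NormedAddCommGroup G] [NormedSpace ℂ G] (T : V →ₗ[ℂ] ℂ) (J : V →ₗ[ℂ] G) (C : ℝ)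
    (h : ∀ A, ‖T A‖ ≤ C * ‖J A‖) : ∃ S : G →L[ℂ] ℂ, ∀ A, T A = S (J A) := by
  -- Transport `T` to the range of `J` by a linear section; the domination makes the result bounded
  -- and independent of the section, and Hahn–Banach extends it.
  obtain ⟨σ, hσ⟩ := J.rangeRestrict.exists_rightInverse_of_surjective
    (LinearMap.range_eq_top.2 J.surjective_rangeRestrict)
  have hσ' : ∀ y, J (σ y) = y := fun y => congrArg Subtype.val (LinearMap.congr_fun hσ y)
  let g : StrongDual ℂ J.range := LinearMap.mkContinuous (T ∘ₗ σ) C fun y => by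
    have := h (σ y)
    rwa [hσ'] at this
  obtain ⟨S, hS, -⟩ := exists_extension_norm_eq J.range g
  refine ⟨S, fun A => ?_⟩
  have h1 := hS ⟨J A, LinearMap.mem_range_self J A⟩
  have h2 : T (σ ⟨J A, LinearMap.mem_range_self J A⟩) = T A := by
    rw [← sub_eq_zero, ← map_sub, ← norm_le_zero_iff]
    refine (h _).trans ?_
    rw [map_sub, hσ', sub_self, norm_zero, mul_zero]
  exact h2.symm.trans h1.symm

/-- Finitely many weighted derivatives, as a map to a normed space. -/
def weightedDerivs (s : Finset (ℕ × ℕ)) :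
    𝓢(Rd d, ℂ) →L[ℂ] (∀ i : s, DerivSpace d i.1.2) :=
  ContinuousLinearMap.pi fun i => weightedDeriv i.1.1 i.1.2

/-- A tempered distribution factors through finitely many weighted derivatives. -/
theorem exists_factor_weightedDerivs (T : 𝓢(Rd d, ℂ) →L[ℂ] ℂ) :
    ∃ (s : Finset (ℕ × ℕ)) (S : (∀ i : s, DerivSpace d i.1.2) →L[ℂ] ℂ),
      ∀ A, T A = S (weightedDerivs s A) := by
  have hq : Continuous ((normSeminorm ℂ ℂ).comp T.toLinearMap) := T.continuous.norm
  obtain ⟨s, C, -, hC⟩ := Seminorm.bound_of_continuous (schwartz_withSeminorms ℂ (Rd d) ℂ) _ hq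
  refine ⟨s, exists_factor_of_norm_le T.toLinearMap (weightedDerivs s).toLinearMap C fun A => ?_⟩
  refine (hC A).trans ?_
  simp only [smul_apply, NNReal.smul_def, smul_eq_mul]
  refine mul_le_mul_of_nonneg_left ?_ C.2
  refine Seminorm.finset_sup_apply_le (norm_nonneg _) fun i hi => ?_
  exact (seminorm_le_norm_weightedDeriv i.1 i.2 A).trans
    (norm_le_pi_norm (weightedDerivs s A) ⟨i, hi⟩)

/-- The integral of a continuous family of Schwartz functions, against a density for which all the
seminorms are integrable, is a Schwartz function, and tempered distributions commute with it. -/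
theorem exists_schwartz_integral {X : Type*} [TopologicalSpace X] [SecondCountableTopology X]
    [MeasurableSpace X] [BorelSpace X] {μ : Measure X} {Ψ : X → 𝓢(Rd d, ℂ)} (hΨ : Continuous Ψ)
    {c : X → ℂ} (hc : AEStronglyMeasurable c μ)
    (hint : ∀ k n, Integrable (fun x => ‖c x‖ * SchwartzMap.seminorm ℂ k n (Ψ x)) μ) :
    ∃ A : 𝓢(Rd d, ℂ), (∀ t, A t = ∫ x, c x * Ψ x t ∂μ) ∧
      ∀ T : 𝓢(Rd d, ℂ) →L[ℂ] ℂ, T A = ∫ x, c x * T (Ψ x) ∂μ := by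
  have hsm : ∀ x, ContDiff ℝ ∞ (Ψ x) := fun x => (Ψ x).smooth ⊤
  have hD : ∀ n x t, iteratedFDeriv ℝ n (fun t => c x * Ψ x t) t
      = c x • iteratedFDeriv ℝ n (Ψ x) t := fun n x t => by
    have := iteratedFDeriv_const_smul_apply (𝕜 := ℝ) (a := c x) (x := t) (i := n)
      ((Ψ x).smooth n).contDiffAt
    exact this
  have hmeas : ∀ n t, AEStronglyMeasurable (fun x => c x • iteratedFDeriv ℝ n (Ψ x) t) μ :=
    fun n t => hc.smul ((continuous_iteratedFDeriv_eval n t).comp hΨ).aestronglyMeasurable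
  have hgen := fun n => contDiff_integral_and_iteratedFDeriv (μ := μ) n (fun x t => c x * Ψ x t)
    (fun x => contDiff_const.mul (hsm x))
    (fun k t => by simp_rw [hD]; exact hmeas k t)
    (fun k => ⟨_, hint 0 k, fun x t => by
      rw [hD, norm_smul]
      gcongr
      exact SchwartzMap.norm_iteratedFDeriv_le_seminorm ℂ (Ψ x) k t⟩)
  have hformula : ∀ n t, iteratedFDeriv ℝ n (fun t => ∫ x, c x * Ψ x t ∂μ) t
      = ∫ x, c x • iteratedFDeriv ℝ n (Ψ x) t ∂μ := fun n t => by
    rw [(hgen n).2 t]; simp_rw [hD]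
  let A : 𝓢(Rd d, ℂ) :=
    { toFun := fun t => ∫ x, c x * Ψ x t ∂μ
      smooth' := contDiff_infty.2 fun n => (hgen n).1
      decay' := fun k n => ⟨∫ x, ‖c x‖ * SchwartzMap.seminorm ℂ k n (Ψ x) ∂μ, fun t => by
        rw [hformula, ← norm_norm t, ← norm_pow, ← norm_smul, ← integral_smul]
        refine norm_integral_le_of_norm_le (hint k n) (Eventually.of_forall fun x => ?_)
        rw [smul_comm, norm_smul, norm_smul, norm_pow, norm_norm]
        gcongr
        exact SchwartzMap.le_seminorm ℂ k n (Ψ x) t⟩ }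
  have hA : ∀ t, A t = ∫ x, c x * Ψ x t ∂μ := fun t => rfl
  have hAD : ∀ n t, iteratedFDeriv ℝ n A t = ∫ x, c x • iteratedFDeriv ℝ n (Ψ x) t ∂μ := hformula
  refine ⟨A, hA, fun T => ?_⟩
  -- Factored through a Banach space, `T` commutes with the Bochner integral taken there. It remains
  -- to identify the weighted derivatives of `A` with the integral of those of `Ψ x`, which is
  -- checked by evaluation at points.
  obtain ⟨s, S, hS⟩ := exists_factor_weightedDerivs T
  have hJint : Integrable (fun x => c x • weightedDerivs s (Ψ x)) μ := by
    have hb : Integrable (fun x => ∑ i ∈ s, ‖c x‖ * SchwartzMap.seminorm ℂ i.1 i.2 (Ψ x)) μ :=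
      integrable_finsetSum _ fun i _ => hint i.1 i.2
    refine hb.mono' (hc.smul ((weightedDerivs s).continuous.comp hΨ).aestronglyMeasurable)
      (Eventually.of_forall fun x => ?_)
    rw [norm_smul, ← Finset.mul_sum]
    refine mul_le_mul_of_nonneg_left ?_ (norm_nonneg _)
    refine (pi_norm_le_iff_of_nonneg (Finset.sum_nonneg fun i _ => apply_nonneg _ _)).2 fun i => ?_
    exact (norm_weightedDeriv_le i.1.1 i.1.2 (Ψ x)).trans
      (Finset.single_le_sum (f := fun j : ℕ × ℕ => SchwartzMap.seminorm ℂ j.1 j.2 (Ψ x))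
        (fun j _ => apply_nonneg _ _) i.2)
  have hJA : weightedDerivs s A = ∫ x, c x • weightedDerivs s (Ψ x) ∂μ := by
    funext i
    refine DerivSpace.ext fun t => ?_
    have h := ((DerivSpace.eval t).comp
      (ContinuousLinearMap.proj (R := ℂ) (φ := fun i : s => DerivSpace d i.1.2) i)).integral_comp_comm
        hJint
    refine Eq.trans ?_ h
    change DerivSpace.eval t (weightedDeriv i.1.1 i.1.2 A)
      = ∫ x, DerivSpace.eval t (c x • weightedDeriv i.1.1 i.1.2 (Ψ x)) ∂μ
    simp_rw [map_smul, eval_weightedDeriv, hAD, smul_comm (c _), integral_smul]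
  rw [hS, hJA, ← S.integral_comp_comm hJint]
  simp_rw [map_smul, hS, smul_eq_mul]

end SchwartzIntegral

/-! ### The short-time Fourier transform of a function -/

section TimeFrequency

theorem IsTemperedFunction.aestronglyMeasurable {U : Rd d → ℂ} (hU : IsTemperedFunction U) :
    AEStronglyMeasurable U volume := by
  obtain ⟨N, hN⟩ := hU
  have hc : Continuous fun x : Rd d => ((1 + ‖x‖) ^ N : ℝ) := by fun_prop
  have h := hc.aestronglyMeasurable.smul (μ := volume) hN.aestronglyMeasurable
  refine h.congr (Eventually.of_forall fun x => ?_)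
  exact smul_inv_smul₀ (by positivity : (1 + ‖x‖) ^ N ≠ 0) (U x)

theorem norm_le_of_semi (A : 𝓢(Rd d, ℂ)) (N : ℕ) (x : Rd d) :
    (1 + ‖x‖) ^ N * ‖A x‖ ≤ 2 ^ N * semi (N, 0) A := by
  have := one_add_pow_mul_le_semi (k := N) A (le_refl 0) x
  rwa [norm_iteratedFDeriv_zero] at this

/-- Polynomial growth in the shift of the product of a tempered function with a shifted Schwartz
function. -/
theorem norm_mul_shift_le (U : Rd d → ℂ) (G : 𝓢(Rd d, ℂ)) (N : ℕ) (t a : Rd d) :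
    ‖U t * G (t - a)‖
      ≤ (2 ^ N * semi (N, 0) G * (1 + ‖a‖) ^ N) * ‖(((1 + ‖t‖) ^ N)⁻¹ : ℝ) • U t‖ := by
  have h1 := norm_le_of_semi G N (t - a)
  have h2 : 1 + ‖t‖ ≤ (1 + ‖t - a‖) * (1 + ‖a‖) := by
    have : ‖t‖ ≤ ‖t - a‖ + ‖a‖ := by simpa using norm_add_le (t - a) a
    nlinarith [norm_nonneg a, norm_nonneg (t - a)]
  have h3 : 0 < (1 + ‖t‖) ^ N := by positivity
  have h4 : (1 + ‖t‖) ^ N * ‖G (t - a)‖ ≤ 2 ^ N * semi (N, 0) G * (1 + ‖a‖) ^ N := by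
    calc (1 + ‖t‖) ^ N * ‖G (t - a)‖ ≤ ((1 + ‖t - a‖) * (1 + ‖a‖)) ^ N * ‖G (t - a)‖ := by gcongr
      _ = ((1 + ‖t - a‖) ^ N * ‖G (t - a)‖) * (1 + ‖a‖) ^ N := by rw [mul_pow]; ring
      _ ≤ _ := mul_le_mul_of_nonneg_right h1 (by positivity)
  rw [norm_smul, norm_inv, norm_pow, Real.norm_of_nonneg (by positivity : 0 ≤ 1 + ‖t‖), norm_mul]
  calc ‖U t‖ * ‖G (t - a)‖ = ((1 + ‖t‖) ^ N * ‖G (t - a)‖) * (((1 + ‖t‖) ^ N)⁻¹ * ‖U t‖) := by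
        field_simp
    _ ≤ _ := mul_le_mul_of_nonneg_right h4 (by positivity)

theorem IsTemperedFunction.integrable_mul_shift {U : Rd d → ℂ} (hU : IsTemperedFunction U)
    (G : 𝓢(Rd d, ℂ)) (a : Rd d) : Integrable fun t => U t * G (t - a) := by
  have hm := hU.aestronglyMeasurable
  obtain ⟨N, hN⟩ := hU
  refine (hN.norm.const_mul (2 ^ N * semi (N, 0) G * (1 + ‖a‖) ^ N)).mono' ?_
    (Eventually.of_forall fun t => norm_mul_shift_le U G N t a)
  exact hm.mul (G.continuous.comp (continuous_id.sub continuous_const)).aestronglyMeasurable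

theorem IsTemperedFunction.integrable_mul {U : Rd d → ℂ} (hU : IsTemperedFunction U)
    (G : 𝓢(Rd d, ℂ)) : Integrable fun t => U t * G t := by
  simpa using hU.integrable_mul_shift G 0

theorem isTemperedFunction_schwartz (A : 𝓢(Rd d, ℂ)) : IsTemperedFunction (A : Rd d → ℂ) :=
  ⟨0, by simpa using A.integrable⟩

theorem IsTemperedFunction.mul_schwartz {U : Rd d → ℂ} (hU : IsTemperedFunction U)
    (A : 𝓢(Rd d, ℂ)) : IsTemperedFunction fun t => U t * A t :=
  ⟨0, by simpa using hU.integrable_mul A⟩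

theorem IsTemperedFunction.sub {U W : Rd d → ℂ} (hU : IsTemperedFunction U)
    (hW : IsTemperedFunction W) : IsTemperedFunction fun t => U t - W t := by
  have key : ∀ {U : Rd d → ℂ} {N M : ℕ}, N ≤ M → AEStronglyMeasurable U volume →
      Integrable (fun x : Rd d => (((1 + ‖x‖) ^ N)⁻¹ : ℝ) • U x) volume →
      Integrable (fun x : Rd d => (((1 + ‖x‖) ^ M)⁻¹ : ℝ) • U x) volume := by
    intro U N M hNM hm h
    have hc : Continuous fun x : Rd d => (((1 + ‖x‖) ^ M)⁻¹ : ℝ) :=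
      Continuous.inv₀ (by fun_prop) fun x => by positivity
    refine h.mono (hc.aestronglyMeasurable.smul hm) (Eventually.of_forall fun x => ?_)
    rw [norm_smul, norm_smul]
    refine mul_le_mul_of_nonneg_right ?_ (norm_nonneg _)
    rw [Real.norm_of_nonneg (by positivity), Real.norm_of_nonneg (by positivity)]
    exact inv_anti₀ (by positivity) (pow_le_pow_right₀ (by linarith [norm_nonneg x]) hNM)
  have hm1 := hU.aestronglyMeasurable
  have hm2 := hW.aestronglyMeasurable
  obtain ⟨N, hN⟩ := hU
  obtain ⟨M, hM⟩ := hW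
  refine ⟨max N M, ?_⟩
  simp_rw [smul_sub]
  exact (key (le_max_left N M) hm1 hN).sub (key (le_max_right N M) hm2 hM)

/-- The modulus of the short-time Fourier transform, with window `G`, of a function `U`. -/
def tf (G : 𝓢(Rd d, ℂ)) (U : Rd d → ℂ) (z : Rd d × Rd d) : ℝ≥0∞ :=
  ‖𝓕 (fun t : Rd d => U t * G (t - z.2)) z.1‖ₑ

theorem continuous_fourier_mul_shift {U : Rd d → ℂ} (hU : IsTemperedFunction U)
    (G : 𝓢(Rd d, ℂ)) :
    Continuous fun z : Rd d × Rd d => 𝓕 (fun t : Rd d => U t * G (t - z.2)) z.1 := by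
  have hm := hU.aestronglyMeasurable
  have hU' := hU
  obtain ⟨N, hN⟩ := hU
  simp_rw [Real.fourier_eq']
  rw [continuous_iff_continuousAt]
  intro z₀
  have hball : ∀ᶠ z : Rd d × Rd d in 𝓝 z₀, ‖z.2‖ < ‖z₀.2‖ + 1 :=
    (continuous_snd.norm.tendsto z₀).eventually (gt_mem_nhds (by simp))
  refine continuousAt_of_dominated (bound := fun t => (2 ^ N * semi (N, 0) G *
    (1 + (‖z₀.2‖ + 1)) ^ N) * ‖(((1 + ‖t‖) ^ N)⁻¹ : ℝ) • U t‖) ?_ ?_ (hN.norm.const_mul _) ?_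
  · refine Eventually.of_forall fun z => ?_
    have hc : Continuous fun t : Rd d =>
        Complex.exp (((-2 * π * inner ℝ t z.1 : ℝ) : ℂ) * Complex.I) := by fun_prop
    exact hc.aestronglyMeasurable.smul (hU'.integrable_mul_shift G z.2).aestronglyMeasurable
  · filter_upwards [hball] with z hz
    refine Eventually.of_forall fun t => ?_
    rw [norm_smul, Complex.norm_exp_ofReal_mul_I, one_mul]
    refine (norm_mul_shift_le U G N t z.2).trans ?_
    gcongr
  · refine Eventually.of_forall fun t => Continuous.continuousAt ?_
    have := G.continuous
    fun_prop

theorem continuous_tf {U : Rd d → ℂ} (hU : IsTemperedFunction U) (G : 𝓢(Rd d, ℂ)) :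
    Continuous (tf G U) :=
  (continuous_fourier_mul_shift hU G).enorm

theorem tf_ne_top (G : 𝓢(Rd d, ℂ)) (U : Rd d → ℂ) (z : Rd d × Rd d) : tf G U z ≠ ∞ :=
  enorm_ne_top

/-- The a priori growth required by `pmax_rpow_le`, whose constants do not retain it. -/
theorem exists_tf_le_bw {U : Rd d → ℂ} (hU : IsTemperedFunction U) (G : 𝓢(Rd d, ℂ)) :
    ∃ (N : ℝ) (D : ℝ≥0), ∀ z, tf G U z ≤ D * bw z ^ N := by
  obtain ⟨N, hN⟩ := hU
  set I : ℝ := ∫ t, ‖(((1 + ‖t‖) ^ N)⁻¹ : ℝ) • U t‖ with hI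
  refine ⟨N, (2 ^ N * semi (N, 0) G * I).toNNReal, fun z => ?_⟩
  have h1 : ‖𝓕 (fun t : Rd d => U t * G (t - z.2)) z.1‖
      ≤ (2 ^ N * semi (N, 0) G * (1 + ‖z.2‖) ^ N) * I := by
    rw [Real.fourier_eq', hI, ← integral_const_mul]
    refine norm_integral_le_of_norm_le (hN.norm.const_mul _) (Eventually.of_forall fun t => ?_)
    rw [norm_smul, Complex.norm_exp_ofReal_mul_I, one_mul]
    exact norm_mul_shift_le U G N t z.2
  have hI0 : 0 ≤ I := integral_nonneg fun t => norm_nonneg _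
  have h2 : tf G U z ≤ ENNReal.ofReal ((2 ^ N * semi (N, 0) G * I) * (1 + ‖z‖) ^ N) := by
    rw [tf, ← ofReal_norm]
    refine ENNReal.ofReal_le_ofReal (h1.trans ?_)
    rw [mul_right_comm]
    have : ‖z.2‖ ≤ ‖z‖ := norm_snd_le z
    have h0 : 0 ≤ semi (N, 0) G := apply_nonneg _ _
    gcongr
  refine h2.trans (le_of_eq ?_)
  rw [ENNReal.ofReal_mul (mul_nonneg (mul_nonneg (by positivity) (apply_nonneg _ _)) hI0),
    bw_rpow_eq_ofReal, Real.rpow_natCast]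
  rfl

theorem enorm_fourier_comp_sub (f : Rd d → ℂ) (a y : Rd d) :
    ‖𝓕 (fun t => f (t - a)) y‖ₑ = ‖𝓕 f y‖ₑ := by
  have h := congrFun (VectorFourier.fourierIntegral_comp_add_right Real.fourierChar
    (volume : Measure (Rd d)) (innerₗ (Rd d)) f (-a)) y
  have h2 : 𝓕 (fun t => f (t - a)) y = Real.fourierChar (innerₗ (Rd d) (-a) y) • 𝓕 f y := by
    refine Eq.trans ?_ h
    simp only [sub_eq_add_neg]
    rfl
  rw [h2, ← ofReal_norm, ← ofReal_norm, Circle.norm_smul]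

/-- The Fourier transform of a product is bounded by the convolution of the transforms. -/
theorem enorm_fourier_mul_le {a : Rd d → ℂ} (ha : Integrable a) (b : 𝓢(Rd d, ℂ)) (x : Rd d) :
    ‖𝓕 (fun t => a t * b t) x‖ₑ ≤ ∫⁻ v, ‖𝓕 a v‖ₑ * ‖(𝓕 b : 𝓢(Rd d, ℂ)) (x - v)‖ₑ := by
  have hg : Integrable fun v => (𝓕 b : 𝓢(Rd d, ℂ)) (x - v) :=
    (𝓕 b : 𝓢(Rd d, ℂ)).integrable.comp_sub_left x
  -- The multiplication formula `∫ â k = ∫ a k̂` with `k v = b̂ (x - v)`, whose transform is `e^{-2π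
  -- i t·x} b t` by inversion; only integrability of `a` enters.
  have h := VectorFourier.integral_fourierIntegral_smul_eq_flip (L := innerₗ (Rd d))
    Real.continuous_fourierChar continuous_inner ha hg
  have hinv : ∀ t, VectorFourier.fourierIntegral Real.fourierChar volume (innerₗ (Rd d)).flip
      (fun v => (𝓕 b : 𝓢(Rd d, ℂ)) (x - v)) t
      = Complex.exp (((-2 * π * inner ℝ t x : ℝ) : ℂ) * Complex.I) * b t := by
    intro t
    have hb : b t = 𝓕⁻ (𝓕 b : 𝓢(Rd d, ℂ)) t := by rw [FourierTransform.fourierInv_fourier_eq]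
    rw [hb, SchwartzMap.fourierInv_coe, Real.fourierInv_eq']
    rw [VectorFourier.fourierIntegral, ← integral_const_mul,
      ← integral_sub_left_eq_self (fun v => _) volume x]
    refine integral_congr_ae (Eventually.of_forall fun v => ?_)
    simp only [sub_sub_cancel, smul_eq_mul, Circle.smul_def, Real.fourierChar_apply]
    rw [← mul_assoc, ← Complex.exp_add]
    congr 2
    simp only [LinearMap.flip_apply, innerₗ_apply_apply, inner_sub_right, real_inner_comm t v]
    push_cast
    ring
  have h2 : 𝓕 (fun t => a t * b t) x = ∫ v, 𝓕 a v * (𝓕 b : 𝓢(Rd d, ℂ)) (x - v) := by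
    have h3 : ∫ v, 𝓕 a v * (𝓕 b : 𝓢(Rd d, ℂ)) (x - v)
        = ∫ t, a t • VectorFourier.fourierIntegral Real.fourierChar volume (innerₗ (Rd d)).flip
      (fun v => (𝓕 b : 𝓢(Rd d, ℂ)) (x - v)) t := h
    rw [h3, Real.fourier_eq']
    simp_rw [hinv]
    refine integral_congr_ae (Eventually.of_forall fun t => ?_)
    simp only [smul_eq_mul]
    ring_nf
  rw [h2]
  refine (enorm_integral_le_lintegral_enorm _).trans (le_of_eq ?_)
  simp_rw [enorm_mul]

/-- The square of the `L²` norm of a Schwartz function. -/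
def energy (G : 𝓢(Rd d, ℂ)) : ℝ≥0∞ := ‖∫ t, G t * conjS G t‖ₑ

theorem energy_ne_top (G : 𝓢(Rd d, ℂ)) : energy G ≠ ∞ := enorm_ne_top

theorem integral_mul_conjS (G : 𝓢(Rd d, ℂ)) :
    ∫ t, G t * conjS G t = ((∫ t, ‖G t‖ ^ 2 : ℝ) : ℂ) := by
  rw [← integral_complex_ofReal]
  refine integral_congr_ae (Eventually.of_forall fun t => ?_)
  simp [Complex.mul_conj, Complex.normSq_eq_norm_sq]

theorem integrable_norm_sq (G : 𝓢(Rd d, ℂ)) : Integrable fun t => ‖G t‖ ^ 2 := by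
  have h := ((isTemperedFunction_schwartz G).integrable_mul (conjS G)).norm
  refine h.congr (Eventually.of_forall fun t => ?_)
  simp [pow_two]

theorem integral_norm_sq_pos {G : 𝓢(Rd d, ℂ)} (hG : G ≠ 0) : 0 < ∫ t, ‖G t‖ ^ 2 := by
  have hc : Continuous fun t => ‖G t‖ ^ 2 := G.continuous.norm.pow 2
  obtain ⟨t, ht⟩ : ∃ t, G t ≠ 0 := by
    by_contra! h
    exact hG (SchwartzMap.ext h)
  exact integral_pos_of_integrable_nonneg_nonzero hc (integrable_norm_sq G)
    (fun t => by positivity) (x := t) (by simpa using ht)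

theorem energy_ne_zero {G : 𝓢(Rd d, ℂ)} (hG : G ≠ 0) : energy G ≠ 0 := by
  rw [energy, integral_mul_conjS, enorm_ne_zero]
  exact_mod_cast (integral_norm_sq_pos hG).ne'

/-- Change of window: the Fourier transform of `U ψ` is controlled by the short-time Fourier
transform of `U` with an arbitrary window. -/
theorem energy_mul_fourier_le {U : Rd d → ℂ} (hU : IsTemperedFunction U) (G ψ : 𝓢(Rd d, ℂ))
    (x : Rd d) :
    energy G * ‖𝓕 (fun t => U t * ψ t) x‖ₑ
      ≤ ∫⁻ η, ∫⁻ v, tf G U (v, η) * ‖(𝓕 (shiftMul ψ (conjS G) η) : 𝓢(Rd d, ℂ)) (x - v)‖ₑ := by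
  set e : Rd d → ℂ := fun t => Complex.exp (((-2 * π * inner ℝ t x : ℝ) : ℂ) * Complex.I) with he
  set f : Rd d → ℂ := fun t => e t * (U t * ψ t) with hf
  set g : Rd d → ℂ := fun u => G (-u) * conjS G (-u) with hg
  have hfi : Integrable f := by
    refine (hU.integrable_mul ψ).bdd_mul (c := 1) ?_ ?_
    · exact Continuous.aestronglyMeasurable (by fun_prop)
    · exact Eventually.of_forall fun t => (Complex.norm_exp_ofReal_mul_I _).le
  have hgi : Integrable g :=
    ((isTemperedFunction_schwartz G).integrable_mul (conjS G)).comp_neg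
  -- The integral of `f * g` is the product of the integrals, here the transform of `U ψ` at `x`
  -- times `∫ |G|²`. On the other hand `(f * g) η` is the transform at `x` of the product of `U ·
  -- T_η G` and `ψ · T_η Ḡ`.
  have hconv := integral_convolution (μ := volume) (ν := volume) (ContinuousLinearMap.mul ℂ ℂ)
    hfi hgi
  have hg0 : ∫ u, g u = ∫ t, G t * conjS G t :=
    integral_neg_eq_self (fun t => G t * conjS G t) volume
  have hf0 : ∫ t, f t = 𝓕 (fun t => U t * ψ t) x := by
    rw [Real.fourier_eq']; rfl
  have hη : ∀ η, (MeasureTheory.convolution f g (ContinuousLinearMap.mul ℂ ℂ) volume) η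
      = 𝓕 (fun t => (U t * G (t - η)) * shiftMul ψ (conjS G) η t) x := by
    intro η
    rw [Real.fourier_eq', MeasureTheory.convolution]
    refine integral_congr_ae (Eventually.of_forall fun t => ?_)
    simp only [hf, hg, he, ContinuousLinearMap.mul_apply', shiftMul_apply, smul_eq_mul, neg_sub]
    ring
  rw [hf0, hg0, ContinuousLinearMap.mul_apply'] at hconv
  rw [energy, mul_comm, ← enorm_mul, ← hconv]
  refine (enorm_integral_le_lintegral_enorm _).trans (lintegral_mono fun η => ?_)
  rw [hη]
  exact enorm_fourier_mul_le (hU.integrable_mul_shift G η) (shiftMul ψ (conjS G) η) x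

theorem fourier_coe_shiftMul_translate (A G : 𝓢(Rd d, ℂ)) (ξ η y : Rd d) :
    ‖(𝓕 (shiftMul (A.compSubConstCLM ℂ ξ) G η) : 𝓢(Rd d, ℂ)) y‖ₑ
      = ‖(𝓕 (shiftMul A G (η - ξ)) : 𝓢(Rd d, ℂ)) y‖ₑ := by
  have h : ⇑(shiftMul (A.compSubConstCLM ℂ ξ) G η)
      = fun t => shiftMul A G (η - ξ) (t - ξ) := by
    funext t; simp
  rw [SchwartzMap.fourier_coe, SchwartzMap.fourier_coe, h, enorm_fourier_comp_sub]

/-- Reproducing inequality for the short-time Fourier transform. -/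
theorem exists_tf_le_lintegral {G : 𝓢(Rd d, ℂ)} (hG : G ≠ 0) (m : ℝ) (hm : 0 ≤ m) :
    ∃ K : ℝ≥0, ∀ U : Rd d → ℂ, IsTemperedFunction U → ∀ z,
      tf G U z ≤ K * ∫⁻ w, tf G U w * bw (z - w) ^ (-m) := by
  obtain ⟨C, M, hC⟩ := exists_fourier_shiftMul_le (conjS G) m
  set c := (energy G).toNNReal with hc
  have hc' : (c : ℝ≥0∞) = energy G := ENNReal.coe_toNNReal (energy_ne_top G)
  have hc0 : c ≠ 0 := fun h => energy_ne_zero hG (by rw [← hc', h]; rfl)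
  refine ⟨c⁻¹ * (C * (semi M G).toNNReal), fun U hU z => ?_⟩
  -- Change of window with `ψ = T_ξ G`: up to modulus the kernel depends only on the difference of
  -- phase-space points, and it decays to every order.
  have h1 := energy_mul_fourier_le hU G (G.compSubConstCLM ℂ z.2) z.1
  have h2 : energy G * tf G U z
      ≤ ∫⁻ η, ∫⁻ v, (C * (semi M G).toNNReal : ℝ≥0) * (tf G U (v, η) * bw (z - (v, η)) ^ (-m)) := by
    refine le_trans (le_of_eq ?_) (h1.trans ?_)
    · simp [tf]
    · refine lintegral_mono fun η => lintegral_mono fun v => ?_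
      rw [fourier_coe_shiftMul_translate]
      refine (mul_le_mul' le_rfl (hC G (z.1 - v) (η - z.2))).trans ?_
      calc _ = (C * ENNReal.ofReal (semi M G)) * (tf G U (v, η) *
              (bw (z.1 - v) ^ (-m) * bw (z.2 - η) ^ (-m))) := by
            rw [bw_sub_comm η]; ring
        _ ≤ (C * ENNReal.ofReal (semi M G)) * (tf G U (v, η) * bw (z - (v, η)) ^ (-m)) :=
            mul_le_mul' le_rfl (mul_le_mul' le_rfl (mul_bw_rpow_neg_le_prod _ _ hm))
        _ = _ := by rw [ENNReal.ofReal]; push_cast; rfl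
  have hmeas : Measurable fun w : Rd d × Rd d => tf G U w * bw (z - w) ^ (-m) :=
    (continuous_tf hU G).measurable.mul
      ((continuous_bw_rpow (-m)).comp (continuous_const.sub continuous_id)).measurable
  have h3 : ∫⁻ η, ∫⁻ v, (C * (semi M G).toNNReal : ℝ≥0) *
      (tf G U (v, η) * bw (z - (v, η)) ^ (-m))
      = (C * (semi M G).toNNReal : ℝ≥0) * ∫⁻ w, tf G U w * bw (z - w) ^ (-m) := by
    rw [← lintegral_const_mul _ hmeas, Measure.volume_eq_prod,
      lintegral_prod_symm _ (hmeas.const_mul _).aemeasurable]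
  rw [h3, ← hc'] at h2
  rw [ENNReal.coe_mul, ENNReal.coe_inv hc0, mul_assoc,
    ← ENNReal.mul_le_iff_le_inv (by simpa using hc0) ENNReal.coe_ne_top]
  exact h2

/-- The short-time Fourier transform of a tempered function and its Peetre maximal function have
equivalent mixed norms, uniformly in the function. -/
theorem exists_mixN_pmax_tf_le {G : 𝓢(Rd d, ℂ)} (hG : G ≠ 0) {p q : ℝ≥0∞} (hp : p ≠ 0)
    (hq : q ≠ 0) (s : ℝ) :
    ∃ m₀ : ℝ, 0 ≤ m₀ ∧ ∀ m, m₀ ≤ m → ∃ C : ℝ≥0, ∀ U : Rd d → ℂ, IsTemperedFunction U →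
      mixN p q s (pmax m (tf G U)) ≤ C * mixN p q s (tf G U) := by
  obtain ⟨m₀, hm₀, h⟩ := exists_mixN_pmax_le (d := d) hp hq s
  have hK : ∀ m : ℝ, ∃ K : ℝ≥0, 0 ≤ m → ∀ U : Rd d → ℂ, IsTemperedFunction U → ∀ z,
      tf G U z ≤ K * ∫⁻ w, tf G U w * bw (z - w) ^ (-m) := fun m => by
    rcases le_or_gt 0 m with hm | hm
    · obtain ⟨K, hK⟩ := exists_tf_le_lintegral hG m hm
      exact ⟨K, fun _ => hK⟩
    · exact ⟨0, fun h => absurd h hm.not_ge⟩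
  choose K hK using hK
  refine ⟨m₀, hm₀, fun m hm => ?_⟩
  obtain ⟨C, hC⟩ := h m hm (K m)
  refine ⟨C, fun U hU => hC _ (continuous_tf hU G).lowerSemicontinuous fun z => ?_⟩
  obtain ⟨N, D, hD⟩ := exists_tf_le_bw hU G
  exact pmax_rpow_le (minExp_pos hp hq) (minExp_le_one p q) (hm₀.trans hm)
    (fun m hm z => hK m hm U hU z) (ENNReal.coe_ne_top (r := D)) hD z

end TimeFrequency

/-! ### Multiplication by a symbol, on the Fourier side -/

section Multiplication

theorem le_inv_mul_of_mul_le {c a b : ℝ≥0∞} (h0 : c ≠ 0) (htop : c ≠ ∞) (h : c * a ≤ b) :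
    a ≤ c⁻¹ * b := by
  rwa [← ENNReal.mul_le_iff_le_inv h0 htop]

theorem tf_mul_eq (G : 𝓢(Rd d, ℂ)) (U : Rd d → ℂ) (Φ : 𝓢(Rd d, ℂ)) (z : Rd d × Rd d) :
    tf G (fun t => U t * Φ t) z = ‖𝓕 (fun t => U t * shiftMul Φ G z.2 t) z.1‖ₑ := by
  simp [tf, mul_assoc]

/-- The Fourier transform of `Φ · T_ξ G · T_η w̄`, in terms of the short-time Fourier transform
of `Φ` with window `G`. -/
theorem exists_fourier_shiftMul_shiftMul_le_pmax {G : 𝓢(Rd d, ℂ)} (hG : G ≠ 0) (w : 𝓢(Rd d, ℂ))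
    {m a : ℝ} (hm : 0 ≤ m) (ha : (d : ℝ) < a) :
    ∃ C : ℝ≥0, ∀ (Φ : 𝓢(Rd d, ℂ)) (y ξ η : Rd d),
      ‖(𝓕 (shiftMul (shiftMul Φ G ξ) (conjS w) η) : 𝓢(Rd d, ℂ)) y‖ₑ
        ≤ C * (pmax m (tf G Φ) (y, ξ) * bw (η - ξ) ^ (-(m + a))) := by
  -- The change of window for `Φ`, with `ψ = T_ξ G · T_η w̄`, has as kernel the transform of a
  -- triple product. Of its decay, `m` compensates the maximal function and the excess `a > d` makes
  -- the integrals in `v` and `η'` converge.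
  obtain ⟨C, hC⟩ := exists_fourier_shiftMul_shiftMul_le G (conjS w) (conjS G) (m + a)
  set j : ℝ≥0∞ := ∫⁻ v : Rd d, bw v ^ (-a) with hj
  have hjtop : j ≠ ∞ := (lintegral_bw_rpow_neg_lt_top volume (by simpa using ha)).ne
  have hmeas : Measurable fun v : Rd d => bw v ^ (-a) := (continuous_bw_rpow _).measurable
  have hctop : (energy G)⁻¹ * (C * (j * j)) ≠ ∞ :=
    ENNReal.mul_ne_top (ENNReal.inv_ne_top.2 (energy_ne_zero hG))
      (ENNReal.mul_ne_top ENNReal.coe_ne_top (ENNReal.mul_ne_top hjtop hjtop))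
  refine ⟨((energy G)⁻¹ * (C * (j * j))).toNNReal, fun Φ y ξ η => ?_⟩
  rw [ENNReal.coe_toNNReal hctop, mul_assoc]
  refine le_inv_mul_of_mul_le (energy_ne_zero hG) (energy_ne_top G) ?_
  set ψ := shiftMul (G.compSubConstCLM ℂ ξ) (conjS w) η with hψ
  set P := pmax m (tf G Φ) (y, ξ) with hP
  have hfun : ⇑(shiftMul (shiftMul Φ G ξ) (conjS w) η) = fun t => Φ t * ψ t := by
    funext t; simp [hψ, mul_assoc]
  have h1 := energy_mul_fourier_le (isTemperedFunction_schwartz Φ) G ψ y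
  rw [SchwartzMap.fourier_coe, hfun]
  refine h1.trans ?_
  have h2 : ∀ η' v, tf G Φ (v, η') * ‖(𝓕 (shiftMul ψ (conjS G) η') : 𝓢(Rd d, ℂ)) (y - v)‖ₑ
      ≤ (C * P * bw (η - ξ) ^ (-(m + a)) * bw (η' - ξ) ^ (-a)) * bw (v - y) ^ (-a) := by
    intro η' v
    have e : ‖(𝓕 (shiftMul ψ (conjS G) η') : 𝓢(Rd d, ℂ)) (y - v)‖ₑ
        = ‖(𝓕 (shiftMul (shiftMul G (conjS w) (η - ξ)) (conjS G) (η' - ξ)) : 𝓢(Rd d, ℂ))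
            (y - v)‖ₑ := by
      rw [← fourier_coe_shiftMul_translate, hψ]
      congr 4
      ext t
      simp
    rw [e]
    have h3 : tf G Φ (v, η') ≤ P * (bw (v - y) ^ m * bw (η' - ξ) ^ m) :=
      (le_pmax_mul hm (tf G Φ) (v, η') (y, ξ)).trans
        (mul_le_mul' le_rfl (bw_prod_rpow_le (v - y) (η' - ξ) hm))
    refine (mul_le_mul' h3 (hC (y - v) (η - ξ) (η' - ξ))).trans (le_of_eq ?_)
    have e1 : ∀ x : Rd d, bw x ^ m * bw x ^ (-(m + a)) = bw x ^ (-a) := fun x => by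
      rw [← bw_rpow_add]; congr 1; ring
    rw [bw_sub_comm y v]
    calc _ = C * P * bw (η - ξ) ^ (-(m + a)) * (bw (η' - ξ) ^ m * bw (η' - ξ) ^ (-(m + a))) *
          (bw (v - y) ^ m * bw (v - y) ^ (-(m + a))) := by ring
      _ = _ := by rw [e1, e1]
  refine (lintegral_mono fun η' => lintegral_mono fun v => h2 η' v).trans (le_of_eq ?_)
  have h4 : ∀ x : Rd d, ∫⁻ v, bw (v - x) ^ (-a) = j := fun x =>
    lintegral_sub_right_eq_self (fun v : Rd d => bw v ^ (-a)) x
  have hms : ∀ x : Rd d, Measurable fun v : Rd d => bw (v - x) ^ (-a) := fun x =>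
    hmeas.comp (measurable_id.sub_const x)
  simp_rw [lintegral_const_mul _ (hms y), h4]
  rw [lintegral_mul_const _ ((hms ξ).const_mul _), lintegral_const_mul _ (hms ξ), h4]
  ring

/-- The pointwise estimate behind the multiplier theorem: the short-time Fourier transform of
`σ Φ` is dominated by a convolution in the first variable. -/
theorem exists_tf_mul_le {G w : 𝓢(Rd d, ℂ)} (hG : G ≠ 0) (hw : w ≠ 0) {m : ℝ} (hm : 0 ≤ m) :
    ∃ C : ℝ≥0, ∀ σ : Rd d → ℂ, IsTemperedFunction σ → ∀ (Φ : 𝓢(Rd d, ℂ)) (x ξ : Rd d),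
      tf G (fun t => σ t * Φ t) (x, ξ)
        ≤ C * ∫⁻ v, pmax m (tf G Φ) (x - v, ξ) * pmax m (tf w σ) (v, ξ) := by
  have ha : (d : ℝ) < d + 1 := by linarith
  obtain ⟨C, hC⟩ := exists_fourier_shiftMul_shiftMul_le_pmax hG w hm ha
  set a : ℝ := d + 1 with ha'
  set j : ℝ≥0∞ := ∫⁻ v : Rd d, bw v ^ (-a) with hj
  have hjtop : j ≠ ∞ := (lintegral_bw_rpow_neg_lt_top volume (by simpa using ha)).ne
  have hctop : (energy w)⁻¹ * (C * j) ≠ ∞ :=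
    ENNReal.mul_ne_top (ENNReal.inv_ne_top.2 (energy_ne_zero hw))
      (ENNReal.mul_ne_top ENNReal.coe_ne_top hjtop)
  refine ⟨((energy w)⁻¹ * (C * j)).toNNReal, fun σ hσ Φ x ξ => ?_⟩
  rw [ENNReal.coe_toNNReal hctop, mul_assoc]
  refine le_inv_mul_of_mul_le (energy_ne_zero hw) (energy_ne_top w) ?_
  rw [tf_mul_eq G]
  -- Here the test function is `Φ · T_ξ G` and the window is that of the symbol. Moving `tf w σ`
  -- from position `η` to `ξ` costs `bw (η - ξ) ^ m`, which the decay of order `m + a` absorbs,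
  -- leaving an integrable factor in `η`.
  refine (energy_mul_fourier_le hσ w (shiftMul Φ G ξ) x).trans ?_
  have hVm : Measurable fun v : Rd d => pmax m (tf G Φ) (x - v, ξ) * pmax m (tf w σ) (v, ξ) :=
    (((lowerSemicontinuous_pmax m (tf_ne_top G Φ)).measurable).comp (by fun_prop)).mul
      (((lowerSemicontinuous_pmax m (tf_ne_top w σ)).measurable).comp (by fun_prop))
  set I := ∫⁻ v, pmax m (tf G Φ) (x - v, ξ) * pmax m (tf w σ) (v, ξ) with hI
  have h1 : ∀ η v, tf w σ (v, η) *
      ‖(𝓕 (shiftMul (shiftMul Φ G ξ) (conjS w) η) : 𝓢(Rd d, ℂ)) (x - v)‖ₑ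
      ≤ (C * bw (η - ξ) ^ (-a)) *
        (pmax m (tf G Φ) (x - v, ξ) * pmax m (tf w σ) (v, ξ)) := by
    intro η v
    have h3 : tf w σ (v, η) ≤ pmax m (tf w σ) (v, ξ) * bw (η - ξ) ^ m := by
      have := le_pmax_mul hm (tf w σ) (v, η) (v, ξ)
      have e : bw ((v, η) - (v, ξ)) = bw (η - ξ) := by simp [bw_eq_ofReal, Prod.norm_def]
      rwa [e] at this
    refine (mul_le_mul' h3 (hC Φ (x - v) ξ η)).trans (le_of_eq ?_)
    have e1 : bw (η - ξ) ^ m * bw (η - ξ) ^ (-(m + a)) = bw (η - ξ) ^ (-a) := by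
      rw [← bw_rpow_add]; congr 1; ring
    rw [← e1]
    ring
  refine (lintegral_mono fun η => lintegral_mono fun v => h1 η v).trans (le_of_eq ?_)
  have h4 : ∫⁻ η, bw (η - ξ) ^ (-a) = j :=
    lintegral_sub_right_eq_self (fun v : Rd d => bw v ^ (-a)) ξ
  have hms : Measurable fun v : Rd d => bw (v - ξ) ^ (-a) :=
    (continuous_bw_rpow _).measurable.comp (measurable_id.sub_const ξ)
  simp_rw [lintegral_const_mul _ hVm]
  rw [lintegral_mul_const _ (hms.const_mul _), lintegral_const_mul _ hms, h4]

/-- Young's inequality for slowly varying functions in each slice, with exponent `min 1 p` on the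
symbol. The weighted slice norm of the symbol is bounded uniformly in `ξ`, because its maximal
function has finite mixed norm with outer exponent `∞`. -/
theorem exists_mixN_tf_mul_le {G w : 𝓢(Rd d, ℂ)} (hG : G ≠ 0) (hw : w ≠ 0) {p q : ℝ≥0∞}
    (hp : p ≠ 0) (hq : q ≠ 0) (s γ : ℝ) :
    ∃ C : ℝ≥0, ∀ σ : Rd d → ℂ, IsTemperedFunction σ → mixN (min 1 p) ∞ γ (tf w σ) ≠ ∞ →
      ∀ Φ : 𝓢(Rd d, ℂ),
      mixN p q (s + γ) (tf G fun t => σ t * Φ t)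
        ≤ C * mixN (min 1 p) ∞ γ (tf w σ) * mixN p q s (tf G Φ) := by
  have hp1 : min 1 p ≠ 0 := by simp [hp]
  obtain ⟨m₁, hm₁, h₁⟩ := exists_mixN_pmax_tf_le hG hp hq s
  obtain ⟨m₂, hm₂, h₂⟩ := exists_mixN_pmax_tf_le hw hp1 ENNReal.top_ne_zero γ
  set m := max m₁ m₂ with hmdef
  have hm : 0 ≤ m := hm₁.trans (le_max_left _ _)
  obtain ⟨C₁, hC₁⟩ := h₁ m (le_max_left _ _)
  obtain ⟨C₂, hC₂⟩ := h₂ m (le_max_right _ _)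
  obtain ⟨C₃, hC₃⟩ := exists_tf_mul_le hG hw hm
  obtain ⟨C₄, hC₄⟩ := exists_eLpNorm_conv_le (d := d) hm hp
  obtain ⟨C₅, hC₅⟩ := exists_weight_mul_eLpNorm_le_mixN (d := d) hm (min 1 p)
    ENNReal.top_ne_zero γ
  refine ⟨C₃ * C₄ * C₅ * C₂ * C₁, fun σ hσ hfin Φ => ?_⟩
  set V := pmax m (tf G Φ) with hV
  set S := pmax m (tf w σ) with hS
  have hVs : SlowlyVarying m V := slowlyVarying_pmax hm _
  have hSs : SlowlyVarying m S := slowlyVarying_pmax hm _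
  have hVm : Measurable V := (lowerSemicontinuous_pmax m (tf_ne_top G Φ)).measurable
  have hSm : Measurable S := (lowerSemicontinuous_pmax m (tf_ne_top w σ)).measurable
  set B := mixN (min 1 p) ∞ γ (tf w σ) with hB
  have hSB : ∀ ξ, weight γ ξ * eLpNorm (fun x : Rd d => S (x, ξ)) (min 1 p) volume
      ≤ C₅ * C₂ * B := fun ξ => by
    refine (hC₅ S hSs ξ).trans ?_
    rw [mul_assoc]
    exact mul_le_mul' le_rfl (hC₂ σ hσ)
  have hcB : C₃ * C₄ * (C₅ * C₂ * B) ≠ ∞ := by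
    refine ENNReal.mul_ne_top (ENNReal.mul_ne_top ENNReal.coe_ne_top ENNReal.coe_ne_top) ?_
    exact ENNReal.mul_ne_top (ENNReal.mul_ne_top ENNReal.coe_ne_top ENNReal.coe_ne_top) hfin
  have h1 : ∀ ξ, weight (s + γ) ξ *
      eLpNorm (fun x : Rd d => tf G (fun t => σ t * Φ t) (x, ξ)) p volume
      ≤ (C₃ * C₄ * (C₅ * C₂ * B)) * (weight s ξ * eLpNorm (fun x : Rd d => V (x, ξ)) p volume) := by
    intro ξ
    have h2 : eLpNorm (fun x : Rd d => tf G (fun t => σ t * Φ t) (x, ξ)) p volume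
        ≤ C₃ * (C₄ * (eLpNorm (fun x : Rd d => V (x, ξ)) p volume *
          eLpNorm (fun x : Rd d => S (x, ξ)) (min 1 p) volume)) := by
      calc _ ≤ eLpNorm (fun x : Rd d => C₃ * ∫⁻ v, V (x - v, ξ) * S (v, ξ)) p volume :=
            eLpNorm_mono_ennreal fun x => hC₃ σ hσ Φ x ξ
        _ = C₃ * eLpNorm (fun x : Rd d => ∫⁻ v, V (x - v, ξ) * S (v, ξ)) p volume :=
            eLpNorm_ennreal_const_mul ENNReal.coe_ne_top _ _
        _ ≤ _ := mul_le_mul' le_rfl (hC₄ (fun x => V (x, ξ)) (fun x => S (x, ξ))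
            (hVs.slice_fst ξ) (hSs.slice_fst ξ) (hVm.comp (by fun_prop)) (hSm.comp (by fun_prop)))
    calc _ ≤ weight s ξ * weight γ ξ * (C₃ * (C₄ * (eLpNorm (fun x : Rd d => V (x, ξ)) p volume *
          eLpNorm (fun x : Rd d => S (x, ξ)) (min 1 p) volume))) := by
          rw [weight_add]; exact mul_le_mul' le_rfl h2
      _ = (C₃ * C₄ * (weight γ ξ * eLpNorm (fun x : Rd d => S (x, ξ)) (min 1 p) volume)) *
          (weight s ξ * eLpNorm (fun x : Rd d => V (x, ξ)) p volume) := by ring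
      _ ≤ _ := mul_le_mul' (mul_le_mul' le_rfl (hSB ξ)) le_rfl
  calc mixN p q (s + γ) (tf G fun t => σ t * Φ t)
      ≤ (C₃ * C₄ * (C₅ * C₂ * B)) * mixN p q s V := by
        rw [mixN, mixN, ← eLpNorm_ennreal_const_mul hcB]
        exact eLpNorm_mono_ennreal h1
    _ ≤ (C₃ * C₄ * (C₅ * C₂ * B)) * (C₁ * mixN p q s (tf G Φ)) :=
        mul_le_mul' le_rfl (hC₁ Φ (isTemperedFunction_schwartz Φ))
    _ = _ := by push_cast; ring

end Multiplication

/-! ### Schwartz functions in mixed norm spaces, and embeddings -/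

section Embedding

theorem exists_eLpNorm_bw_rpow_lt_top {p : ℝ≥0∞} (hp : p ≠ 0) :
    ∃ m : ℝ, 0 ≤ m ∧ eLpNorm (fun x : Rd d => bw x ^ (-m)) p volume < ∞ := by
  rcases eq_or_ne p ∞ with rfl | htop
  · refine ⟨0, le_rfl, ?_⟩
    simp only [neg_zero, ENNReal.rpow_zero]
    rw [eLpNorm_ennreal_top]
    exact (essSup_le_of_ae_le 1 (Eventually.of_forall fun _ => le_rfl)).trans_lt
      ENNReal.one_lt_top
  · have hpr : 0 < p.toReal := ENNReal.toReal_pos hp htop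
    refine ⟨(d + 1) / p.toReal, by positivity, ?_⟩
    rw [eLpNorm_ennreal_eq_lintegral hp htop]
    refine ENNReal.rpow_lt_top_of_nonneg (by positivity) ?_
    simp_rw [← ENNReal.rpow_mul]
    rw [neg_mul, div_mul_cancel₀ _ hpr.ne']
    exact (lintegral_bw_rpow_neg_lt_top volume (by simp)).ne

theorem weight_le_bw (s : ℝ) (x : Rd d) : weight s x ≤ bw x ^ |s| := by
  simpa [weight, bw_zero] using weight_le_mul s x 0

theorem one_le_weight_mul_bw (s : ℝ) (x : Rd d) : 1 ≤ weight s x * bw x ^ |s| := by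
  simpa [weight, zero_sub, bw_neg] using weight_le_mul s 0 x

theorem mixN_tf_schwartz_lt_top (G Φ : 𝓢(Rd d, ℂ)) {p q : ℝ≥0∞} (hp : p ≠ 0) (hq : q ≠ 0)
    (s : ℝ) : mixN p q s (tf G Φ) < ∞ := by
  obtain ⟨a, ha, hap⟩ := exists_eLpNorm_bw_rpow_lt_top (d := d) hp
  obtain ⟨b, hb, hbq⟩ := exists_eLpNorm_bw_rpow_lt_top (d := d) hq
  set m := max a (b + |s|) with hm
  obtain ⟨C, M, hC⟩ := exists_fourier_shiftMul_le G m
  set c : ℝ≥0∞ := C * ENNReal.ofReal (semi M Φ) with hc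
  have hctop : c ≠ ∞ := ENNReal.mul_ne_top ENNReal.coe_ne_top ENNReal.ofReal_ne_top
  have h1 : ∀ z, tf G Φ z ≤ c * (bw z.1 ^ (-a) * bw z.2 ^ (-(b + |s|))) := fun z => by
    have h := hC Φ z.1 z.2
    rw [SchwartzMap.fourier_coe] at h
    have e : ⇑(shiftMul Φ G z.2) = fun t => Φ t * G (t - z.2) := by funext t; simp
    rw [e] at h
    refine h.trans (mul_le_mul' le_rfl (mul_le_mul' (bw_rpow_mono _ ?_) (bw_rpow_mono _ ?_)))
    · exact neg_le_neg (le_max_left _ _)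
    · exact neg_le_neg (le_max_right _ _)
  refine (mixN_mono h1).trans_lt ?_
  rw [mixN_const_mul hctop]
  refine ENNReal.mul_lt_top hctop.lt_top ?_
  set L := eLpNorm (fun x : Rd d => bw x ^ (-a)) p volume with hL
  have h2 : ∀ ξ : Rd d, weight s ξ *
      eLpNorm (fun x : Rd d => bw x ^ (-a) * bw ξ ^ (-(b + |s|))) p volume
      ≤ L * bw ξ ^ (-b) := by
    intro ξ
    have e : (fun x : Rd d => bw x ^ (-a) * bw ξ ^ (-(b + |s|)))
        = fun x : Rd d => bw ξ ^ (-(b + |s|)) * bw x ^ (-a) := funext fun x => mul_comm _ _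
    rw [e, eLpNorm_ennreal_const_mul (bw_rpow_ne_top _ _)]
    calc _ ≤ bw ξ ^ |s| * (bw ξ ^ (-(b + |s|)) * L) := mul_le_mul' (weight_le_bw s ξ) le_rfl
      _ = L * (bw ξ ^ |s| * bw ξ ^ (-(b + |s|))) := by ring
      _ = _ := by
        rw [← bw_rpow_add]; congr 2; ring
  refine (eLpNorm_mono_ennreal h2).trans_lt ?_
  rw [eLpNorm_ennreal_const_mul hap.ne]
  exact ENNReal.mul_lt_top hap hbq

/-- Pairing with a Schwartz function is continuous for the modulation quasi-norm. -/
theorem exists_enorm_integral_mul_le {G : 𝓢(Rd d, ℂ)} (hG : G ≠ 0) {p q : ℝ≥0∞} (hp : p ≠ 0)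
    (hq : q ≠ 0) (s : ℝ) :
    ∃ (C : ℝ≥0) (M : ℕ × ℕ), ∀ U : Rd d → ℂ, IsTemperedFunction U → ∀ ψ : 𝓢(Rd d, ℂ),
      ‖∫ t, ψ t * U t‖ₑ ≤ C * ENNReal.ofReal (semi M ψ) * mixN p q s (tf G U) := by
  obtain ⟨m, hm, h₁⟩ := exists_mixN_pmax_tf_le hG hp hq s
  obtain ⟨C₁, hC₁⟩ := h₁ m le_rfl
  obtain ⟨C₂, hC₂⟩ := exists_weight_mul_le_mixN (d := d) hm hp hq s
  set a : ℝ := d + 1 with ha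
  obtain ⟨C₃, M, hC₃⟩ := exists_fourier_shiftMul_le (conjS G) (a + |s|)
  set j : ℝ≥0∞ := ∫⁻ v : Rd d, bw v ^ (-a) with hj
  have hjtop : j ≠ ∞ := (lintegral_bw_rpow_neg_lt_top volume (by simp [ha])).ne
  have hmeas : Measurable fun v : Rd d => bw v ^ (-a) := (continuous_bw_rpow _).measurable
  have hctop : (energy G)⁻¹ * (C₃ * C₂ * C₁ * (j * j)) ≠ ∞ :=
    ENNReal.mul_ne_top (ENNReal.inv_ne_top.2 (energy_ne_zero hG))
      (ENNReal.mul_ne_top (ENNReal.mul_ne_top (ENNReal.mul_ne_top ENNReal.coe_ne_top ENNReal.coe_ne_top)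
        ENNReal.coe_ne_top) (ENNReal.mul_ne_top hjtop hjtop))
  refine ⟨((energy G)⁻¹ * (C₃ * C₂ * C₁ * (j * j))).toNNReal, M, fun U hU ψ => ?_⟩
  rw [ENNReal.coe_toNNReal hctop, mul_assoc, mul_assoc]
  refine le_inv_mul_of_mul_le (energy_ne_zero hG) (energy_ne_top G) ?_
  -- The pairing is a value of the transform of `U ψ`, so the change-of-window estimate applies to
  -- it.
  have h0 : ∫ t, ψ t * U t = 𝓕 (fun t => U t * ψ t) 0 := by
    rw [Real.fourier_eq']
    refine integral_congr_ae (Eventually.of_forall fun t => ?_)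
    simp [mul_comm]
  rw [h0]
  refine (energy_mul_fourier_le hU G ψ 0).trans ?_
  set X := mixN p q s (tf G U) with hX
  set S := ENNReal.ofReal (semi M ψ) with hS
  have h1 : ∀ η v, tf G U (v, η) * ‖(𝓕 (shiftMul ψ (conjS G) η) : 𝓢(Rd d, ℂ)) (0 - v)‖ₑ
      ≤ (C₃ * C₂ * C₁ * S * X) * bw η ^ (-a) * bw v ^ (-a) := by
    intro η v
    have h2 : tf G U (v, η) ≤ C₂ * C₁ * X * bw η ^ |s| := by
      calc tf G U (v, η) ≤ pmax m (tf G U) (v, η) := le_pmax _ _ _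
        _ ≤ (weight s η * bw η ^ |s|) * pmax m (tf G U) (v, η) :=
            le_mul_of_one_le_left (zero_le) (one_le_weight_mul_bw s η)
        _ = (weight s η * pmax m (tf G U) (v, η)) * bw η ^ |s| := by ring
        _ ≤ (C₂ * (C₁ * X)) * bw η ^ |s| :=
            mul_le_mul' ((hC₂ _ (slowlyVarying_pmax hm _) (v, η)).trans
              (mul_le_mul' le_rfl (hC₁ U hU))) le_rfl
        _ = _ := by ring
    refine (mul_le_mul' h2 (hC₃ ψ (0 - v) η)).trans ?_
    rw [zero_sub, bw_neg]
    have e1 : bw η ^ |s| * bw η ^ (-(a + |s|)) = bw η ^ (-a) := by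
      rw [← bw_rpow_add]; congr 1; ring
    have e2 : bw v ^ (-(a + |s|)) ≤ bw v ^ (-a) := bw_rpow_mono _ (by linarith [abs_nonneg s])
    calc _ = (C₃ * C₂ * C₁ * S * X) * (bw η ^ |s| * bw η ^ (-(a + |s|))) *
          bw v ^ (-(a + |s|)) := by ring
      _ ≤ _ := by rw [e1]; exact mul_le_mul' le_rfl e2
  refine (lintegral_mono fun η => lintegral_mono fun v => h1 η v).trans (le_of_eq ?_)
  simp_rw [lintegral_const_mul _ hmeas]
  rw [lintegral_mul_const _ (hmeas.const_mul _), lintegral_const_mul _ hmeas, ← hj]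
  ring

/-- For `p ≤ 1`, the modulation quasi-norm controls weighted pointwise values on the Fourier
side. -/
theorem exists_weight_mul_enorm_le {G : 𝓢(Rd d, ℂ)} (hG : G ≠ 0) {p q : ℝ≥0∞} (hp : p ≠ 0)
    (hp1 : p ≤ 1) (hq : q ≠ 0) (s : ℝ) :
    ∃ C : ℝ≥0, ∀ (Φ : 𝓢(Rd d, ℂ)) (t : Rd d),
      weight s t * ‖Φ t‖ₑ ≤ C * mixN p q s (tf G Φ) := by
  obtain ⟨m, hm, h₁⟩ := exists_mixN_pmax_tf_le hG hp hq s
  obtain ⟨C₁, hC₁⟩ := h₁ m le_rfl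
  obtain ⟨C₂, hC₂⟩ := exists_weight_mul_eLpNorm_le_mixN (d := d) hm p hq s
  obtain ⟨C₃, hC₃⟩ := exists_slowlyVarying_eLpNorm_le (E := Rd d) volume hm hp hp1
  obtain ⟨t₀, ht₀⟩ : ∃ t, G t ≠ 0 := by
    by_contra! h
    exact hG (SchwartzMap.ext h)
  have hg0 : ‖G t₀‖ₑ ≠ 0 := enorm_ne_zero.2 ht₀
  have hctop : ‖G t₀‖ₑ⁻¹ * (bw t₀ ^ |s| * C₃ * C₂ * C₁) ≠ ∞ :=
    ENNReal.mul_ne_top (ENNReal.inv_ne_top.2 hg0)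
      (ENNReal.mul_ne_top (ENNReal.mul_ne_top (ENNReal.mul_ne_top (bw_rpow_ne_top _ _)
        ENNReal.coe_ne_top) ENNReal.coe_ne_top) ENNReal.coe_ne_top)
  refine ⟨(‖G t₀‖ₑ⁻¹ * (bw t₀ ^ |s| * C₃ * C₂ * C₁)).toNNReal, fun Φ t => ?_⟩
  rw [ENNReal.coe_toNNReal hctop, mul_assoc]
  refine le_inv_mul_of_mul_le hg0 enorm_ne_top ?_
  set ξ := t - t₀ with hξ
  set V := pmax m (tf G Φ) with hV
  -- With `ξ = t - t₀`, the product `Φ t * G t₀` is the value at `t` of `Φ · T_ξ G`, hence bounded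
  -- by the `L^1` norm of its transform; as `p ≤ 1`, slow variation of the maximal function bounds
  -- that by an `L^p` quasi-norm.
  have h2 : ‖Φ t‖ₑ * ‖G t₀‖ₑ ≤ C₃ * eLpNorm (fun x : Rd d => V (x, ξ)) p volume := by
    have e : Φ t * G t₀ = 𝓕⁻ (𝓕 (shiftMul Φ G ξ) : 𝓢(Rd d, ℂ)) t := by
      rw [FourierTransform.fourierInv_fourier_eq, shiftMul_apply, hξ, sub_sub_cancel]
    rw [← enorm_mul, e, SchwartzMap.fourierInv_coe, Real.fourierInv_eq']
    refine (enorm_integral_le_lintegral_enorm _).trans (le_trans ?_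
      (hC₃ (fun x => V (x, ξ)) ((slowlyVarying_pmax hm _).slice_fst ξ)))
    rw [eLpNorm_ennreal_one]
    refine lintegral_mono fun x => ?_
    rw [smul_eq_mul, enorm_mul, ← ofReal_norm (Complex.exp _), Complex.norm_exp_ofReal_mul_I,
      ENNReal.ofReal_one, one_mul, SchwartzMap.fourier_coe]
    refine le_trans (le_of_eq ?_) (le_pmax m (tf G Φ) (x, ξ))
    have e : ⇑(shiftMul Φ G ξ) = fun t => Φ t * G (t - ξ) := by funext t; simp
    rw [tf, e]
  have h3 : weight s t ≤ weight s ξ * bw t₀ ^ |s| := by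
    simpa [hξ] using weight_le_mul s t ξ
  calc ‖G t₀‖ₑ * (weight s t * ‖Φ t‖ₑ) = weight s t * (‖Φ t‖ₑ * ‖G t₀‖ₑ) := by ring
    _ ≤ (weight s ξ * bw t₀ ^ |s|) * (C₃ * eLpNorm (fun x : Rd d => V (x, ξ)) p volume) :=
        mul_le_mul' h3 h2
    _ = bw t₀ ^ |s| * C₃ * (weight s ξ * eLpNorm (fun x : Rd d => V (x, ξ)) p volume) := by ring
    _ ≤ bw t₀ ^ |s| * C₃ * (C₂ * (C₁ * mixN p q s (tf G Φ))) :=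
        mul_le_mul' le_rfl ((hC₂ V (slowlyVarying_pmax hm _) ξ).trans
          (mul_le_mul' le_rfl (hC₁ Φ (isTemperedFunction_schwartz Φ))))
    _ = _ := by ring

end Embedding

/-! ### Approximation by Schwartz functions -/

section Approximation

theorem tendsto_eLpNorm_zero_of_dominated {α : Type*} [MeasurableSpace α] {μ : Measure α}
    {p : ℝ≥0∞} (hp : p ≠ 0) (hptop : p ≠ ∞) {F : ℕ → α → ℝ≥0∞} {b : α → ℝ≥0∞}
    (hF : ∀ n, Measurable (F n)) (hb : ∀ n x, F n x ≤ b x) (hfin : eLpNorm b p μ ≠ ∞)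
    (hlim : ∀ x, Tendsto (fun n => F n x) atTop (𝓝 0)) :
    Tendsto (fun n => eLpNorm (F n) p μ) atTop (𝓝 0) := by
  have hpr : 0 < p.toReal := ENNReal.toReal_pos hp hptop
  simp_rw [eLpNorm_ennreal_eq_lintegral hp hptop] at hfin ⊢
  have h0 : ∀ {r : ℝ}, 0 < r → Tendsto (fun x : ℝ≥0∞ => x ^ r) (𝓝 0) (𝓝 0) := fun {r} hr => by
    have := (ENNReal.continuous_rpow_const (y := r)).tendsto 0
    rwa [ENNReal.zero_rpow_of_pos hr] at this
  refine (h0 (by positivity : 0 < 1 / p.toReal)).comp ?_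
  have hfin' : ∫⁻ x, b x ^ p.toReal ∂μ ≠ ∞ := fun h => by
    rw [h, ENNReal.top_rpow_of_pos (by positivity)] at hfin
    exact hfin rfl
  simpa using tendsto_lintegral_of_dominated_convergence (μ := μ) (f := fun _ => 0)
    (fun x => b x ^ p.toReal) (fun n => (hF n).pow_const p.toReal)
    (fun n => Eventually.of_forall fun x => ENNReal.rpow_le_rpow (hb n x) hpr.le) hfin'
    (Eventually.of_forall fun x => (h0 hpr).comp (hlim x))

theorem tendsto_mixN_zero_of_dominated {p q : ℝ≥0∞} (hp : p ≠ 0) (hptop : p ≠ ∞) (hq : q ≠ 0)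
    (hqtop : q ≠ ∞) {s : ℝ} {F : ℕ → Rd d × Rd d → ℝ≥0∞} {b : Rd d × Rd d → ℝ≥0∞}
    (hF : ∀ n, LowerSemicontinuous (F n)) (hb : ∀ n z, F n z ≤ b z)
    (hslice : ∀ ξ, eLpNorm (fun x : Rd d => b (x, ξ)) p volume ≠ ∞) (hfin : mixN p q s b ≠ ∞)
    (hlim : ∀ z, Tendsto (fun n => F n z) atTop (𝓝 0)) :
    Tendsto (fun n => mixN p q s (F n)) atTop (𝓝 0) := by
  refine tendsto_eLpNorm_zero_of_dominated hq hqtop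
    (fun n => measurable_mixN_integrand (hF n) p s)
    (fun n ξ => mul_le_mul' le_rfl (eLpNorm_mono_ennreal fun x => hb n (x, ξ))) hfin fun ξ => ?_
  have := tendsto_eLpNorm_zero_of_dominated (μ := volume) hp hptop
    (fun n => (hF n).measurable.comp (measurable_id.prodMk (measurable_const (a := ξ))))
    (fun n x => hb n (x, ξ)) (hslice ξ) (fun x => hlim (x, ξ))
  have h := ENNReal.Tendsto.const_mul (a := weight s ξ) this (Or.inr (weight_ne_top s ξ))
  rwa [mul_zero] at h

/-- The mollification of a rapidly decreasing function is a Schwartz function, whose short-time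
Fourier transform is an average of modulated shifts. -/
theorem exists_mollification {U : Rd d → ℂ} (hUm : AEStronglyMeasurable U volume)
    (hU : ∀ N : ℕ, Integrable fun t => (1 + ‖t‖) ^ N * ‖U t‖) (φ : ContDiffBump (0 : Rd d)) :
    ∃ A : 𝓢(Rd d, ℂ), ∀ (G : 𝓢(Rd d, ℂ)) (x ξ : Rd d),
      𝓕 (fun t => A t * G (t - ξ)) x
        = ∫ h, φ.normed volume h • (Complex.exp (((2 * π * inner ℝ (0 - h) x : ℝ) : ℂ) * Complex.I)
            * 𝓕 (fun t => U t * G (t - (ξ + (0 - h)))) x) := by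
  set ρ : Rd d → ℂ := fun t => (φ.normed volume t : ℂ) with hρ
  have hρc : HasCompactSupport ρ :=
    φ.hasCompactSupport_normed.comp_left (g := fun r : ℝ => (r : ℂ)) (by simp)
  have hρs : ContDiff ℝ (⊤ : ℕ∞) ρ := Complex.ofRealCLM.contDiff.comp φ.contDiff_normed
  set R : 𝓢(Rd d, ℂ) := hρc.toSchwartzMap hρs with hR
  have hRρ : ∀ t, R t = ρ t := fun t => rfl
  have hΨ : Continuous fun y : Rd d => R.compSubConstCLM ℂ y :=
    continuous_compSubConst.comp (continuous_id.prodMk continuous_const)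
  -- The mollification is the superposition of translates of the bump with density `U`; a seminorm
  -- of a translate grows polynomially, and the decay of `U` compensates.
  obtain ⟨A, hA, -⟩ := exists_schwartz_integral (μ := volume) hΨ hUm (fun k n => by
    refine ((hU k).const_mul (2 ^ k * semi (k, n) R)).mono' ?_ (Eventually.of_forall fun y => ?_)
    · have h1 : Continuous fun y => SchwartzMap.seminorm ℂ k n (R.compSubConstCLM ℂ y) :=
        ((schwartz_withSeminorms ℂ (Rd d) ℂ).continuous_seminorm (k, n)).comp hΨ
      exact hUm.norm.mul h1.aestronglyMeasurable
    · rw [Real.norm_of_nonneg (mul_nonneg (norm_nonneg _) (apply_nonneg _ _))]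
      have h2 := (seminorm_le_semi k n (R.compSubConstCLM ℂ y)).trans
        (semi_compSubConst_le (k, n) R y)
      calc _ ≤ ‖U y‖ * (2 ^ k * (1 + ‖y‖) ^ k * semi (k, n) R) :=
            mul_le_mul_of_nonneg_left h2 (norm_nonneg _)
        _ = _ := by ring)
  refine ⟨A, fun G x ξ => ?_⟩
  have hUi : Integrable U := by
    rw [← integrable_norm_iff hUm]
    simpa using hU 0
  have hρi : Integrable ρ := R.integrable
  set e : Rd d → ℂ := fun t => Complex.exp (((-2 * π * inner ℝ t x : ℝ) : ℂ) * Complex.I) with he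
  have hec : Continuous e := by fun_prop
  have hint : Integrable (fun z : Rd d × Rd d => (e z.1 * G (z.1 - ξ)) * (ρ z.2 * U (z.1 - z.2)))
      (volume.prod volume) := by
    have h1 : Integrable (fun z : Rd d × Rd d => ρ z.2 * U (z.1 - z.2)) (volume.prod volume) :=
      hρi.convolution_integrand (ContinuousLinearMap.mul ℂ ℂ) hUi
    refine h1.bdd_mul (c := 2 ^ 0 * semi (0, 0) G) ?_ (Eventually.of_forall fun z => ?_)
    · have := G.continuous
      exact Continuous.aestronglyMeasurable (by fun_prop)
    · rw [norm_mul, he, Complex.norm_exp_ofReal_mul_I, one_mul]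
      simpa using norm_le_of_semi G 0 (z.1 - ξ)
  have hA' : ∀ t, A t = ∫ h, ρ h * U (t - h) := fun t => by
    rw [hA, ← integral_sub_left_eq_self (fun y => _) volume t]
    refine integral_congr_ae (Eventually.of_forall fun h => ?_)
    simp [hRρ, mul_comm]
  calc 𝓕 (fun t => A t * G (t - ξ)) x
      = ∫ t, ∫ h, (e t * G (t - ξ)) * (ρ h * U (t - h)) := by
        rw [Real.fourier_eq']
        refine integral_congr_ae (Eventually.of_forall fun t => ?_)
        simp only [smul_eq_mul]
        rw [hA', integral_const_mul]
        ring
    _ = ∫ h, ∫ t, (e t * G (t - ξ)) * (ρ h * U (t - h)) := integral_integral_swap hint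
    _ = _ := by
        refine integral_congr_ae (Eventually.of_forall fun h => ?_)
        simp only
        rw [Real.fourier_eq', ← integral_const_mul, Complex.real_smul, ← integral_const_mul,
          ← integral_add_right_eq_self (fun t => _) h]
        refine integral_congr_ae (Eventually.of_forall fun t => ?_)
        have e1 : e (t + h) = Complex.exp (((2 * π * inner ℝ (0 - h) x : ℝ) : ℂ) * Complex.I)
            * Complex.exp (((-2 * π * inner ℝ t x : ℝ) : ℂ) * Complex.I) := by
          simp only [he]
          rw [← Complex.exp_add]
          congr 1
          simp only [inner_add_left, zero_sub, inner_neg_left]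
          push_cast
          ring
        have e2 : t + h - ξ = t - (ξ + (0 - h)) := by abel
        simp only [e1, e2, add_sub_cancel_right, smul_eq_mul, hρ]
        ring

theorem tf_sub_eq {U W : Rd d → ℂ} (hU : IsTemperedFunction U) (hW : IsTemperedFunction W)
    (G : 𝓢(Rd d, ℂ)) (z : Rd d × Rd d) :
    tf G (fun t => U t - W t) z
      = ‖𝓕 (fun t => U t * G (t - z.2)) z.1 - 𝓕 (fun t => W t * G (t - z.2)) z.1‖ₑ := by
  rw [tf]
  congr 1
  have h1 := hU.integrable_mul_shift G z.2
  have h2 := hW.integrable_mul_shift G z.2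
  have hec : Continuous fun t : Rd d =>
    Complex.exp (((-2 * π * inner ℝ t z.1 : ℝ) : ℂ) * Complex.I) := by fun_prop
  have h3 : ∀ {f : Rd d → ℂ}, Integrable f → Integrable fun t : Rd d =>
      Complex.exp (((-2 * π * inner ℝ t z.1 : ℝ) : ℂ) * Complex.I) • f t := fun {f} hf =>
    hf.bdd_mul (c := 1) hec.aestronglyMeasurable
      (Eventually.of_forall fun t => (Complex.norm_exp_ofReal_mul_I _).le)
  simp only [Real.fourier_eq']
  rw [← integral_sub (h3 h1) (h3 h2)]
  refine integral_congr_ae (Eventually.of_forall fun t => ?_)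
  simp only [smul_eq_mul]
  ring

theorem tf_sub_le {U W : Rd d → ℂ} (hU : IsTemperedFunction U) (hW : IsTemperedFunction W)
    (G : 𝓢(Rd d, ℂ)) (z : Rd d × Rd d) :
    tf G (fun t => U t - W t) z ≤ tf G U z + tf G W z := by
  rw [tf_sub_eq hU hW]
  exact enorm_sub_le

/-- A rapidly decreasing function with finite modulation quasi-norm for the exponents
`min 1 p`, `min 1 q` can be approximated by Schwartz functions in the quasi-norm with exponents
`p`, `q`. -/
theorem exists_schwartz_mixN_sub_lt {G : 𝓢(Rd d, ℂ)} (hG : G ≠ 0) {p q : ℝ≥0∞} (hp : p ≠ 0)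
    (hq : q ≠ 0) {s : ℝ} {U : Rd d → ℂ} (hUm : AEStronglyMeasurable U volume)
    (hU : ∀ N : ℕ, Integrable fun t => (1 + ‖t‖) ^ N * ‖U t‖)
    (hfin : mixN (min 1 p) (min 1 q) s (tf G U) ≠ ∞) {ε : ℝ≥0∞} (hε : 0 < ε) :
    ∃ A : 𝓢(Rd d, ℂ), mixN p q s (tf G fun t => U t - A t) < ε := by
  have hUi : Integrable U := by
    rw [← integrable_norm_iff hUm]
    simpa using hU 0
  have hUt : IsTemperedFunction U := ⟨0, by simpa using hUi⟩
  have hp1 : min 1 p ≠ 0 := by simp [hp]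
  have hq1 : min 1 q ≠ 0 := by simp [hq]
  have hp1' : min 1 p ≠ ∞ := ne_top_of_le_ne_top ENNReal.one_ne_top (min_le_left _ _)
  have hq1' : min 1 q ≠ ∞ := ne_top_of_le_ne_top ENNReal.one_ne_top (min_le_left _ _)
  -- Convergence is proved for the exponents `min 1 p`, `min 1 q`, which are finite. Slow variation
  -- of the maximal function of the difference then carries it to `p`, `q`.
  obtain ⟨m, hm, h₁⟩ := exists_mixN_pmax_tf_le hG hp1 hq1 s
  obtain ⟨C₁, hC₁⟩ := h₁ m le_rfl
  obtain ⟨C₂, hC₂⟩ := exists_slowlyVarying_mixN_le (d := d) hm hp1 hq1 (min_le_right 1 p)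
    (min_le_right 1 q) s
  obtain ⟨C₃, hC₃⟩ := exists_weight_mul_eLpNorm_le_mixN (d := d) hm (min 1 p) hq1 s
  set φ : ℕ → ContDiffBump (0 : Rd d) := fun n =>
    { rIn := 1 / (n + 1) / 2
      rOut := 1 / (n + 1)
      rIn_pos := by positivity
      rIn_lt_rOut := half_lt_self (by positivity) } with hφ
  have hφr : Tendsto (fun n => (φ n).rOut) atTop (𝓝 0) := tendsto_one_div_add_atTop_nhds_zero_nat
  have hφ1 : ∀ n, (φ n).rOut ≤ 1 := fun n => by
    change 1 / ((n : ℝ) + 1) ≤ 1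
    rw [div_le_one (by positivity)]
    linarith [(Nat.cast_nonneg n : (0 : ℝ) ≤ n)]
  choose A hA using fun n => exists_mollification hUm hU (φ n)
  have hAt : ∀ n, IsTemperedFunction (A n) := fun n => isTemperedFunction_schwartz (A n)
  set V := pmax m (tf G U) with hV
  have hVs : SlowlyVarying m V := slowlyVarying_pmax hm _
  set F : ℕ → Rd d × Rd d → ℝ≥0∞ := fun n => tf G fun t => U t - A n t with hF
  have hFc : ∀ n, Continuous (F n) := fun n => continuous_tf (hUt.sub (hAt n)) G
  -- pointwise convergence
  have hlim : ∀ z, Tendsto (fun n => F n z) atTop (𝓝 0) := by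
    intro z
    set g : Rd d → ℂ := fun u => Complex.exp (((2 * π * inner ℝ u z.1 : ℝ) : ℂ) * Complex.I)
      * 𝓕 (fun t => U t * G (t - (z.2 + u))) z.1 with hg
    have hgc : Continuous g := by
      have h := (continuous_fourier_mul_shift hUt G).comp
        (continuous_const.prodMk (continuous_const.add continuous_id) :
          Continuous fun u : Rd d => (z.1, z.2 + u))
      exact Continuous.mul (by fun_prop) h
    have h := ContDiffBump.convolution_tendsto_right_of_continuous (μ := volume) hφr hgc 0
    -- By definition this is the formula of `exists_mollification`, which is stated with `0 - h` so
    -- as to be a convolution evaluated at `0`.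
    have h2 : ∀ n, (MeasureTheory.convolution ((φ n).normed volume) g
        (ContinuousLinearMap.lsmul ℝ ℝ) volume) 0 = 𝓕 (fun t => A n t * G (t - z.2)) z.1 :=
      fun n => ((hA n) G z.1 z.2).symm
    have h3 : g 0 = 𝓕 (fun t => U t * G (t - z.2)) z.1 := by simp [hg]
    simp_rw [h2, h3] at h
    have h4 := ((tendsto_const_nhds (x := 𝓕 (fun t => U t * G (t - z.2)) z.1)).sub h).enorm
    simp only [sub_self, enorm_zero] at h4
    refine h4.congr fun n => ?_
    exact (tf_sub_eq hUt (hAt n) G z).symm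
  -- domination
  set c : ℝ≥0∞ := 1 + 2 ^ m with hc
  have hctop : c ≠ ∞ :=
    ENNReal.add_ne_top.2 ⟨ENNReal.one_ne_top, ENNReal.rpow_ne_top_of_nonneg hm (by simp)⟩
  -- The bumps have mass one and live in the unit ball, so the averaged shifts have length less than
  -- `1` and cost a factor `2 ^ m` in the maximal function.
  have hdom : ∀ n z, F n z ≤ c * V z := by
    intro n z
    refine (tf_sub_le hUt (hAt n) G z).trans ?_
    rw [hc, add_mul, one_mul]
    refine add_le_add (le_pmax m (tf G U) z) ?_
    have h1 : ∀ h, ‖(φ n).normed volume h • (Complex.exp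
        (((2 * π * inner ℝ (0 - h) z.1 : ℝ) : ℂ) * Complex.I)
          * 𝓕 (fun t => U t * G (t - (z.2 + (0 - h)))) z.1)‖ₑ
        ≤ (2 ^ m * V z) * ‖(φ n).normed volume h‖ₑ := by
      intro h
      rw [enorm_smul, enorm_mul, ← ofReal_norm (Complex.exp _), Complex.norm_exp_ofReal_mul_I,
        ENNReal.ofReal_one, one_mul, mul_comm]
      rcases eq_or_ne ((φ n).normed volume h) 0 with h0 | h0
      · simp [h0]
      · refine mul_le_mul' ?_ le_rfl
        have hh : ‖h‖ < 1 := by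
          have : h ∈ Function.support ((φ n).normed volume) := h0
          rw [(φ n).support_normed_eq, mem_ball_zero_iff] at this
          exact this.trans_le (hφ1 n)
        have h2 := le_pmax_mul hm (tf G U) (z.1, z.2 + (0 - h)) z
        refine h2.trans ?_
        rw [mul_comm]
        refine mul_le_mul' (ENNReal.rpow_le_rpow ?_ hm) le_rfl
        have e : bw ((z.1, z.2 + (0 - h)) - z) = bw h := by
          simp [bw_eq_ofReal, Prod.norm_def]
        have h1' : ‖h‖ₑ ≤ 1 := by
          rw [← ofReal_norm]; exact ENNReal.ofReal_le_one.2 hh.le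
        rw [e, bw]
        exact (add_le_add le_rfl h1').trans one_add_one_eq_two.le
    have h3 : ∫⁻ h, ‖(φ n).normed volume h‖ₑ = 1 := by
      have h4 := ofReal_integral_eq_lintegral_ofReal (μ := volume) (φ n).integrable_normed
        (Eventually.of_forall fun x => (φ n).nonneg_normed x)
      rw [(φ n).integral_normed, ENNReal.ofReal_one] at h4
      rw [h4]
      refine lintegral_congr fun h => ?_
      exact Real.enorm_eq_ofReal ((φ n).nonneg_normed h)
    have hmeas : Measurable fun h => ‖(φ n).normed volume h‖ₑ :=
      (φ n).continuous_normed.enorm.measurable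
    calc tf G (A n) z ≤ _ := by
          rw [tf, hA n G z.1 z.2]
          exact enorm_integral_le_lintegral_enorm _
      _ ≤ ∫⁻ h, (2 ^ m * V z) * ‖(φ n).normed volume h‖ₑ := lintegral_mono h1
      _ = _ := by rw [lintegral_const_mul _ hmeas, h3, mul_one]
  have hVfin : mixN (min 1 p) (min 1 q) s V ≠ ∞ :=
    ne_top_of_le_ne_top (ENNReal.mul_ne_top ENNReal.coe_ne_top hfin) (hC₁ U hUt)
  have hconv := tendsto_mixN_zero_of_dominated hp1 hp1' hq1 hq1' (s := s) (b := fun z => c * V z)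
    (fun n => (hFc n).lowerSemicontinuous) hdom (fun ξ => by
      rw [eLpNorm_ennreal_const_mul hctop]
      refine ENNReal.mul_ne_top hctop fun h => ?_
      have := hC₃ V hVs ξ
      rw [h, ENNReal.mul_top (weight_ne_zero s ξ), top_le_iff] at this
      exact ENNReal.mul_ne_top ENNReal.coe_ne_top hVfin this)
    (by rw [mixN_const_mul hctop]; exact ENNReal.mul_ne_top hctop hVfin) hlim
  have hfinal := ENNReal.Tendsto.const_mul (a := (C₂ * C₁ : ℝ≥0)) hconv
    (Or.inr ENNReal.coe_ne_top)
  rw [mul_zero] at hfinal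
  obtain ⟨n, hn⟩ := (hfinal.eventually (gt_mem_nhds hε)).exists
  refine ⟨A n, lt_of_le_of_lt ?_ hn⟩
  calc mixN p q s (F n) ≤ mixN p q s (pmax m (F n)) := mixN_mono (le_pmax m _)
    _ ≤ C₂ * mixN (min 1 p) (min 1 q) s (pmax m (F n)) := hC₂ _ (slowlyVarying_pmax hm _)
    _ ≤ C₂ * (C₁ * mixN (min 1 p) (min 1 q) s (F n)) :=
        mul_le_mul' le_rfl (hC₁ _ (hUt.sub (hAt n)))
    _ = _ := by push_cast; ring

end Approximation

/-! ### Tempered distributions given by functions -/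

section Distributions

theorem exists_represents {U : Rd d → ℂ} (hU : IsTemperedFunction U) :
    ∃ T : 𝓢'(Rd d, ℂ), Represents T U := by
  have hU' := hU
  obtain ⟨N, hN⟩ := hU
  set I : ℝ := ∫ t, ‖(((1 + ‖t‖) ^ N)⁻¹ : ℝ) • U t‖ with hI
  have hi : ∀ φ : 𝓢(Rd d, ℂ), Integrable fun t => φ t * U t := fun φ => by
    simpa [mul_comm] using hU'.integrable_mul φ
  let L : 𝓢(Rd d, ℂ) →L[ℂ] ℂ := SchwartzMap.mkCLMtoNormedSpace (𝕜 := ℂ) (σ := RingHom.id ℂ)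
    (fun φ => ∫ t, φ t * U t)
    (fun f g => by
      rw [← integral_add (hi f) (hi g)]
      refine integral_congr_ae (Eventually.of_forall fun t => ?_)
      simp [add_mul])
    (fun a f => by
      simp only [smul_apply, smul_eq_mul, mul_assoc, RingHom.id_apply]
      rw [integral_const_mul])
    ⟨Finset.Iic (N, 0), 2 ^ N * I, mul_nonneg (by positivity)
      (integral_nonneg fun t => norm_nonneg _), fun φ => by
      have h1 : ‖∫ t, φ t * U t‖ ≤ ∫ t, (2 ^ N * semi (N, 0) φ) *
          ‖(((1 + ‖t‖) ^ N)⁻¹ : ℝ) • U t‖ := by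
        refine norm_integral_le_of_norm_le (hN.norm.const_mul _) (Eventually.of_forall fun t => ?_)
        have := norm_mul_shift_le U φ N t 0
        simpa [mul_comm] using this
      rw [integral_const_mul] at h1
      refine h1.trans (le_of_eq ?_)
      change 2 ^ N * semi (N, 0) φ * I = 2 ^ N * I * semi (N, 0) φ
      ring⟩
  exact ⟨ContinuousLinearMap.toPointwiseConvergenceCLM _ _ _ _ L, hU', fun φ => rfl⟩

theorem Represents.add {T S : 𝓢'(Rd d, ℂ)} {U W : Rd d → ℂ} (hT : Represents T U)
    (hS : Represents S W) (φ : 𝓢(Rd d, ℂ)) : (T + S) φ = ∫ t, φ t * (U t + W t) := by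
  have hi : ∀ {U : Rd d → ℂ}, IsTemperedFunction U → Integrable fun t => φ t * U t := fun hU => by
    simpa [mul_comm] using hU.integrable_mul φ
  change T φ + S φ = _
  rw [hT.2, hS.2, ← integral_add (hi hT.1) (hi hS.1)]
  refine integral_congr_ae (Eventually.of_forall fun t => ?_)
  simp [mul_add]

theorem Represents.sub {T S : 𝓢'(Rd d, ℂ)} {U W : Rd d → ℂ} (hT : Represents T U)
    (hS : Represents S W) : Represents (T - S) fun t => U t - W t := by
  refine ⟨hT.1.sub hS.1, fun φ => ?_⟩
  have hi : ∀ {U : Rd d → ℂ}, IsTemperedFunction U → Integrable fun t => φ t * U t := fun hU => by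
    simpa [mul_comm] using hU.integrable_mul φ
  change T φ - S φ = _
  rw [hT.2, hS.2, ← integral_sub (hi hT.1) (hi hS.1)]
  refine integral_congr_ae (Eventually.of_forall fun t => ?_)
  simp [mul_sub]

theorem represents_schwartz (φ : 𝓢(Rd d, ℂ)) :
    Represents (φ : 𝓢'(Rd d, ℂ)) (φ : Rd d → ℂ) :=
  ⟨isTemperedFunction_schwartz φ, fun ψ => by simp⟩

theorem represents_fourier_schwartz (φ : 𝓢(Rd d, ℂ)) :
    Represents (𝓕 (φ : 𝓢'(Rd d, ℂ))) ((𝓕 φ : 𝓢(Rd d, ℂ)) : Rd d → ℂ) := by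
  rw [TemperedDistribution.fourier_toTemperedDistributionCLM_eq]
  exact represents_schwartz _

/-- The Fourier multiplier with symbol `σ`, from Schwartz functions to tempered distributions. -/
def multiplierDist {σ : Rd d → ℂ} (hσ : IsTemperedFunction σ) :
    𝓢(Rd d, ℂ) →ₗ[ℂ] 𝓢'(Rd d, ℂ) where
  toFun φ := 𝓕⁻ (exists_represents (hσ.mul_schwartz (𝓕 φ : 𝓢(Rd d, ℂ)))).choose
  map_add' φ ψ := by
    rw [← FourierTransform.fourierInv_add]
    congr 1
    ext χ
    have h := fun φ : 𝓢(Rd d, ℂ) =>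
      (exists_represents (hσ.mul_schwartz (𝓕 φ : 𝓢(Rd d, ℂ)))).choose_spec
    rw [(h φ).add (h ψ), (h (φ + ψ)).2]
    refine integral_congr_ae (Eventually.of_forall fun t => ?_)
    simp [FourierTransform.fourier_add, mul_add]
  map_smul' c φ := by
    rw [RingHom.id_apply, ← FourierTransform.fourierInv_smul]
    congr 1
    ext χ
    have h := fun φ : 𝓢(Rd d, ℂ) =>
      (exists_represents (hσ.mul_schwartz (𝓕 φ : 𝓢(Rd d, ℂ)))).choose_spec
    change _ = c • (exists_represents (hσ.mul_schwartz (𝓕 φ : 𝓢(Rd d, ℂ)))).choose χ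
    rw [(h φ).2, (h (c • φ)).2, ← integral_smul]
    refine integral_congr_ae (Eventually.of_forall fun t => ?_)
    simp only [FourierTransform.fourier_smul, smul_apply, smul_eq_mul]
    ring

theorem represents_fourier_multiplierDist {σ : Rd d → ℂ} (hσ : IsTemperedFunction σ)
    (φ : 𝓢(Rd d, ℂ)) :
    Represents (𝓕 (multiplierDist hσ φ)) fun t => σ t * (𝓕 φ : 𝓢(Rd d, ℂ)) t := by
  have h := (exists_represents (hσ.mul_schwartz (𝓕 φ : 𝓢(Rd d, ℂ)))).choose_spec
  have e : 𝓕 (multiplierDist hσ φ)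
      = (exists_represents (hσ.mul_schwartz (𝓕 φ : 𝓢(Rd d, ℂ)))).choose :=
    FourierTransform.fourier_fourierInv_eq _
  rw [e]
  exact h

theorem fourierMultiplier_eq (σ : Rd d → ℂ) (φ : 𝓢(Rd d, ℂ)) (x : Rd d) :
    fourierMultiplier σ φ x = 𝓕 (fun t => σ (-t) * (𝓕 φ : 𝓢(Rd d, ℂ)) (-t)) x := by
  rw [fourierMultiplier, Real.fourier_eq', ← integral_neg_eq_self]
  refine integral_congr_ae (Eventually.of_forall fun t => ?_)
  simp only [character, smul_eq_mul, inner_neg_right, real_inner_comm t x]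
  ring_nf

/-- `σ φ̂` is integrable, so the multiplier is a bounded continuous function; the pairing is the
multiplication formula for `u`, the reflection turning the inverse transform into a direct one. -/
theorem represents_multiplierDist {σ : Rd d → ℂ} (hσ : IsTemperedFunction σ) (φ : 𝓢(Rd d, ℂ)) :
    Represents (multiplierDist hσ φ) (fourierMultiplier σ φ) := by
  set u : Rd d → ℂ := fun t => σ (-t) * (𝓕 φ : 𝓢(Rd d, ℂ)) (-t) with hu
  have hui : Integrable u := (hσ.integrable_mul (𝓕 φ : 𝓢(Rd d, ℂ))).comp_neg
  have hH : fourierMultiplier σ φ = 𝓕 u := funext fun x => fourierMultiplier_eq σ φ x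
  have hcont : Continuous (𝓕 u) :=
    VectorFourier.fourierIntegral_continuous Real.continuous_fourierChar
      (L := innerₗ (Rd d)) continuous_inner hui
  rw [hH]
  -- A bounded function is integrable against the power `d + 1`.
  refine ⟨⟨d + 1, ?_⟩, fun ψ => ?_⟩
  · have h1 : Integrable (fun x : Rd d => (1 + ‖x‖) ^ (-((d + 1 : ℕ) : ℝ))) :=
      integrable_one_add_norm (by simp)
    refine (h1.mul_const (∫ t, ‖u t‖)).mono' ?_ (Eventually.of_forall fun x => ?_)
    · have hc : Continuous fun x : Rd d => (((1 + ‖x‖) ^ (d + 1))⁻¹ : ℝ) :=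
        Continuous.inv₀ (by fun_prop) fun x => by positivity
      exact (hc.smul hcont).aestronglyMeasurable
    · rw [norm_smul, norm_inv, norm_pow, Real.norm_of_nonneg (by positivity : 0 ≤ 1 + ‖x‖),
        Real.rpow_neg (by positivity), Real.rpow_natCast]
      refine mul_le_mul_of_nonneg_left ?_ (by positivity)
      exact VectorFourier.norm_fourierIntegral_le_integral_norm _ _ _ _ _
  · have h1 : multiplierDist hσ φ ψ
        = 𝓕 (multiplierDist hσ φ) (𝓕⁻ ψ : 𝓢(Rd d, ℂ)) := by
      rw [TemperedDistribution.fourier_apply, FourierTransform.fourier_fourierInv_eq]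
    rw [h1, (represents_fourier_multiplierDist hσ φ).2]
    have h2 := VectorFourier.integral_fourierIntegral_smul_eq_flip (L := innerₗ (Rd d))
      Real.continuous_fourierChar continuous_inner (ψ.integrable (μ := volume)) hui
    have h3 : ∫ x, ψ x * 𝓕 u x = ∫ t, 𝓕 (ψ : Rd d → ℂ) t * u t := by
      rw [flip_innerₗ] at h2
      exact h2.symm
    rw [h3, ← integral_neg_eq_self]
    refine integral_congr_ae (Eventually.of_forall fun t => ?_)
    simp only [hu, SchwartzMap.fourierInv_coe, Real.fourierInv_eq_fourier_neg, neg_neg]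

/-- The short-time Fourier transform of a distribution, expressed on the Fourier side. -/
theorem enorm_stft_eq (g : 𝓢(Rd d, ℂ)) {D : 𝓢'(Rd d, ℂ)} {U : Rd d → ℂ} (h : Represents (𝓕 D) U)
    (x ξ : Rd d) : ‖stft g D x ξ‖ₑ = tf (conjS (𝓕 g : 𝓢(Rd d, ℂ))) U (-x, ξ) := by
  have h1 : stft g D x ξ = 𝓕 D (𝓕⁻ (conjShift g x ξ) : 𝓢(Rd d, ℂ)) := by
    rw [TemperedDistribution.fourier_apply, FourierTransform.fourier_fourierInv_eq]
    rfl
  have h2 : ∀ t, (𝓕⁻ (conjShift g x ξ) : 𝓢(Rd d, ℂ)) t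
      = Complex.exp (((2 * π * inner ℝ (t - ξ) x : ℝ) : ℂ) * Complex.I)
        * conjS (𝓕 g : 𝓢(Rd d, ℂ)) (t - ξ) := by
    intro t
    rw [conjS_apply, SchwartzMap.fourierInv_coe, Real.fourierInv_eq', SchwartzMap.fourier_coe,
      Real.fourier_eq', ← integral_conj, ← integral_const_mul,
      ← integral_add_right_eq_self (fun y => _) x]
    refine integral_congr_ae (Eventually.of_forall fun y => ?_)
    simp only [conjShift_apply, smul_eq_mul, map_mul, add_sub_cancel_right, character]
    rw [← Complex.exp_conj, ← Complex.exp_conj, ← mul_assoc, ← mul_assoc, ← Complex.exp_add,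
      ← Complex.exp_add]
    congr 2
    simp only [map_mul, Complex.conj_ofReal, Complex.conj_I, inner_add_left, inner_add_right,
      inner_sub_left, inner_sub_right, real_inner_comm t y, real_inner_comm t x,
      real_inner_comm ξ y]
    push_cast
    ring
  rw [h1, h.2, tf, Real.fourier_eq']
  have h3 : ∫ t, (𝓕⁻ (conjShift g x ξ) : 𝓢(Rd d, ℂ)) t * U t
      = Complex.exp (((-(2 * π * inner ℝ ξ x) : ℝ) : ℂ) * Complex.I) *
        ∫ t, Complex.exp (((-2 * π * inner ℝ t (-x) : ℝ) : ℂ) * Complex.I) •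
          (U t * conjS (𝓕 g : 𝓢(Rd d, ℂ)) (t - ξ)) := by
    rw [← integral_const_mul]
    refine integral_congr_ae (Eventually.of_forall fun t => ?_)
    simp only [h2, smul_eq_mul]
    have e : Complex.exp (((2 * π * inner ℝ (t - ξ) x : ℝ) : ℂ) * Complex.I)
        = Complex.exp (((-(2 * π * inner ℝ ξ x) : ℝ) : ℂ) * Complex.I) *
          Complex.exp (((-2 * π * inner ℝ t (-x) : ℝ) : ℂ) * Complex.I) := by
      rw [← Complex.exp_add]
      congr 1
      simp only [inner_sub_left, inner_neg_right]
      push_cast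
      ring
    rw [e]
    ring
  rw [h3, enorm_mul, ← ofReal_norm (Complex.exp _), Complex.norm_exp_ofReal_mul_I,
    ENNReal.ofReal_one, one_mul]

theorem conjS_fourier_ne_zero {g : 𝓢(Rd d, ℂ)} (hg : g ≠ 0) :
    conjS (𝓕 g : 𝓢(Rd d, ℂ)) ≠ 0 := by
  intro h
  have h1 : (𝓕 g : 𝓢(Rd d, ℂ)) = 0 := by
    ext t
    have := congrArg (fun f : 𝓢(Rd d, ℂ) => f t) h
    simpa using this
  apply hg
  rw [← FourierTransform.fourierInv_fourier_eq (F := 𝓢(Rd d, ℂ)) g, h1]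
  exact (FourierTransform.fourierInvCLM ℂ 𝓢(Rd d, ℂ)).map_zero

/-- Transfers the norm estimates to the Fourier side; the reflection `x ↦ -x` in `enorm_stft_eq`
preserves Lebesgue measure. -/
theorem modulationNorm_eq_mixN_tf (g : 𝓢(Rd d, ℂ)) (p q : ℝ≥0∞) (s : ℝ) {D : 𝓢'(Rd d, ℂ)}
    {U : Rd d → ℂ} (h : Represents (𝓕 D) U) :
    modulationNorm g p q s D = mixN p q s (tf (conjS (𝓕 g : 𝓢(Rd d, ℂ))) U) := by
  rw [modulationNorm, mixN]
  congr 1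
  funext ξ
  congr 1
  set V := tf (conjS (𝓕 g : 𝓢(Rd d, ℂ))) U with hV
  have hc : Continuous fun x : Rd d => V (x, ξ) :=
    (continuous_tf h.1 _).comp (continuous_id.prodMk continuous_const)
  rw [← eLpNorm_enorm]
  simp_rw [enorm_stft_eq g h]
  exact eLpNorm_comp_measurePreserving (g := fun x : Rd d => V (x, ξ))
    hc.aestronglyMeasurable (Measure.measurePreserving_neg volume)

theorem continuous_stft (g : 𝓢(Rd d, ℂ)) (T : 𝓢'(Rd d, ℂ)) :
    Continuous fun z : Rd d × Rd d => stft g T z.1 z.2 := by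
  have hT : Continuous fun φ : 𝓢(Rd d, ℂ) => T φ := map_continuous T
  exact hT.comp (continuous_conjShift g)

theorem modulationNorm_eq_mixN (g : 𝓢(Rd d, ℂ)) (p q : ℝ≥0∞) (s : ℝ) (T : 𝓢'(Rd d, ℂ)) :
    modulationNorm g p q s T = mixN p q s fun z => ‖stft g T z.1 z.2‖ₑ := by
  rw [modulationNorm, mixN]
  congr 1

theorem exists_modulationNorm_sub_le (g : 𝓢(Rd d, ℂ)) (p q : ℝ≥0∞) (s : ℝ) :
    ∃ K : ℝ≥0, (∀ T S : 𝓢'(Rd d, ℂ), modulationNorm g p q s (T + S)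
        ≤ K * (modulationNorm g p q s T + modulationNorm g p q s S)) ∧
      ∀ T S : 𝓢'(Rd d, ℂ), modulationNorm g p q s (T - S)
        ≤ K * (modulationNorm g p q s T + modulationNorm g p q s S) := by
  obtain ⟨K, hK⟩ := exists_mixN_add_le (d := d) p q s
  simp_rw [modulationNorm_eq_mixN]
  have hl : ∀ T : 𝓢'(Rd d, ℂ), LowerSemicontinuous fun z : Rd d × Rd d => ‖stft g T z.1 z.2‖ₑ :=
    fun T => (continuous_stft g T).enorm.lowerSemicontinuous
  refine ⟨K, fun T S => ?_, fun T S => ?_⟩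
  · exact (mixN_mono fun z => enorm_add_le (stft g T z.1 z.2) (stft g S z.1 z.2)).trans
      (hK _ _ (hl T) (hl S))
  · exact (mixN_mono fun z => enorm_sub_le (a := stft g T z.1 z.2) (b := stft g S z.1 z.2)).trans
      (hK _ _ (hl T) (hl S))

theorem modulationNorm_smul (g : 𝓢(Rd d, ℂ)) (p q : ℝ≥0∞) (s : ℝ) (c : ℂ) (T : 𝓢'(Rd d, ℂ)) :
    modulationNorm g p q s (c • T) = ‖c‖ₑ * modulationNorm g p q s T := by
  simp_rw [modulationNorm_eq_mixN]
  rw [← mixN_const_mul enorm_ne_top]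
  congr 1
  funext z
  exact enorm_mul c (stft g T z.1 z.2)

theorem modulationNorm_zero (g : 𝓢(Rd d, ℂ)) (p q : ℝ≥0∞) (s : ℝ) :
    modulationNorm g p q s 0 = 0 := by
  have h := modulationNorm_smul g p q s 0 0
  have e : (0 : ℂ) • (0 : 𝓢'(Rd d, ℂ)) = 0 := by
    ext φ
    exact zero_smul ℂ ((0 : 𝓢'(Rd d, ℂ)) φ)
  rwa [e, enorm_zero, zero_mul] at h

/-- Pointwise convergence of distributions gives pointwise convergence of their short-time Fourier
transforms; then Fatou for mixed norms. -/
theorem modulationNorm_le_liminf (g : 𝓢(Rd d, ℂ)) (p q : ℝ≥0∞) (s : ℝ) {T : 𝓢'(Rd d, ℂ)}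
    {S : ℕ → 𝓢'(Rd d, ℂ)} (h : ∀ φ, Tendsto (fun n => S n φ) atTop (𝓝 (T φ))) :
    modulationNorm g p q s T ≤ liminf (fun n => modulationNorm g p q s (S n)) atTop := by
  simp_rw [modulationNorm_eq_mixN]
  refine le_trans (mixN_mono fun z => ?_)
    (mixN_liminf_le fun n => (continuous_stft g (S n)).enorm.lowerSemicontinuous)
  exact (h (conjShift g z.1 z.2)).enorm.liminf_eq.ge

end Distributions

/-! ### Extension from the Schwartz class to modulation spaces -/

section Extension

theorem tendsto_inv_natCast_add_one :
    Tendsto (fun n : ℕ => ((n : ℝ≥0∞) + 1)⁻¹) atTop (𝓝 0) := by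
  have h := (tendsto_add_atTop_iff_nat 1).2 ENNReal.tendsto_inv_nat_nhds_zero
  simpa using h

theorem exists_seq_of_mem_modulationSpace {g : 𝓢(Rd d, ℂ)} {p q : ℝ≥0∞} {s : ℝ}
    {f : 𝓢'(Rd d, ℂ)} (hf : f ∈ modulationSpace g p q s) :
    ∃ φ : ℕ → 𝓢(Rd d, ℂ), ∀ n,
      modulationNorm g p q s (f - (φ n : 𝓢'(Rd d, ℂ))) ≤ ((n : ℝ≥0∞) + 1)⁻¹ := by
  choose φ hφ using fun n : ℕ => hf (((n : ℝ≥0∞) + 1)⁻¹)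
    (ENNReal.inv_pos.2 (ENNReal.add_ne_top.2 ⟨ENNReal.natCast_ne_top n, ENNReal.one_ne_top⟩))
  exact ⟨φ, fun n => (hφ n).le⟩

/-- Extension by continuity of a bounded linear map from Schwartz functions to distributions. -/
theorem exists_extension {g : 𝓢(Rd d, ℂ)} {p q : ℝ≥0∞} {s t : ℝ}
    {D : 𝓢(Rd d, ℂ) →ₗ[ℂ] 𝓢'(Rd d, ℂ)} {B C K : ℝ≥0} {M : ℕ × ℕ}
    (hY : ∀ φ : 𝓢(Rd d, ℂ), modulationNorm g p q t (D φ)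
      ≤ B * modulationNorm g p q s (φ : 𝓢'(Rd d, ℂ)))
    (hP : ∀ φ ψ, ‖D φ ψ‖ₑ ≤ C * ENNReal.ofReal (semi M ψ) * modulationNorm g p q t (D φ))
    (hK : ∀ T S : 𝓢'(Rd d, ℂ), modulationNorm g p q s (T - S)
      ≤ K * (modulationNorm g p q s T + modulationNorm g p q s S))
    {f : 𝓢'(Rd d, ℂ)} (hf : f ∈ modulationSpace g p q s) :
    ∃ h : 𝓢'(Rd d, ℂ), ∀ φ : 𝓢(Rd d, ℂ),
      (∀ ψ, ‖h ψ - D φ ψ‖ₑ ≤ C * ENNReal.ofReal (semi M ψ) *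
        (B * (K * modulationNorm g p q s (f - (φ : 𝓢'(Rd d, ℂ)))))) ∧
      modulationNorm g p q t (h - D φ)
        ≤ B * (K * modulationNorm g p q s (f - (φ : 𝓢'(Rd d, ℂ)))) := by
  obtain ⟨φ, hφ⟩ := exists_seq_of_mem_modulationSpace hf
  set X := fun T : 𝓢'(Rd d, ℂ) => modulationNorm g p q s T with hX
  set ε : ℕ → ℝ≥0∞ := fun n => ((n : ℝ≥0∞) + 1)⁻¹ with hε
  have hεa : ∀ {n N : ℕ}, N ≤ n → ε n ≤ ε N := fun {n N} h => by
    simp only [hε]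
    gcongr
  have hεlim : Tendsto ε atTop (𝓝 0) := tendsto_inv_natCast_add_one
  have hdiff : ∀ n (χ : 𝓢(Rd d, ℂ)), modulationNorm g p q t (D (φ n - χ))
      ≤ B * (K * (X (f - (χ : 𝓢'(Rd d, ℂ))) + ε n)) := by
    intro n χ
    refine (hY _).trans (mul_le_mul' le_rfl ?_)
    have e : ((φ n - χ : 𝓢(Rd d, ℂ)) : 𝓢'(Rd d, ℂ))
        = (f - (χ : 𝓢'(Rd d, ℂ))) - (f - (φ n : 𝓢'(Rd d, ℂ))) := by
      rw [map_sub]; abel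
    rw [e]
    exact (hK _ _).trans (mul_le_mul' le_rfl (add_le_add le_rfl (hφ n)))
  have hdiffψ : ∀ n (χ ψ : 𝓢(Rd d, ℂ)), ‖D (φ n) ψ - D χ ψ‖ₑ
      ≤ C * ENNReal.ofReal (semi M ψ) * (B * (K * (X (f - (χ : 𝓢'(Rd d, ℂ))) + ε n))) := by
    intro n χ ψ
    have e : D (φ n) ψ - D χ ψ = D (φ n - χ) ψ := by rw [map_sub]; rfl
    rw [e]
    exact (hP _ _).trans (mul_le_mul' le_rfl (hdiff n χ))
  have hctop : ∀ ψ : 𝓢(Rd d, ℂ), (C : ℝ≥0∞) * ENNReal.ofReal (semi M ψ) ≠ ∞ := fun ψ =>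
    ENNReal.mul_ne_top ENNReal.coe_ne_top ENNReal.ofReal_ne_top
  have hcauchy : ∀ ψ, ∃ a : ℂ, Tendsto (fun n => D (φ n) ψ) atTop (𝓝 a) := by
    intro ψ
    refine cauchySeq_tendsto_of_complete (EMetric.cauchySeq_iff_le_tendsto_0.2
      ⟨fun N => C * ENNReal.ofReal (semi M ψ) * (B * (K * (ε N + ε N))), ?_, ?_⟩)
    · intro n m N hn hm
      rw [edist_eq_enorm_sub]
      refine (hdiffψ n (φ m) ψ).trans ?_
      refine mul_le_mul' le_rfl (mul_le_mul' le_rfl (mul_le_mul' le_rfl ?_))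
      exact add_le_add ((hφ m).trans (hεa hm)) (hεa hn)
    · have h1 := ENNReal.Tendsto.const_mul (a := C * ENNReal.ofReal (semi M ψ))
        (ENNReal.Tendsto.const_mul (a := (B : ℝ≥0∞)) (ENNReal.Tendsto.const_mul (a := (K : ℝ≥0∞))
          (hεlim.add hεlim) (Or.inr ENNReal.coe_ne_top)) (Or.inr ENNReal.coe_ne_top))
          (Or.inr (hctop ψ))
      simpa using h1
  choose a ha using hcauchy
  have hlimε : ∀ (A : ℝ≥0∞) (c : ℝ≥0∞), c ≠ ∞ →
      Tendsto (fun n => c * (B * (K * (A + ε n)))) atTop (𝓝 (c * (B * (K * A)))) := by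
    intro A c hc
    have h1 := ENNReal.Tendsto.const_mul (a := c)
        (ENNReal.Tendsto.const_mul (a := (B : ℝ≥0∞)) (ENNReal.Tendsto.const_mul (a := (K : ℝ≥0∞))
          ((tendsto_const_nhds (x := A)).add hεlim) (Or.inr ENNReal.coe_ne_top))
          (Or.inr ENNReal.coe_ne_top)) (Or.inr hc)
    simpa using h1
  have hest : ∀ χ ψ : 𝓢(Rd d, ℂ), ‖a ψ - D χ ψ‖ₑ ≤ C * ENNReal.ofReal (semi M ψ) *
      (B * (K * X (f - (χ : 𝓢'(Rd d, ℂ))))) := fun χ ψ =>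
    le_of_tendsto_of_tendsto' ((ha ψ).sub_const (D χ ψ)).enorm (hlimε _ _ (hctop ψ))
      fun n => hdiffψ n χ ψ
  let L : 𝓢(Rd d, ℂ) →ₗ[ℂ] ℂ :=
    { toFun := a
      map_add' := fun ψ₁ ψ₂ => tendsto_nhds_unique (ha (ψ₁ + ψ₂)) <| by
        simpa using (ha ψ₁).add (ha ψ₂)
      map_smul' := fun c ψ => tendsto_nhds_unique (ha (c • ψ)) <| by
        simpa using (ha ψ).const_mul c }
  -- The limit differs from the continuous functional `D (φ 0)` by one bounded by a Schwartz
  -- seminorm.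
  have hLcont : Continuous L := by
    set R : ℝ≥0∞ := C * (B * (K * X (f - (φ 0 : 𝓢'(Rd d, ℂ))))) with hR
    have hRtop : R ≠ ∞ := by
      refine ENNReal.mul_ne_top ENNReal.coe_ne_top (ENNReal.mul_ne_top ENNReal.coe_ne_top
        (ENNReal.mul_ne_top ENNReal.coe_ne_top (ne_top_of_le_ne_top ?_ (hφ 0))))
      simp
    have hD0 : Continuous fun ψ : 𝓢(Rd d, ℂ) => D (φ 0) ψ := map_continuous (D (φ 0))
    have hb : ∀ ψ, ‖L ψ - D (φ 0) ψ‖ ≤ R.toReal * semi M ψ := by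
      intro ψ
      have h1 : ‖L ψ - D (φ 0) ψ‖ₑ ≤ ENNReal.ofReal (R.toReal * semi M ψ) := by
        rw [ENNReal.ofReal_mul ENNReal.toReal_nonneg, ENNReal.ofReal_toReal hRtop]
        refine (hest (φ 0) ψ).trans (le_of_eq ?_)
        rw [hR]; ring
      rw [← ofReal_norm] at h1
      exact (ENNReal.ofReal_le_ofReal_iff
        (mul_nonneg ENNReal.toReal_nonneg (apply_nonneg _ _))).1 h1
    refine continuous_of_continuousAt_zero L ?_
    rw [ContinuousAt, map_zero]
    have h1 : Tendsto (fun ψ : 𝓢(Rd d, ℂ) => L ψ - D (φ 0) ψ) (𝓝 0) (𝓝 0) := by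
      refine squeeze_zero_norm hb ?_
      have := ((continuous_semi (d := d) M).tendsto 0).const_mul R.toReal
      simpa using this
    have h2 : Tendsto (fun ψ : 𝓢(Rd d, ℂ) => D (φ 0) ψ) (𝓝 0) (𝓝 0) := by
      simpa using hD0.tendsto 0
    simpa using h1.add h2
  let h : 𝓢'(Rd d, ℂ) := ContinuousLinearMap.toPointwiseConvergenceCLM _ _ _ _ ⟨L, hLcont⟩
  have hh : ∀ ψ, h ψ = a ψ := fun ψ => rfl
  refine ⟨h, fun χ => ⟨fun ψ => hest χ ψ, ?_⟩⟩
  -- The quasi-norm need not be continuous under this weak limit, but lower semicontinuity suffices.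
  refine (modulationNorm_le_liminf g p q t (T := h - D χ) (S := fun n => D (φ n - χ))
    fun ψ => ?_).trans ?_
  · change Tendsto _ _ (𝓝 (h ψ - D χ ψ))
    rw [hh]
    refine ((ha ψ).sub_const (D χ ψ)).congr fun n => ?_
    rw [map_sub]; rfl
  · refine (liminf_le_liminf (Eventually.of_forall fun n => hdiff n χ)).trans (le_of_eq ?_)
    have := hlimε (X (f - (χ : 𝓢'(Rd d, ℂ)))) 1 ENNReal.one_ne_top
    simp only [one_mul] at this
    exact this.liminf_eq

end Extension

/-! ### Injectivity of the short-time Fourier transform -/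

section Injectivity

theorem exists_enorm_fourier_mul_seminorm_conjShift_le (g φ : 𝓢(Rd d, ℂ)) (k n : ℕ) :
    ∃ C : ℝ≥0, ∀ z : Rd d × Rd d,
      ‖𝓕 (fun t => φ t * g (t - z.1)) (-z.2)‖ₑ *
        ENNReal.ofReal (SchwartzMap.seminorm ℂ k n (conjShift g z.1 z.2))
        ≤ C * (bw z.1 ^ (-(d + 1 : ℝ)) * bw z.2 ^ (-(d + 1 : ℝ))) := by
  obtain ⟨C₁, N, h₁⟩ := exists_semi_conjShift_le g (k, n)
  obtain ⟨C₂, M, h₂⟩ := exists_fourier_shiftMul_le g (N + (d + 1) : ℝ)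
  refine ⟨C₂ * (semi M φ).toNNReal * C₁, fun z => ?_⟩
  have h3 := h₂ φ (-z.2) z.1
  have e : ⇑(shiftMul φ g z.1) = fun t => φ t * g (t - z.1) := by funext t; simp
  rw [SchwartzMap.fourier_coe, e, bw_neg] at h3
  have h4 : ENNReal.ofReal (SchwartzMap.seminorm ℂ k n (conjShift g z.1 z.2))
      ≤ C₁ * (bw z.1 ^ (N : ℝ) * bw z.2 ^ (N : ℝ)) := by
    refine (ENNReal.ofReal_le_ofReal ((seminorm_le_semi k n _).trans (h₁ z.1 z.2))).trans ?_
    rw [bw_rpow_eq_ofReal, bw_rpow_eq_ofReal, ENNReal.ofReal_mul (by positivity),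
      ENNReal.ofReal_mul (by positivity), ENNReal.ofReal_coe_nnreal, Real.rpow_natCast,
      Real.rpow_natCast]
  have e1 : ∀ x : Rd d, bw x ^ (-(N + (d + 1) : ℝ)) * bw x ^ (N : ℝ) = bw x ^ (-(d + 1 : ℝ)) :=
    fun x => by rw [← bw_rpow_add]; congr 1; ring
  refine (mul_le_mul' h3 h4).trans (le_of_eq ?_)
  rw [← e1 z.1, ← e1 z.2, ENNReal.ofReal]
  push_cast
  ring

/-- The inversion formula for the short-time Fourier transform: a tempered distribution is
determined by its short-time Fourier transform. -/
theorem eq_zero_of_stft_eq_zero {g : 𝓢(Rd d, ℂ)} (hg : g ≠ 0) {T : 𝓢'(Rd d, ℂ)}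
    (hT : ∀ x ξ, stft g T x ξ = 0) : T = 0 := by
  ext φ
  -- Integrating the conjugate time-frequency shifts of `g` against `W` reproduces `‖g‖² φ`, with
  -- `‖g‖` the `L²` norm. Since `T` passes under this integral, `‖g‖² T φ` is an integral of values
  -- of the short-time Fourier transform of `T`.
  set W : Rd d × Rd d → ℂ := fun z => 𝓕 (fun t => φ t * g (t - z.1)) (-z.2) with hW
  have hWc : Continuous W := by
    have h1 : Continuous fun z : Rd d × Rd d => (-z.2, z.1) :=
      continuous_snd.neg.prodMk continuous_fst
    have h2 := (continuous_fourier_mul_shift (isTemperedFunction_schwartz φ) g).comp h1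
    rw [Function.comp_def] at h2
    exact h2
  have hΨ := continuous_conjShift g
  have hint : ∀ k n, Integrable (fun z : Rd d × Rd d =>
      ‖W z‖ * SchwartzMap.seminorm ℂ k n (conjShift g z.1 z.2)) := by
    intro k n
    obtain ⟨C, hC⟩ := exists_enorm_fourier_mul_seminorm_conjShift_le g φ k n
    have h1 : Continuous fun z : Rd d × Rd d => SchwartzMap.seminorm ℂ k n (conjShift g z.1 z.2) :=
      ((schwartz_withSeminorms ℂ (Rd d) ℂ).continuous_seminorm (k, n)).comp hΨ
    refine ⟨(hWc.norm.mul h1).aestronglyMeasurable, ?_⟩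
    rw [HasFiniteIntegral]
    refine (lintegral_mono fun z => ?_).trans_lt (b := ∫⁻ z : Rd d × Rd d,
      C * (bw z.1 ^ (-(d + 1 : ℝ)) * bw z.2 ^ (-(d + 1 : ℝ)))) ?_
    · rw [enorm_mul, enorm_norm, Real.enorm_eq_ofReal (apply_nonneg _ _)]
      exact hC z
    · rw [lintegral_const_mul' _ _ ENNReal.coe_ne_top]
      exact ENNReal.mul_lt_top ENNReal.coe_lt_top
        (lintegral_bw_rpow_neg_prod_ne_top (by linarith) (by linarith)).lt_top
  obtain ⟨A, hA, hTA⟩ := exists_schwartz_integral hΨ hWc.aestronglyMeasurable hint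
  have hpt : ∀ t, A t = ((∫ t, ‖g t‖ ^ 2 : ℝ) : ℂ) * φ t := by
    intro t
    have hi : Integrable (fun z : Rd d × Rd d => W z * conjShift g z.1 z.2 t)
        (volume.prod volume) := by
      have hev : Continuous fun ψ : 𝓢(Rd d, ℂ) => ψ t :=
        map_continuous (TemperedDistribution.delta t)
      refine (hint 0 0).mono' (hWc.mul (hev.comp hΨ)).aestronglyMeasurable
        (Eventually.of_forall fun z => ?_)
      rw [norm_mul]
      exact mul_le_mul_of_nonneg_left (SchwartzMap.norm_le_seminorm ℂ _ t) (norm_nonneg _)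
    rw [hA, Measure.volume_eq_prod, integral_prod _ hi, ← integral_mul_conjS]
    have hin : ∀ x, ∫ ξ, W (x, ξ) * conjShift g x ξ t = (g (t - x) * conjS g (t - x)) * φ t := by
      intro x
      have e1 : φ t * g (t - x) = 𝓕⁻ (𝓕 (shiftMul φ g x) : 𝓢(Rd d, ℂ)) t := by
        rw [FourierTransform.fourierInv_fourier_eq, shiftMul_apply]
      rw [mul_comm (g (t - x)), mul_assoc, mul_comm (g (t - x)), e1, SchwartzMap.fourierInv_coe,
        Real.fourierInv_eq', ← integral_const_mul, ← integral_neg_eq_self]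
      refine integral_congr_ae (Eventually.of_forall fun ξ => ?_)
      have e : ⇑(shiftMul φ g x) = fun t => φ t * g (t - x) := by funext t; simp
      simp only [hW, neg_neg, SchwartzMap.fourier_coe, e, conjShift_apply, map_mul, conjS_apply,
        smul_eq_mul, character]
      rw [← Complex.exp_conj]
      simp only [map_mul, Complex.conj_ofReal, Complex.conj_I, inner_neg_left]
      push_cast
      ring_nf
    simp_rw [hin]
    rw [integral_mul_const]
    congr 1
    exact integral_sub_left_eq_self (fun u => g u * conjS g u) volume t
  have hA' : A = ((∫ t, ‖g t‖ ^ 2 : ℝ) : ℂ) • φ := by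
    ext t
    rw [hpt]
    rfl
  have h0 : T A = 0 := by
    have h1 : T A = ∫ z, W z * T (conjShift g z.1 z.2) :=
      hTA ⟨T.toLinearMap, map_continuous T⟩
    rw [h1]
    have h2 : ∀ z : Rd d × Rd d, T (conjShift g z.1 z.2) = 0 := fun z => hT z.1 z.2
    simp [h2]
  rw [hA', map_smul, smul_eq_mul, mul_eq_zero] at h0
  rcases h0 with h0 | h0
  · exact absurd (by exact_mod_cast h0) (integral_norm_sq_pos hg).ne'
  · exact h0

/-- Continuity of the short-time Fourier transform upgrades vanishing almost everywhere to vanishing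
everywhere, in `x` for almost every `ξ` and then in `ξ` for every `x`. -/
theorem eq_zero_of_modulationNorm_eq_zero {g : 𝓢(Rd d, ℂ)} (hg : g ≠ 0) {p q : ℝ≥0∞}
    (hp : p ≠ 0) (hq : q ≠ 0) {s : ℝ} {T : 𝓢'(Rd d, ℂ)} (hT : modulationNorm g p q s T = 0) :
    T = 0 := by
  have hc := continuous_stft g T
  have hce : Continuous fun z : Rd d × Rd d => ‖stft g T z.1 z.2‖ₑ := hc.enorm
  have hm := measurable_mixN_integrand hce.lowerSemicontinuous p s
  rw [modulationNorm_eq_mixN, mixN, eLpNorm_eq_zero_iff hm.aestronglyMeasurable hq] at hT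
  have h1 : ∀ᵐ ξ : Rd d, ∀ x, stft g T x ξ = 0 := by
    filter_upwards [hT] with ξ hξ
    have h2 : eLpNorm (fun x : Rd d => ‖stft g T x ξ‖ₑ) p volume = 0 := by
      rw [Pi.zero_apply, mul_eq_zero] at hξ
      exact hξ.resolve_left (weight_ne_zero s ξ)
    have hcx : Continuous fun x : Rd d => stft g T x ξ := by
      have h4 := hc.comp (by fun_prop : Continuous fun x : Rd d => (x, ξ))
      rw [Function.comp_def] at h4
      exact h4
    rw [eLpNorm_enorm, eLpNorm_eq_zero_iff hcx.aestronglyMeasurable hp] at h2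
    exact congrFun ((hcx.ae_eq_iff_eq volume continuous_zero).1 h2)
  refine eq_zero_of_stft_eq_zero hg fun x => ?_
  have hcξ : Continuous fun ξ : Rd d => stft g T x ξ := by
    have h4 := hc.comp (by fun_prop : Continuous fun ξ : Rd d => (x, ξ))
    rw [Function.comp_def] at h4
    exact h4
  have h3 : (fun ξ : Rd d => stft g T x ξ) =ᵐ[volume] 0 := h1.mono fun ξ h => h x
  exact congrFun ((hcξ.ae_eq_iff_eq volume continuous_zero).1 h3)

end Injectivity

/-! ### The multiplier theorem -/

section Multiplier

theorem amalgamNorm_eq_mixN (w : 𝓢(Rd d, ℂ)) (r : ℝ≥0∞) (γ : ℝ) (σ : Rd d → ℂ) :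
    amalgamNorm w r 0 ∞ γ σ = mixN r ∞ γ (tf w σ) := by
  simp only [amalgamNorm, mixN, weight_zero, one_mul]
  rfl

theorem isTemperedFunction_of_weight_mul_le {F : Rd d → ℂ} (hF : AEStronglyMeasurable F volume)
    {s : ℝ} {R : ℝ≥0∞} (hR : R ≠ ∞) (h : ∀ t, weight s t * ‖F t‖ₑ ≤ R) {U : Rd d → ℂ}
    (hU : IsTemperedFunction U) : IsTemperedFunction fun t => U t * F t := by
  have hUm := hU.aestronglyMeasurable
  obtain ⟨N, hN⟩ := hU
  have hb : ∀ t, ‖F t‖ ≤ R.toReal * (1 + ‖t‖) ^ ⌈|s|⌉₊ := by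
    intro t
    have h1 : ‖F t‖ₑ ≤ R * bw t ^ (⌈|s|⌉₊ : ℝ) := by
      calc ‖F t‖ₑ ≤ (weight s t * bw t ^ |s|) * ‖F t‖ₑ :=
            le_mul_of_one_le_left zero_le (one_le_weight_mul_bw s t)
        _ = (weight s t * ‖F t‖ₑ) * bw t ^ |s| := by ring
        _ ≤ _ := mul_le_mul' (h t) (bw_rpow_mono t (Nat.le_ceil _))
    rw [bw_rpow_eq_ofReal, Real.rpow_natCast, ← ENNReal.ofReal_toReal hR,
      ← ENNReal.ofReal_mul ENNReal.toReal_nonneg, ← ofReal_norm] at h1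
    exact (ENNReal.ofReal_le_ofReal_iff (by positivity)).1 h1
  refine ⟨N + ⌈|s|⌉₊, (hN.norm.const_mul R.toReal).mono' ?_ (Eventually.of_forall fun t => ?_)⟩
  · have hc : Continuous fun x : Rd d => (((1 + ‖x‖) ^ (N + ⌈|s|⌉₊))⁻¹ : ℝ) :=
      Continuous.inv₀ (by fun_prop) fun x => by positivity
    exact hc.aestronglyMeasurable.smul (hUm.mul hF)
  · have h0 : 0 < 1 + ‖t‖ := by positivity
    rw [norm_smul, norm_smul, norm_inv, norm_inv, norm_pow, norm_pow, Real.norm_of_nonneg h0.le,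
      norm_mul, pow_add]
    calc _ ≤ ((1 + ‖t‖) ^ N * (1 + ‖t‖) ^ ⌈|s|⌉₊)⁻¹ *
          (‖U t‖ * (R.toReal * (1 + ‖t‖) ^ ⌈|s|⌉₊)) :=
          mul_le_mul_of_nonneg_left (mul_le_mul_of_nonneg_left (hb t) (norm_nonneg _))
            (by positivity)
      _ = _ := by field_simp

theorem modulationNorm_schwartz_lt_top (g φ : 𝓢(Rd d, ℂ)) {p q : ℝ≥0∞} (hp : p ≠ 0) (hq : q ≠ 0)
    (s : ℝ) : modulationNorm g p q s (φ : 𝓢'(Rd d, ℂ)) < ∞ := by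
  rw [modulationNorm_eq_mixN_tf g p q s (represents_fourier_schwartz φ)]
  exact mixN_tf_schwartz_lt_top _ _ hp hq s

theorem integrable_pow_mul_norm_mul_schwartz {σ : Rd d → ℂ} (hσ : IsTemperedFunction σ)
    (Φ : 𝓢(Rd d, ℂ)) (N : ℕ) : Integrable fun t => (1 + ‖t‖) ^ N * ‖σ t * Φ t‖ := by
  have hm := hσ.aestronglyMeasurable
  obtain ⟨L, hL⟩ := hσ
  refine (hL.norm.const_mul (2 ^ (N + L) * semi (N + L, 0) Φ)).mono' ?_
    (Eventually.of_forall fun t => ?_)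
  · have hc : Continuous fun x : Rd d => ((1 + ‖x‖) ^ N : ℝ) := by fun_prop
    exact hc.aestronglyMeasurable.mul (hm.mul Φ.continuous.aestronglyMeasurable).norm
  · have h1 := norm_le_of_semi Φ (N + L) t
    have h0 : 0 < 1 + ‖t‖ := by positivity
    rw [norm_mul, norm_norm, norm_mul, norm_pow, norm_smul, norm_inv, norm_pow,
      Real.norm_of_nonneg h0.le]
    calc _ = ((1 + ‖t‖) ^ (N + L) * ‖Φ t‖) * (((1 + ‖t‖) ^ L)⁻¹ * ‖σ t‖) := by
          rw [pow_add]; field_simp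
      _ ≤ _ := mul_le_mul_of_nonneg_right h1 (by positivity)

/-- The function `σ φ̂` is rapidly decreasing in the integral sense and has finite quasi-norm for
`min 1 p`, `min 1 q`, so mollification approximates it. -/
theorem multiplierDist_mem_modulationSpace {g w : 𝓢(Rd d, ℂ)} (hg : g ≠ 0) (hw : w ≠ 0)
    {p q : ℝ≥0∞} (hp : p ≠ 0) (hq : q ≠ 0) (s : ℝ) {γ : ℝ} {σ : Rd d → ℂ}
    (hσ : IsTemperedFunction σ) (hfin : mixN (min 1 p) ∞ γ (tf w σ) ≠ ∞) (φ : 𝓢(Rd d, ℂ)) :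
    multiplierDist hσ φ ∈ modulationSpace g p q s := by
  intro ε hε
  set G := conjS (𝓕 g : 𝓢(Rd d, ℂ)) with hG
  have hG0 : G ≠ 0 := conjS_fourier_ne_zero hg
  have hp1 : min 1 p ≠ 0 := by simp [hp]
  have hq1 : min 1 q ≠ 0 := by simp [hq]
  set U : Rd d → ℂ := fun t => σ t * (𝓕 φ : 𝓢(Rd d, ℂ)) t with hU
  -- A Schwartz function lies in every modulation space, so the source weight can be taken `s - γ`
  -- to land on `s`.
  obtain ⟨C, hC⟩ := exists_mixN_tf_mul_le hG0 hw hp1 hq1 (s - γ) γ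
  have hmin : min 1 (min 1 p) = min 1 p := by simp
  have hUfin : mixN (min 1 p) (min 1 q) s (tf G U) ≠ ∞ := by
    have h1 := hC σ hσ (by rwa [hmin]) (𝓕 φ : 𝓢(Rd d, ℂ))
    rw [hmin, sub_add_cancel] at h1
    refine ne_top_of_le_ne_top ?_ h1
    exact ENNReal.mul_ne_top (ENNReal.mul_ne_top ENNReal.coe_ne_top hfin)
      (mixN_tf_schwartz_lt_top _ _ hp1 hq1 _).ne
  obtain ⟨A, hA⟩ := exists_schwartz_mixN_sub_lt hG0 hp hq (U := U)
    (hσ.mul_schwartz _).aestronglyMeasurable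
    (integrable_pow_mul_norm_mul_schwartz hσ (𝓕 φ : 𝓢(Rd d, ℂ))) hUfin hε
  refine ⟨(𝓕⁻ A : 𝓢(Rd d, ℂ)), ?_⟩
  have h1 : Represents (𝓕 (multiplierDist hσ φ - ((𝓕⁻ A : 𝓢(Rd d, ℂ)) : 𝓢'(Rd d, ℂ))))
      fun t => U t - A t := by
    have e : 𝓕 (multiplierDist hσ φ - ((𝓕⁻ A : 𝓢(Rd d, ℂ)) : 𝓢'(Rd d, ℂ)))
        = 𝓕 (multiplierDist hσ φ) - 𝓕 ((𝓕⁻ A : 𝓢(Rd d, ℂ)) : 𝓢'(Rd d, ℂ)) :=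
      map_sub (FourierTransform.fourierCLM ℂ 𝓢'(Rd d, ℂ)) _ _
    rw [e]
    have h2 := represents_fourier_schwartz (𝓕⁻ A : 𝓢(Rd d, ℂ))
    rw [FourierTransform.fourier_fourierInv_eq] at h2
    exact (represents_fourier_multiplierDist hσ φ).sub h2
  rw [modulationNorm_eq_mixN_tf g p q s h1]
  exact hA

theorem exists_pos_le_mul_lt {R ε : ℝ≥0∞} (hR : R ≠ ∞) (hε : 0 < ε) :
    ∃ η : ℝ≥0∞, 0 < η ∧ η ≤ ε ∧ R * η < ε := by
  obtain ⟨δ, hδ0, hδ⟩ := exists_between hε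
  have hR' : R + 1 ≠ ∞ := ENNReal.add_ne_top.2 ⟨hR, ENNReal.one_ne_top⟩
  refine ⟨δ / (R + 1), ENNReal.div_pos hδ0.ne' hR', ?_, lt_of_le_of_lt ?_ hδ⟩
  · refine le_trans ?_ hδ.le
    exact ENNReal.div_le_of_le_mul (le_mul_of_one_le_right zero_le (by simp))
  · calc R * (δ / (R + 1)) ≤ (R + 1) * (δ / (R + 1)) := mul_le_mul' le_self_add le_rfl
      _ = δ := ENNReal.mul_div_cancel (by simp) hR'

theorem exists_schwartz_approx_smul_add_smul {g : 𝓢(Rd d, ℂ)} {p q : ℝ≥0∞} {s : ℝ}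
    {f₁ f₂ : 𝓢'(Rd d, ℂ)} (h₁ : f₁ ∈ modulationSpace g p q s) (h₂ : f₂ ∈ modulationSpace g p q s)
    (a b : ℂ) {ε : ℝ≥0∞} (hε : 0 < ε) :
    ∃ φ₁ φ₂ : 𝓢(Rd d, ℂ), modulationNorm g p q s (f₁ - (φ₁ : 𝓢'(Rd d, ℂ))) ≤ ε ∧
      modulationNorm g p q s (f₂ - (φ₂ : 𝓢'(Rd d, ℂ))) ≤ ε ∧
      modulationNorm g p q s
        (a • f₁ + b • f₂ - ((a • φ₁ + b • φ₂ : 𝓢(Rd d, ℂ)) : 𝓢'(Rd d, ℂ))) < ε := by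
  obtain ⟨K, hK, -⟩ := exists_modulationNorm_sub_le g p q s
  have hRtop : K * (‖a‖ₑ + ‖b‖ₑ) ≠ ∞ :=
    ENNReal.mul_ne_top ENNReal.coe_ne_top (ENNReal.add_ne_top.2 ⟨enorm_ne_top, enorm_ne_top⟩)
  obtain ⟨η, hη0, hηε⟩ := exists_pos_le_mul_lt hRtop hε
  obtain ⟨φ₁, hφ₁⟩ := h₁ η hη0
  obtain ⟨φ₂, hφ₂⟩ := h₂ η hη0
  refine ⟨φ₁, φ₂, hφ₁.le.trans hηε.1, hφ₂.le.trans hηε.1, lt_of_le_of_lt ?_ hηε.2⟩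
  have e : a • f₁ + b • f₂ - ((a • φ₁ + b • φ₂ : 𝓢(Rd d, ℂ)) : 𝓢'(Rd d, ℂ))
      = a • (f₁ - (φ₁ : 𝓢'(Rd d, ℂ))) + b • (f₂ - (φ₂ : 𝓢'(Rd d, ℂ))) := by
    rw [map_add, map_smul, map_smul, smul_sub, smul_sub]; abel
  rw [e]
  refine (hK _ _).trans ?_
  rw [modulationNorm_smul, modulationNorm_smul]
  calc _ ≤ K * (‖a‖ₑ * η + ‖b‖ₑ * η) :=
        mul_le_mul' le_rfl (add_le_add (mul_le_mul' le_rfl hφ₁.le) (mul_le_mul' le_rfl hφ₂.le))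
    _ = (K * (‖a‖ₑ + ‖b‖ₑ)) * η := by ring

end Multiplier

/-! ### Convergence of approximants as distributions, and the extended operator. -/

section MainTheorem

theorem enorm_eq_zero_of_forall_le_mul {x c : ℝ≥0∞} (hc : c ≠ ∞)
    (h : ∀ ε : ℝ≥0∞, 0 < ε → x ≤ c * ε) : x = 0 := by
  refine nonpos_iff_eq_zero.1 (le_of_forall_pos_le_add fun ε hε => ?_)
  obtain ⟨η, hη, -, hlt⟩ := exists_pos_le_mul_lt hc hε
  rw [zero_add]
  exact (h η hη).trans hlt.le

/-- Tempered distributions whose Fourier transform is a function are controlled by their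
modulation quasi-norm. -/
theorem exists_enorm_apply_le {g : 𝓢(Rd d, ℂ)} (hg : g ≠ 0) {p q : ℝ≥0∞} (hp : p ≠ 0)
    (hq : q ≠ 0) (s : ℝ) :
    ∃ (C : ℝ≥0) (M : ℕ × ℕ), ∀ (T : 𝓢'(Rd d, ℂ)) (U : Rd d → ℂ), Represents (𝓕 T) U →
      ∀ ψ, ‖T ψ‖ₑ ≤ C * ENNReal.ofReal (semi M ψ) * modulationNorm g p q s T := by
  obtain ⟨C, M, h⟩ := exists_enorm_integral_mul_le (conjS_fourier_ne_zero hg) hp hq s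
  obtain ⟨C', M', h'⟩ := exists_semi_fourierInv_le (d := d) M
  refine ⟨C * C', M', fun T U hT ψ => ?_⟩
  have h1 : T ψ = 𝓕 T (𝓕⁻ ψ : 𝓢(Rd d, ℂ)) := by
    rw [TemperedDistribution.fourier_apply, FourierTransform.fourier_fourierInv_eq]
  rw [h1, hT.2, modulationNorm_eq_mixN_tf g p q s hT]
  refine (h U hT.1 _).trans (mul_le_mul' ?_ le_rfl)
  rw [ENNReal.coe_mul, mul_assoc]
  refine mul_le_mul' le_rfl ((ENNReal.ofReal_le_ofReal (h' ψ)).trans (le_of_eq ?_))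
  rw [ENNReal.ofReal_mul (by positivity), ENNReal.ofReal_coe_nnreal]

theorem schwartz_mem_modulationSpace (g φ : 𝓢(Rd d, ℂ)) (p q : ℝ≥0∞) (s : ℝ) :
    (φ : 𝓢'(Rd d, ℂ)) ∈ modulationSpace g p q s := fun ε hε =>
  ⟨φ, by rwa [sub_self, modulationNorm_zero]⟩

/-- An element of the modulation space is approximated, as a distribution, by the same Schwartz
functions as in the modulation quasi-norm. -/
theorem exists_enorm_sub_apply_le {g : 𝓢(Rd d, ℂ)} (hg : g ≠ 0) {p q : ℝ≥0∞} (hp : p ≠ 0)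
    (hq : q ≠ 0) (s : ℝ) :
    ∃ (C : ℝ≥0) (M : ℕ × ℕ), ∀ f ∈ modulationSpace g p q s, ∀ φ ψ : 𝓢(Rd d, ℂ),
      ‖f ψ - (φ : 𝓢'(Rd d, ℂ)) ψ‖ₑ ≤ C * ENNReal.ofReal (semi M ψ) *
        modulationNorm g p q s (f - (φ : 𝓢'(Rd d, ℂ))) := by
  obtain ⟨C, M, hP⟩ := exists_enorm_apply_le hg hp hq s
  obtain ⟨K, -, hK⟩ := exists_modulationNorm_sub_le g p q s
  refine ⟨C * K, M, fun f hf => ?_⟩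
  -- The bound `hP` concerns distributions whose Fourier transform is a function, which is not known
  -- of `f`. So the identity is extended by continuity to some `h` satisfying the estimate, and `h -
  -- f` has quasi-norm zero, whence `h = f`.
  obtain ⟨h, hh⟩ := exists_extension (t := s) (B := 1) (C := C) (K := K) (M := M)
    (D := (toTemperedDistributionCLM (Rd d) ℂ volume).toLinearMap)
    (fun φ => by simp) (fun φ ψ => hP _ _ (represents_fourier_schwartz φ) ψ) hK hf
  have hf' : h = f := by
    rw [← sub_eq_zero]
    refine eq_zero_of_modulationNorm_eq_zero hg hp hq (s := s)
      (enorm_eq_zero_of_forall_le_mul (c := K * (K + 1)) ?_ fun ε hε => ?_)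
    · exact ENNReal.mul_ne_top ENNReal.coe_ne_top
        (ENNReal.add_ne_top.2 ⟨ENNReal.coe_ne_top, ENNReal.one_ne_top⟩)
    · obtain ⟨φ, hφ⟩ := hf ε hε
      have e : h - f = (h - (φ : 𝓢'(Rd d, ℂ))) - (f - (φ : 𝓢'(Rd d, ℂ))) := by abel
      rw [e]
      refine (hK _ _).trans ?_
      rw [mul_assoc]
      refine mul_le_mul' le_rfl ?_
      rw [add_mul, one_mul]
      refine add_le_add (((hh φ).2).trans ?_) hφ.le
      rw [ENNReal.coe_one, one_mul]
      exact mul_le_mul' le_rfl hφ.le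
  subst hf'
  intro φ ψ
  refine ((hh φ).1 ψ).trans (le_of_eq ?_)
  push_cast
  ring

/-- Dominated convergence for functions bounded by a fixed power weight. -/
theorem tendsto_integral_of_weight_mul_le {Φ : ℕ → 𝓢(Rd d, ℂ)} {F : Rd d → ℂ} {s : ℝ}
    {R : ℝ≥0∞} (hR : R ≠ ∞) (hb : ∀ n t, weight s t * ‖Φ n t‖ₑ ≤ R)
    (hlim : ∀ t, Tendsto (fun n => Φ n t) atTop (𝓝 (F t))) {U : Rd d → ℂ}
    (hU : IsTemperedFunction U) :
    (IsTemperedFunction fun t => U t * F t) ∧ ∀ ψ : 𝓢(Rd d, ℂ),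
      Tendsto (fun n => ∫ t, ψ t * (U t * Φ n t)) atTop (𝓝 (∫ t, ψ t * (U t * F t))) := by
  have hFm : AEStronglyMeasurable F volume :=
    aestronglyMeasurable_of_tendsto_ae atTop
      (fun n => (Φ n).continuous.aestronglyMeasurable) (Eventually.of_forall hlim)
  have hbF : ∀ t, weight s t * ‖F t‖ₑ ≤ R := fun t =>
    le_of_tendsto' (ENNReal.Tendsto.const_mul (hlim t).enorm (Or.inr (weight_ne_top s t)))
      fun n => hb n t
  refine ⟨isTemperedFunction_of_weight_mul_le hFm hR hbF hU, fun ψ => ?_⟩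
  -- `R ⟨t⟩^{-s}` dominates the approximants.
  set W : Rd d → ℂ := fun t => (((1 + ‖t‖ ^ 2) ^ (-s / 2) : ℝ) : ℂ) with hW
  have hWc : Continuous W := by
    have h1 : Continuous fun t : Rd d => ((1 + ‖t‖ ^ 2) ^ (-s / 2) : ℝ) :=
      Continuous.rpow_const (by fun_prop) fun t => Or.inl (by positivity)
    exact Complex.continuous_ofReal.comp h1
  have hWn : ∀ t, ‖W t‖ = (1 + ‖t‖ ^ 2) ^ (-s / 2) := fun t => by
    rw [hW, Complex.norm_real, Real.norm_of_nonneg (by positivity)]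
  have hWw : ∀ t, ‖W t‖ₑ = weight (-s) t := fun t => by
    rw [← ofReal_norm, hWn]; rfl
  have hww : ∀ t : Rd d, weight s t * weight (-s) t = 1 := fun t => by
    rw [← weight_add, add_neg_cancel, weight_zero]
  have hWt := isTemperedFunction_of_weight_mul_le hWc.aestronglyMeasurable ENNReal.one_ne_top
    (s := s) (fun t => by rw [hWw, hww]) hU
  have hΦ : ∀ n t, ‖Φ n t‖ ≤ R.toReal * ‖W t‖ := by
    intro n t
    have h1 : ‖Φ n t‖ₑ ≤ R * ‖W t‖ₑ := by
      calc ‖Φ n t‖ₑ = (weight s t * ‖Φ n t‖ₑ) * weight (-s) t := by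
            rw [mul_right_comm, hww, one_mul]
        _ ≤ _ := by rw [hWw]; exact mul_le_mul' (hb n t) le_rfl
    rw [← ENNReal.ofReal_toReal hR, ← ofReal_norm, ← ofReal_norm,
      ← ENNReal.ofReal_mul ENNReal.toReal_nonneg] at h1
    exact (ENNReal.ofReal_le_ofReal_iff (by positivity)).1 h1
  refine tendsto_integral_of_dominated_convergence
    (fun t => R.toReal * ‖(U t * W t) * ψ t‖) (fun n => ?_)
    ((hWt.integrable_mul ψ).norm.const_mul _) (fun n => Eventually.of_forall fun t => ?_)
    (Eventually.of_forall fun t => ((hlim t).const_mul (U t)).const_mul (ψ t))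
  · exact ψ.continuous.aestronglyMeasurable.mul
      (hU.aestronglyMeasurable.mul (Φ n).continuous.aestronglyMeasurable)
  · rw [norm_mul, norm_mul, norm_mul, norm_mul]
    calc _ = (‖ψ t‖ * ‖U t‖) * ‖Φ n t‖ := by ring
      _ ≤ (‖ψ t‖ * ‖U t‖) * (R.toReal * ‖W t‖) :=
          mul_le_mul_of_nonneg_left (hΦ n t) (by positivity)
      _ = _ := by ring

/-- For `p ≤ 1`, the Fourier transforms of Schwartz functions converging in the modulation space
converge pointwise, with a uniform weighted bound. -/
theorem exists_tendsto_fourier {g : 𝓢(Rd d, ℂ)} (hg : g ≠ 0) {p q : ℝ≥0∞} (hp : p ≠ 0)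
    (hp1 : p ≤ 1) (hq : q ≠ 0) {s : ℝ} {f : 𝓢'(Rd d, ℂ)} {φ : ℕ → 𝓢(Rd d, ℂ)}
    (hφ : ∀ n, modulationNorm g p q s (f - (φ n : 𝓢'(Rd d, ℂ))) ≤ ((n : ℝ≥0∞) + 1)⁻¹) :
    ∃ (F : Rd d → ℂ) (R : ℝ≥0∞), R ≠ ∞ ∧
      (∀ n t, weight s t * ‖(𝓕 (φ n) : 𝓢(Rd d, ℂ)) t‖ₑ ≤ R) ∧
      ∀ t, Tendsto (fun n => (𝓕 (φ n) : 𝓢(Rd d, ℂ)) t) atTop (𝓝 (F t)) := by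
  obtain ⟨C, hC⟩ := exists_weight_mul_enorm_le (conjS_fourier_ne_zero hg) hp hp1 hq s
  obtain ⟨K, hKa, hK⟩ := exists_modulationNorm_sub_le g p q s
  have hC' : ∀ (χ : 𝓢(Rd d, ℂ)) t, weight s t * ‖(𝓕 χ : 𝓢(Rd d, ℂ)) t‖ₑ
      ≤ C * modulationNorm g p q s (χ : 𝓢'(Rd d, ℂ)) := fun χ t => by
    rw [modulationNorm_eq_mixN_tf g p q s (represents_fourier_schwartz χ)]
    exact hC _ t
  set ε : ℕ → ℝ≥0∞ := fun n => ((n : ℝ≥0∞) + 1)⁻¹ with hε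
  have hεa : ∀ {n N : ℕ}, N ≤ n → ε n ≤ ε N := fun {n N} h => by
    simp only [hε]
    gcongr
  have hεlim : Tendsto ε atTop (𝓝 0) := tendsto_inv_natCast_add_one
  have hcauchy : ∀ t, ∃ a : ℂ, Tendsto (fun n => (𝓕 (φ n) : 𝓢(Rd d, ℂ)) t) atTop (𝓝 a) := by
    intro t
    refine cauchySeq_tendsto_of_complete (EMetric.cauchySeq_iff_le_tendsto_0.2
      ⟨fun N => (weight s t)⁻¹ * (C * (K * (ε N + ε N))), fun n m N hn hm => ?_, ?_⟩)
    · rw [edist_eq_enorm_sub]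
      refine le_inv_mul_of_mul_le (weight_ne_zero s t) (weight_ne_top s t) ?_
      have e : (𝓕 (φ n) : 𝓢(Rd d, ℂ)) t - (𝓕 (φ m) : 𝓢(Rd d, ℂ)) t
          = (𝓕 (φ n - φ m) : 𝓢(Rd d, ℂ)) t := by
        have h1 : (𝓕 (φ n - φ m) : 𝓢(Rd d, ℂ)) = 𝓕 (φ n) - 𝓕 (φ m) :=
          map_sub (FourierTransform.fourierCLM ℂ 𝓢(Rd d, ℂ)) _ _
        rw [h1]; rfl
      rw [e]
      refine (hC' _ t).trans (mul_le_mul' le_rfl ?_)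
      have e2 : ((φ n - φ m : 𝓢(Rd d, ℂ)) : 𝓢'(Rd d, ℂ))
          = (f - (φ m : 𝓢'(Rd d, ℂ))) - (f - (φ n : 𝓢'(Rd d, ℂ))) := by
        rw [map_sub]; abel
      rw [e2]
      exact (hK _ _).trans (mul_le_mul' le_rfl
        (add_le_add ((hφ m).trans (hεa hm)) ((hφ n).trans (hεa hn))))
    · have h1 := ENNReal.Tendsto.const_mul (a := (weight s t)⁻¹)
        (ENNReal.Tendsto.const_mul (a := (C : ℝ≥0∞)) (ENNReal.Tendsto.const_mul (a := (K : ℝ≥0∞))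
          (hεlim.add hεlim) (Or.inr ENNReal.coe_ne_top)) (Or.inr ENNReal.coe_ne_top))
          (Or.inr (ENNReal.inv_ne_top.2 (weight_ne_zero s t)))
      simpa using h1
  choose F hF using hcauchy
  have hε1 : ∀ n, ε n ≤ 1 := fun n => by simp [hε]
  refine ⟨F, C * (K * (K * (modulationNorm g p q s (φ 0 : 𝓢'(Rd d, ℂ)) + 1) + 1)), ?_,
    fun n t => (hC' _ t).trans (mul_le_mul' le_rfl ?_), hF⟩
  · have h1 := (modulationNorm_schwartz_lt_top g (φ 0) hp hq s).ne
    refine ENNReal.mul_ne_top ENNReal.coe_ne_top (ENNReal.mul_ne_top ENNReal.coe_ne_top ?_)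
    refine ENNReal.add_ne_top.2 ⟨ENNReal.mul_ne_top ENNReal.coe_ne_top ?_, ENNReal.one_ne_top⟩
    exact ENNReal.add_ne_top.2 ⟨h1, ENNReal.one_ne_top⟩
  · have e : (φ n : 𝓢'(Rd d, ℂ)) = ((φ 0 : 𝓢'(Rd d, ℂ)) + (f - (φ 0 : 𝓢'(Rd d, ℂ))))
        - (f - (φ n : 𝓢'(Rd d, ℂ))) := by abel
    rw [e]
    refine (hK _ _).trans (mul_le_mul' le_rfl (add_le_add ?_ ((hφ n).trans (hε1 n))))
    exact (hKa _ _).trans (mul_le_mul' le_rfl (add_le_add le_rfl ((hφ 0).trans (hε1 0))))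

/-- Fourier multipliers with symbols in `W(𝓕 L^r, L^∞_γ)`, `r = min 1 p`, are bounded from
`M^{p,q}_s` to `M^{p,q}_{s+γ}`, and act by multiplication on the Fourier side if `p ≤ 1`. -/
theorem exists_isBoundedExtension {g w : 𝓢(Rd d, ℂ)} (hg : g ≠ 0) (hw : w ≠ 0) {p q : ℝ≥0∞}
    (hp : p ≠ 0) (hq : q ≠ 0) (s γ : ℝ) :
    ∃ C : ℝ≥0, ∀ σ : Rd d → ℂ, MemAmalgam w (min 1 p) 0 ∞ γ σ →
      ∃ H : 𝓢'(Rd d, ℂ) → 𝓢'(Rd d, ℂ),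
        IsBoundedExtension g p q s (s + γ) σ (C * amalgamNorm w (min 1 p) 0 ∞ γ σ) H ∧
        (p ≤ 1 → ∀ f ∈ modulationSpace g p q s, IsMultiplierImage σ f (H f)) := by
  obtain ⟨C₀, hC₀⟩ := exists_mixN_tf_mul_le (conjS_fourier_ne_zero hg) hw hp hq s γ
  obtain ⟨K, hKa, hK⟩ := exists_modulationNorm_sub_le g p q s
  obtain ⟨K', hKa', hK'⟩ := exists_modulationNorm_sub_le g p q (s + γ)
  obtain ⟨P, M, hP⟩ := exists_enorm_apply_le hg hp hq (s + γ)
  obtain ⟨P₁, M₁, hP₁⟩ := exists_enorm_sub_apply_le hg hp hq s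
  -- `C₀` is the constant on Schwartz functions; `K` and `K'` come from the quasi-triangle
  -- inequality in the source and in the target when passing to the limit.
  refine ⟨K' * K * C₀, fun σ ⟨hσ, hfin⟩ => ?_⟩
  rw [amalgamNorm_eq_mixN] at hfin ⊢
  set A := mixN (min 1 p) ∞ γ (tf w σ) with hA
  set B : ℝ≥0 := C₀ * A.toNNReal with hB
  have hBA : (B : ℝ≥0∞) = C₀ * A := by rw [hB, ENNReal.coe_mul, ENNReal.coe_toNNReal hfin.ne]
  set D := multiplierDist hσ with hD
  have hY : ∀ φ : 𝓢(Rd d, ℂ), modulationNorm g p q (s + γ) (D φ)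
      ≤ B * modulationNorm g p q s (φ : 𝓢'(Rd d, ℂ)) := fun φ => by
    rw [modulationNorm_eq_mixN_tf g p q _ (represents_fourier_multiplierDist hσ φ),
      modulationNorm_eq_mixN_tf g p q s (represents_fourier_schwartz φ), hBA]
    exact hC₀ σ hσ hfin.ne _
  have hPD : ∀ φ ψ, ‖D φ ψ‖ₑ ≤ P * ENNReal.ofReal (semi M ψ) *
      modulationNorm g p q (s + γ) (D φ) := fun φ ψ =>
    hP _ _ (represents_fourier_multiplierDist hσ φ) ψ
  classical
  have hex := fun (f : 𝓢'(Rd d, ℂ)) (hf : f ∈ modulationSpace g p q s) =>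
    exists_extension hY hPD hK hf
  set H : 𝓢'(Rd d, ℂ) → 𝓢'(Rd d, ℂ) := fun f =>
    if hf : f ∈ modulationSpace g p q s then (hex f hf).choose else 0 with hH
  have hHD : ∀ f ∈ modulationSpace g p q s, ∀ φ : 𝓢(Rd d, ℂ),
      (∀ ψ, ‖H f ψ - D φ ψ‖ₑ ≤ P * ENNReal.ofReal (semi M ψ) *
        (B * (K * modulationNorm g p q s (f - (φ : 𝓢'(Rd d, ℂ)))))) ∧
      modulationNorm g p q (s + γ) (H f - D φ)
        ≤ B * (K * modulationNorm g p q s (f - (φ : 𝓢'(Rd d, ℂ)))) := by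
    intro f hf
    have e : H f = (hex f hf).choose := by simp only [hH, dif_pos hf]
    rw [e]
    exact (hex f hf).choose_spec
  have hBK : ∀ ψ : 𝓢(Rd d, ℂ), P * ENNReal.ofReal (semi M ψ) * (B * K) ≠ ∞ := fun ψ =>
    ENNReal.mul_ne_top (ENNReal.mul_ne_top ENNReal.coe_ne_top ENNReal.ofReal_ne_top)
      (ENNReal.mul_ne_top ENNReal.coe_ne_top ENNReal.coe_ne_top)
  refine ⟨H, ⟨fun φ => ?_, fun f hf ε hε => ?_, fun f₁ h₁ f₂ h₂ a b => ?_, fun f hf => ?_⟩,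
    fun hp1 f hf => ?_⟩
  · have e : H (φ : 𝓢'(Rd d, ℂ)) = D φ := by
      ext ψ
      have h1 := (hHD _ (schwartz_mem_modulationSpace g φ p q s) φ).1 ψ
      rw [sub_self, modulationNorm_zero, mul_zero, mul_zero, mul_zero, nonpos_iff_eq_zero,
        enorm_eq_zero, sub_eq_zero] at h1
      exact h1
    rw [e]
    exact represents_multiplierDist hσ φ
  · have hRtop : (K' * (B * K + 1) : ℝ≥0∞) ≠ ∞ := ENNReal.mul_ne_top ENNReal.coe_ne_top
      (ENNReal.add_ne_top.2 ⟨ENNReal.mul_ne_top ENNReal.coe_ne_top ENNReal.coe_ne_top,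
        ENNReal.one_ne_top⟩)
    obtain ⟨η, hη0, -, hη⟩ := exists_pos_le_mul_lt hRtop hε
    obtain ⟨φ, hφ⟩ := hf η hη0
    obtain ⟨χ, hχ⟩ := multiplierDist_mem_modulationSpace hg hw hp hq (s + γ) hσ hfin.ne φ η hη0
    refine ⟨χ, lt_of_le_of_lt ?_ hη⟩
    have e : H f - (χ : 𝓢'(Rd d, ℂ)) = (H f - D φ) + (D φ - (χ : 𝓢'(Rd d, ℂ))) := by abel
    rw [e]
    refine (hKa' _ _).trans ?_
    rw [mul_assoc, add_mul, one_mul, mul_assoc]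
    refine mul_le_mul' le_rfl (add_le_add (((hHD f hf φ).2).trans ?_) hχ.le)
    exact mul_le_mul' le_rfl (mul_le_mul' le_rfl hφ.le)
  · have hmem : a • f₁ + b • f₂ ∈ modulationSpace g p q s := fun ε hε => by
      obtain ⟨φ₁, φ₂, -, -, h⟩ := exists_schwartz_approx_smul_add_smul h₁ h₂ a b hε
      exact ⟨_, h⟩
    refine ⟨hmem, ?_⟩
    ext ψ
    -- The values of `H` were chosen one by one, but `hHD` pins each of them down through its
    -- Schwartz approximants; compare with the linear map `D` on `φ₁`, `φ₂` and on their
    -- combination.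
    rw [← sub_eq_zero, ← enorm_eq_zero]
    refine enorm_eq_zero_of_forall_le_mul
      (c := P * ENNReal.ofReal (semi M ψ) * (B * K) * (1 + ‖a‖ₑ + ‖b‖ₑ)) ?_ fun ε hε => ?_
    · exact ENNReal.mul_ne_top (hBK ψ) (ENNReal.add_ne_top.2
        ⟨ENNReal.add_ne_top.2 ⟨ENNReal.one_ne_top, enorm_ne_top⟩, enorm_ne_top⟩)
    obtain ⟨φ₁, φ₂, hφ₁, hφ₂, hφ⟩ := exists_schwartz_approx_smul_add_smul h₁ h₂ a b hε
    have hest : ∀ (f : 𝓢'(Rd d, ℂ)) (_ : f ∈ modulationSpace g p q s) (φ : 𝓢(Rd d, ℂ)),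
        modulationNorm g p q s (f - (φ : 𝓢'(Rd d, ℂ))) ≤ ε →
        ‖H f ψ - D φ ψ‖ₑ ≤ P * ENNReal.ofReal (semi M ψ) * (B * K) * ε := by
      intro f hf φ h
      refine ((hHD f hf φ).1 ψ).trans ?_
      rw [mul_assoc _ (B * K : ℝ≥0∞), mul_assoc (B : ℝ≥0∞)]
      exact mul_le_mul' le_rfl (mul_le_mul' le_rfl (mul_le_mul' le_rfl h))
    have e : H (a • f₁ + b • f₂) ψ - (a • H f₁ + b • H f₂) ψ
        = (H (a • f₁ + b • f₂) ψ - D (a • φ₁ + b • φ₂) ψ)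
          - (a * (H f₁ ψ - D φ₁ ψ) + b * (H f₂ ψ - D φ₂ ψ)) := by
      rw [map_add, map_smul, map_smul]
      change H (a • f₁ + b • f₂) ψ - (a * H f₁ ψ + b * H f₂ ψ)
        = (H (a • f₁ + b • f₂) ψ - (a * D φ₁ ψ + b * D φ₂ ψ)) - _
      ring
    rw [e]
    refine enorm_sub_le.trans ?_
    have h3 := hest _ hmem _ hφ.le
    have h4 := hest _ h₁ _ hφ₁
    have h5 := hest _ h₂ _ hφ₂
    set Q : ℝ≥0∞ := P * ENNReal.ofReal (semi M ψ) * (B * K) with hQ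
    calc _ ≤ Q * ε + (‖a‖ₑ * (Q * ε) + ‖b‖ₑ * (Q * ε)) := by
          refine add_le_add h3 ((enorm_add_le _ _).trans ?_)
          rw [enorm_mul, enorm_mul]
          exact add_le_add (mul_le_mul' le_rfl h4) (mul_le_mul' le_rfl h5)
      _ = _ := by ring
  · have hR : (2 * (K' * (B * K)) : ℝ≥0∞) ≠ ∞ :=
      ENNReal.mul_ne_top ENNReal.ofNat_ne_top (ENNReal.mul_ne_top ENNReal.coe_ne_top
        (ENNReal.mul_ne_top ENNReal.coe_ne_top ENNReal.coe_ne_top))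
    refine le_of_forall_pos_le_add fun ε hε => ?_
    obtain ⟨η, hη0, -, hη⟩ := exists_pos_le_mul_lt hR hε
    obtain ⟨φ, hφ⟩ := hf η hη0
    have h1 : modulationNorm g p q s (φ : 𝓢'(Rd d, ℂ)) ≤ K * (modulationNorm g p q s f + η) := by
      have e : (φ : 𝓢'(Rd d, ℂ)) = f - (f - (φ : 𝓢'(Rd d, ℂ))) := by abel
      rw [e]
      refine (hK _ _).trans (mul_le_mul' le_rfl (add_le_add le_rfl ?_))
      exact hφ.le
    have e : H f = (H f - D φ) + D φ := by abel
    calc modulationNorm g p q (s + γ) (H f)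
        ≤ K' * (modulationNorm g p q (s + γ) (H f - D φ) + modulationNorm g p q (s + γ) (D φ)) := by
          conv_lhs => rw [e]
          exact hKa' _ _
      _ ≤ K' * (B * (K * η) + B * (K * (modulationNorm g p q s f + η))) := by
          refine mul_le_mul' le_rfl (add_le_add (((hHD f hf φ).2).trans ?_) ((hY φ).trans ?_))
          · exact mul_le_mul' le_rfl (mul_le_mul' le_rfl hφ.le)
          · exact mul_le_mul' le_rfl h1
      _ = (K' * K * B) * modulationNorm g p q s f + 2 * (K' * (B * K)) * η := by ring
      _ ≤ _ := by
          refine add_le_add (le_of_eq ?_) hη.le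
          rw [hBA]
          push_cast
          ring
  · obtain ⟨φ, hφ⟩ := exists_seq_of_mem_modulationSpace hf
    obtain ⟨F, R, hR, hb, hlim⟩ := exists_tendsto_fourier hg hp hp1 hq hφ
    have hφ0 : Tendsto (fun n => modulationNorm g p q s (f - (φ n : 𝓢'(Rd d, ℂ)))) atTop (𝓝 0) :=
      tendsto_of_tendsto_of_tendsto_of_le_of_le tendsto_const_nhds tendsto_inv_natCast_add_one
        (fun _ => zero_le) hφ
    have hone : IsTemperedFunction fun _ : Rd d => (1 : ℂ) := by
      have h1 : Integrable (fun x : Rd d => (1 + ‖x‖) ^ (-((d + 1 : ℕ) : ℝ))) :=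
        integrable_one_add_norm (by simp)
      refine ⟨d + 1, h1.ofReal.congr (Eventually.of_forall fun x => ?_)⟩
      beta_reduce
      rw [Real.rpow_neg (by positivity), Real.rpow_natCast, Complex.real_smul, mul_one]
      rfl
    -- Two limits of the same pairings are compared, one by convergence of distributions and one by
    -- dominated convergence. It is used with `U = 1` for `f` and with `U = σ` for `H f`, giving the
    -- same `F` in both.
    have key : ∀ (T : 𝓢'(Rd d, ℂ)) (S : ℕ → 𝓢'(Rd d, ℂ)) (c : 𝓢(Rd d, ℂ) → ℝ≥0∞)
        (U : Rd d → ℂ), (∀ ψ, c ψ ≠ ∞) → (∀ n ψ, ‖T ψ - S n ψ‖ₑ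
          ≤ c ψ * modulationNorm g p q s (f - (φ n : 𝓢'(Rd d, ℂ)))) → IsTemperedFunction U →
        (∀ n, Represents (𝓕 (S n)) fun t => U t * (𝓕 (φ n) : 𝓢(Rd d, ℂ)) t) →
        Represents (𝓕 T) fun t => U t * F t := by
      intro T S c U hc hTS hU hS
      obtain ⟨h1, h2⟩ := tendsto_integral_of_weight_mul_le hR hb hlim hU
      refine ⟨h1, fun ψ => tendsto_nhds_unique ?_ (h2 ψ)⟩
      have h3 : Tendsto (fun n => S n (𝓕 ψ : 𝓢(Rd d, ℂ))) atTop (𝓝 (T (𝓕 ψ : 𝓢(Rd d, ℂ)))) := by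
        rw [tendsto_iff_edist_tendsto_0]
        have h4 := ENNReal.Tendsto.const_mul (a := c (𝓕 ψ : 𝓢(Rd d, ℂ))) hφ0 (Or.inr (hc _))
        rw [mul_zero] at h4
        refine tendsto_of_tendsto_of_tendsto_of_le_of_le tendsto_const_nhds h4
          (fun _ => zero_le) fun n => ?_
        simp only
        rw [edist_comm, edist_eq_enorm_sub]
        exact hTS n _
      refine h3.congr fun n => ?_
      rw [← (hS n).2 ψ]
      rfl
    refine ⟨F, ?_, ?_⟩
    · have h1 := key f (fun n => (φ n : 𝓢'(Rd d, ℂ)))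
        (fun ψ => P₁ * ENNReal.ofReal (semi M₁ ψ)) (fun _ => 1)
        (fun ψ => ENNReal.mul_ne_top ENNReal.coe_ne_top ENNReal.ofReal_ne_top)
        (fun n ψ => hP₁ f hf (φ n) ψ) hone
        (fun n => by simpa using represents_fourier_schwartz (φ n))
      simpa using h1
    · refine key (H f) (fun n => D (φ n)) (fun ψ => P * ENNReal.ofReal (semi M ψ) * (B * K)) σ hBK
        (fun n ψ => ?_) hσ (fun n => represents_fourier_multiplierDist hσ (φ n))
      refine ((hHD f hf (φ n)).1 ψ).trans (le_of_eq ?_)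
      ring

end MainTheorem

end ModulationMultiplier

end

theorem proposition1 (d : ℕ) (hd : 1 ≤ d) (s γ : ℝ) (q : ℝ≥0∞) (hq : 0 < q) :
    -- the Banach case in `p`
    (∀ p : ℝ≥0∞, 1 ≤ p →
      ∀ g : 𝓢(Rd d, ℂ), IsModulationWindow p q g →
      ∀ w : 𝓢(Rd d, ℂ), IsAmalgamWindow 1 w →
      ∃ C : ℝ≥0, ∀ σ : Rd d → ℂ,
        MemAmalgam w 1 0 ∞ γ σ →
        ∃ H : 𝓢'(Rd d, ℂ) → 𝓢'(Rd d, ℂ),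
          IsBoundedExtension g p q s (s + γ) σ
            (C * amalgamNorm w 1 0 ∞ γ σ) H) ∧
    -- the quasi-Banach case in `p`
    (∀ p : ℝ≥0∞, 0 < p → p < 1 →
      ∀ g : 𝓢(Rd d, ℂ), IsModulationWindow p q g →
      ∀ w : 𝓢(Rd d, ℂ), IsAmalgamWindow p w →
      ∃ C : ℝ≥0, ∀ σ : Rd d → ℂ,
        MemAmalgam w p 0 ∞ γ σ →
        ∃ H : 𝓢'(Rd d, ℂ) → 𝓢'(Rd d, ℂ),
          IsBoundedExtension g p q s (s + γ) σ
            (C * amalgamNorm w p 0 ∞ γ σ) H ∧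
          ∀ f ∈ modulationSpace g p q s,
            IsMultiplierImage σ f (H f)) := by
  refine ⟨fun p hp g hg w hw => ?_, fun p hp0 hp g hg w hw => ?_⟩
  · obtain ⟨C, hC⟩ := exists_isBoundedExtension hg.1 hw.1 (one_pos.trans_le hp).ne' hq.ne' s γ
    rw [min_eq_left hp] at hC
    refine ⟨C, fun σ hσ => ?_⟩
    obtain ⟨H, hH, -⟩ := hC σ hσ
    exact ⟨H, hH⟩
  · obtain ⟨C, hC⟩ := exists_isBoundedExtension hg.1 hw.1 hp0.ne' hq.ne' s γ
    rw [min_eq_right hp.le] at hC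
    refine ⟨C, fun σ hσ => ?_⟩
    obtain ⟨H, hH, hH'⟩ := hC σ hσ
    exact ⟨H, hH, hH' hp.le⟩
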